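/- **Setting.** Let $N=\mathbb Z^n\subset N_{\mathbb R}=\mathbb R^n$. A rational polyhedron is a set $\{x: \langle a_i,x\rangle\le b_i,\ i=1,\dots,m\}$ with $a_i\in\mathbb Z^n$, $b_i\in\mathbb R$; for a polyhedron $\sigma$ let $N_\sigma$ be the group of all vectors of $N$ parallel to the affine span of $\sigma$. A *weighted complex* is a finite complex of non-empty rational polyhedra in which every facet (inclusion-maximal cell) $\sigma$ carries a multiplicity $\operatorname{mult}_X(\sigma)\in\mathbb Q$; its support $\operatorname{supp}X$ is the union of its facets with non-zero multiplicity. A *tropical cycle of codimension $p$* is a weighted complex $X$, all of whose facets have dimension $n-p$, that is *balanced*: for every cell $\tau$ of dimension $n-p-1$, $$\sum_{\sigma\supset\tau}\operatorname{mult}_X(\sigma)\,v_{\sigma/\tau}\in\operatorname{Span}_{\mathbb Q}(N_\tau),$$ where $\sigma$ runs over the facets containing $\tau$ and $v_{\sigma/\tau}\in N\cap\operatorname{link}_\tau(\sigma)$ generates $N_\sigma$ together with $N_\tau$. The empty complex (the zero cycle) is a tropical cycle of every codimension. For $v\in\sigma$ let $\operatorname{link}_v(\sigma)=\{u: \exists\delta>0\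 \forall\varepsilon\in[0,\delta]:\ v+\varepsilon u\in\sigma\}$, let $\operatorname{link}_v(X)$ be the complex of all $\operatorname{link}_v(\sigma)$, $v\in\sigma\in X$, with inherited multiplicities, and let $\operatorname{link}_\gamma$ denote the link at a relative interior point of $\gamma$. **Stable intersection.** Let $X$, $Y$ be tropical cycles in $\mathbb R^n$ of codimensions $p$ and $q$. Put $$S(X,Y)=\{\omega\in\mathbb R^n:\ \operatorname{supp}(\operatorname{link}_\omega X)-\operatorname{supp}(\operatorname{link}_\omega Y)=\mathbb R^n\}\quad\text{(Minkowski difference)}.$$ For a cell $\gamma$ of the common refinement $\{\sigma_1\cap\sigma_2\ne\emptyset:\sigma_1\in X,\sigma_2\in Y\}$ of codimension $p+q$, let $\operatorname{mult}(\gamma)$ be the value, for generic $v\in\mathbb R^n$, of $$\sum_{\sigma,\tau}\operatorname{mult}(\sigma)\operatorname{mult}(\tau)\,[N:N_\sigma+N_\tau],$$ the sum being over all pairs of facets $\sigma$ of $\operatorname{link}_\gamma(X)$ and $\tau$ of $\operatorname{link}_\gamma(Y)$ with $v\in\sigma-\tau$. The *stable intersection* $X\cdot Y$ is the weighted complex whose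 facets are the cells $\gamma\subseteq S(X,Y)$ of the common refinement that have codimension $p+q$ and $\operatorname{mult}(\gamma)\neq0$, with these multiplicities; its cells are these $\gamma$ and all their non-empty faces. **Theorem.** Let $X$ and $Y$ be tropical cycles in $\mathbb R^n$ of codimensions $p$ and $q$. 1. The multiplicities are well defined: for every cell $\gamma$ of codimension $p+q$ of the common refinement, the above sum is constant on a dense open set of vectors $v$. 2. $X\cdot Y$ is a (possibly zero) tropical cycle, in particular balanced, and $$\operatorname{codim}(X\cdot Y)=p+q=\operatorname{codim}(X)+\operatorname{codim}(Y).$$ 3. If all multiplicities of $X$ and $Y$ are integers, so are those of $X\cdot Y$. 4. If all multiplicities of $X$ and $Y$ are non-negative, then $\operatorname{supp}(X\cdot Y)=S(X,Y)$; thus $S(X,Y)$ is empty or pure of codimension $p+q$. -/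

import Mathlib

open scoped Pointwise

noncomputable section

namespace Trop

/-- The inclusion of the lattice `N = ℤⁿ` in `N_ℝ = ℝⁿ`. -/
def incl (n : ℕ) : (Fin n → ℤ) →+ (Fin n → ℝ) :=
  (Int.castAddHom ℝ).compLeft (Fin n)

/-- Rational polyhedra: finitely many weak linear inequalities with integral normal vectors
and real right-hand sides. -/
def IsRationalPolyhedron {n : ℕ} (σ : Set (Fin n → ℝ)) : Prop :=
  ∃ (m : ℕ) (a : Fin m → Fin n → ℤ) (b : Fin m → ℝ),
    σ = {x | ∀ i, ∑ j, (a i j : ℝ) * x j ≤ b i}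

/-- `τ` is a nonempty face of the polyhedron `σ`: the set of points of `σ` at which some linear
functional attains its maximum over `σ` (`σ` itself is a face). -/
def IsFace {n : ℕ} (σ τ : Set (Fin n → ℝ)) : Prop :=
  τ.Nonempty ∧ IsExposed ℝ σ τ

/-- The dimension of the affine span of `σ`. -/
def dim {n : ℕ} (σ : Set (Fin n → ℝ)) : ℕ :=
  Module.finrank ℝ (vectorSpan ℝ σ)

/-- `N_σ`: the lattice vectors that are parallel to the affine span of `σ`. -/
def latticeOf {n : ℕ} (σ : Set (Fin n → ℝ)) : AddSubgroup (Fin n → ℤ) :=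
  (vectorSpan ℝ σ).toAddSubgroup.comap (incl n)

/-- `link_v(σ)`, the link of `σ` at the point `v`. -/
def linkCone {n : ℕ} (v : Fin n → ℝ) (σ : Set (Fin n → ℝ)) : Set (Fin n → ℝ) :=
  {u | ∃ δ : ℝ, 0 < δ ∧ ∀ ε ∈ Set.Icc (0 : ℝ) δ, v + ε • u ∈ σ}

/-- `link_τ(σ)`, the link of `σ` at the points `w` of the relative interior of `τ`. For a polyhedron
`σ` and a convex `τ ⊆ σ` all the cones `link_w(σ)` in this union are equal; for `τ = {v}` the
union is `link_v(σ)`. -/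
def linkAlong {n : ℕ} (τ σ : Set (Fin n → ℝ)) : Set (Fin n → ℝ) :=
  ⋃ w ∈ intrinsicInterior ℝ τ, linkCone w σ

/-- A family of cells with a rational number attached to every set; only the values of `mult` on
the facets (the inclusion-maximal cells) matter. -/
structure WeightedComplex (n : ℕ) where
  cells : Set (Set (Fin n → ℝ))
  mult : Set (Fin n → ℝ) → ℚ

namespace WeightedComplex

variable {n : ℕ}

/-- The facets are the inclusion-maximal cells. -/
def IsFacet (X : WeightedComplex n) (σ : Set (Fin n → ℝ)) : Prop :=
  Maximal (fun ρ => ρ ∈ X.cells) σ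

/-- The support: the union of the facets with non-zero multiplicity. -/
def supp (X : WeightedComplex n) : Set (Fin n → ℝ) :=
  {x | ∃ σ, X.IsFacet σ ∧ X.mult σ ≠ 0 ∧ x ∈ σ}

/-- The cells form a finite rational polyhedral complex. -/
structure IsPolyhedralComplex (X : WeightedComplex n) : Prop where
  finite : X.cells.Finite
  nonempty : ∀ σ ∈ X.cells, σ.Nonempty
  rational : ∀ σ ∈ X.cells, IsRationalPolyhedron σ
  face_mem : ∀ σ ∈ X.cells, ∀ τ, IsFace σ τ → τ ∈ X.cells
  inter_face : ∀ σ ∈ X.cells, ∀ τ ∈ X.cells, (σ ∩ τ).Nonempty →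
    IsFace σ (σ ∩ τ) ∧ IsFace τ (σ ∩ τ)

/-- Pure of codimension `p` in `ℝⁿ`: every facet has dimension `n - p`. The empty complex is pure
of every codimension. -/
def IsPureOfCodim (X : WeightedComplex n) (p : ℕ) : Prop :=
  ∀ σ, X.IsFacet σ → dim σ + p = n

/-- The lattice vector `v` can serve as `v_{σ/τ}`: it lies in `link_τ(σ)` and generates `N_σ`
together with `N_τ`. -/
def IsLatticeNormal (σ τ : Set (Fin n → ℝ)) (v : Fin n → ℤ) : Prop :=
  incl n v ∈ linkAlong τ σ ∧ latticeOf τ ⊔ AddSubgroup.zmultiples v = latticeOf σ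

/-- The balancing condition at every ridge `τ` of a complex that is pure of codimension `p`. -/
def IsBalanced (X : WeightedComplex n) (p : ℕ) : Prop :=
  ∀ τ ∈ X.cells, dim τ + 1 + p = n →
    ∃ v : Set (Fin n → ℝ) → (Fin n → ℤ),
      (∀ σ, X.IsFacet σ → τ ⊆ σ → IsLatticeNormal σ τ (v σ)) ∧
      (∑ᶠ (σ : Set (Fin n → ℝ)) (_ : X.IsFacet σ ∧ τ ⊆ σ), X.mult σ • incl n (v σ)) ∈
        Submodule.span ℚ (incl n '' (latticeOf τ : Set (Fin n → ℤ)))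

/-- Tropical cycles of codimension `p` in `ℝⁿ`. -/
structure IsTropicalCycle (X : WeightedComplex n) (p : ℕ) : Prop where
  isPolyhedralComplex : X.IsPolyhedralComplex
  pure : X.IsPureOfCodim p
  balanced : X.IsBalanced p

/-- `link_γ(X)`, with inherited multiplicities; `X.link {ω}` is the link at the point `ω`.
In a polyhedral complex the sum has exactly one term for every facet of the link. -/
def link (X : WeightedComplex n) (γ : Set (Fin n → ℝ)) : WeightedComplex n where
  cells := {C | ∃ σ ∈ X.cells, γ ⊆ σ ∧ C = linkAlong γ σ}
  mult C := ∑ᶠ (σ : Set (Fin n → ℝ)) (_ : X.IsFacet σ ∧ γ ⊆ σ ∧ C = linkAlong γ σ), X.mult σ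

/-- The reflection `-X`. -/
def reflect (X : WeightedComplex n) : WeightedComplex n where
  cells := {C | -C ∈ X.cells}
  mult C := X.mult (-C)

/-- The multiplicity of `A + B` at a generic point `v`, where `A + B` is full-dimensional (so that
the lattice `N_v` is `N = ℤⁿ`): the sum over all pairs of facets with `v ∈ σ₁ + σ₂` of
`mult σ₁ * mult σ₂ * [N : N_{σ₁} + N_{σ₂}]`. -/
def sumMult (A B : WeightedComplex n) (v : Fin n → ℝ) : ℚ :=
  ∑ᶠ (P : Set (Fin n → ℝ) × Set (Fin n → ℝ))
    (_ : A.IsFacet P.1 ∧ B.IsFacet P.2 ∧ v ∈ P.1 + P.2),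
    A.mult P.1 * B.mult P.2 * ((latticeOf P.1 ⊔ latticeOf P.2).index : ℚ)

/-- The cells of the common refinement `X ∩ Y`. -/
def commonCells (X Y : WeightedComplex n) : Set (Set (Fin n → ℝ)) :=
  {γ | γ.Nonempty ∧ ∃ σ₁ ∈ X.cells, ∃ σ₂ ∈ Y.cells, γ = σ₁ ∩ σ₂}

/-- The set of all `ω` for which the Minkowski sum `link_ω X - link_ω Y` is all of `ℝⁿ`. -/
def stableSet (X Y : WeightedComplex n) : Set (Fin n → ℝ) :=
  {ω | (X.link {ω}).supp + (Y.link {ω}).reflect.supp = Set.univ}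

end WeightedComplex

/-- `f` is equal to the constant `m` on a dense open subset of `ℝⁿ`. -/
def IsGenericValue {n : ℕ} (f : (Fin n → ℝ) → ℚ) (m : ℚ) : Prop :=
  ∃ U : Set (Fin n → ℝ), IsOpen U ∧ Dense U ∧ ∀ v ∈ U, f v = m

open Classical in
/-- The (unique) generic value of `f`; `0` if there is none. -/
def genericValue {n : ℕ} (f : (Fin n → ℝ) → ℚ) : ℚ :=
  if h : ∃ m, IsGenericValue f m then h.choose else 0

namespace WeightedComplex

variable {n : ℕ}

/-- The multiplicity of `γ` in `X · Y`: the generic multiplicity of `link_γ X - link_γ Y`. -/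
def stableMult (X Y : WeightedComplex n) (γ : Set (Fin n → ℝ)) : ℚ :=
  genericValue (sumMult (X.link γ) (Y.link γ).reflect)

/-- The cells of the common refinement that lie in `stableSet X Y`, have codimension `p + q`, and
have non-zero multiplicity. -/
def IsStableFacet (X Y : WeightedComplex n) (p q : ℕ) (γ : Set (Fin n → ℝ)) : Prop :=
  γ ∈ commonCells X Y ∧ γ ⊆ stableSet X Y ∧ dim γ + (p + q) = n ∧ stableMult X Y γ ≠ 0

/-- The stable intersection of `X` (of codimension `p`) and `Y` (of codimension `q`): the weighted
complex that consists of the cells of `IsStableFacet` and all their faces. -/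
def stableIntersection (X Y : WeightedComplex n) (p q : ℕ) : WeightedComplex n where
  cells := {δ | ∃ γ, IsStableFacet X Y p q γ ∧ IsFace γ δ}
  mult := stableMult X Y

end WeightedComplex

end Trop

end

/-! Everything follows from one invariance principle: a linear map `L` from a balanced family of
polyhedral cones to a space `W` of the same dimension has a degree. Weight each cone by its
multiplicity times the lattice index of its image; the weighted number of cones whose image contains
a point is the same for all generic points. Indeed, two generic points can be joined by a segment
that avoids the codimension two intersections of walls. Where it meets a wall it crosses images of
ridges only. A cone adjacent to such a ridge contributes a jump proportional to the value of a
functional on its lattice normal, and balancing makes these jumps cancel (`exists_generic_count`,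
`exists_generic_degree`).

The principle is applied at a point `w` to the products of a tangent cone of `X` and a tangent cone
of `Y`, with the map `(x, y) ↦ (x - y, M x)`, where `M` is integral with values in a space of
dimension `n - p - q`. A ridge of a product is a ridge times the interior of a facet, so balancing
is inherited from `X` or from `Y` (`exists_generic_pairDegree`). The degree is read off at points
`(e v, u)` with `u` and `v` generic and `e` tending to `0` from above. There a pair `σ, τ` counts
exactly if `u` is hit by `M` on the tangent cone of `γ = σ ∩ τ`, this `γ` has codimension `p + q`,
and `v` lies in the difference of the links along `γ`. The lattice index factors as `[N : N_σ +
N_τ]` times the index of `M N_γ` (`index_map_subProd`). Hence the sum, over the cells `γ` at `w`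
that are hit at `u`, of the index of `M N_γ` times the multiplicity sum of `γ` at `v` depends on
neither `u` nor `v` (`exists_generic_stableDegree`).

The choice of `w` and `M` gives the assertions. If `w` is a relative interior point of `γ` and `M`
is an isomorphism on its span, the sum has one term, and the multiplicity of `γ` is well defined. If
`w` is a relative interior point of a cell `τ` of one dimension less and `M` is replaced by `(l,
M)`, with `l` zero on `τ` and `M` an isomorphism on its span, then comparing `u` with `-u` shows
that `l` kills the weighted sum of lattice normals; as `l` varies, this is balancing. If all
multiplicities are non-negative and `w` is in the stable set, a transverse pair of facets makes the
degree positive, so some cell through `w` has non-zero multiplicity. -/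

open Filter Topology

namespace Trop

/-! ### Generic points: the filter of complements of hyperplanes -/

section Generic

variable {V W : Type*} [AddCommGroup V] [Module ℝ V] [AddCommGroup W] [Module ℝ W]

/-- The filter generated by the complements of linear hyperplanes. -/
def generic (W : Type*) [AddCommGroup W] [Module ℝ W] : Filter W :=
  ⨅ l : {l : Module.Dual ℝ W // l ≠ 0}, 𝓟 {x | l.1 x ≠ 0}

theorem generic_ne {l : Module.Dual ℝ W} (hl : l ≠ 0) : ∀ᶠ x in generic W, l x ≠ 0 :=
  mem_iInf_of_mem (⟨l, hl⟩ : {l : Module.Dual ℝ W // l ≠ 0}) (mem_principal_self _)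

theorem le_generic {F : Filter W} (h : ∀ l : Module.Dual ℝ W, l ≠ 0 → ∀ᶠ x in F, l x ≠ 0) :
    F ≤ generic W :=
  le_iInf fun l => le_principal_iff.2 (h l.1 l.2)

theorem exists_finite_of_mem_generic {s : Set W} (hs : s ∈ generic W) :
    ∃ t : Set (Module.Dual ℝ W), t.Finite ∧ (∀ l ∈ t, l ≠ 0) ∧ {x | ∀ l ∈ t, l x ≠ 0} ⊆ s := by
  obtain ⟨t, ht, hts⟩ := (hasBasis_iInf_principal_finite
    (fun l : {l : Module.Dual ℝ W // l ≠ 0} => {x : W | l.1 x ≠ 0})).mem_iff.1 hs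
  refine ⟨Subtype.val '' t, ht.image _, ?_, fun x hx => hts ?_⟩
  · rintro _ ⟨l, -, rfl⟩
    exact l.2
  · simp only [Set.mem_iInter]
    exact fun l hl => hx l.1 ⟨l, hl, rfl⟩

/-- A real vector space is not a finite union of hyperplanes. -/
instance : (generic W).NeBot := by
  refine ⟨fun h => ?_⟩
  obtain ⟨t, ht, hne, hts⟩ := exists_finite_of_mem_generic (W := W) (s := ∅) (by rw [h]; trivial)
  have := ht.to_subtype
  obtain ⟨x, -, hx⟩ := Module.Dual.exists_forall_mem_ne_zero_of_forall_exists (K := ℝ) (M := W) ⊤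
    (fun l : t => l.1) (fun l => by
      by_contra hc
      push Not at hc
      exact hne l.1 l.2 (LinearMap.ext fun x => hc x trivial))
  exact hts (a := x) (fun l hl => hx ⟨l, hl⟩)

theorem generic_notMem {U : Submodule ℝ W} (hU : U ≠ ⊤) : ∀ᶠ x in generic W, x ∉ U := by
  obtain ⟨l, hl, hle⟩ := Submodule.exists_le_ker_of_lt_top U (lt_top_iff_ne_top.2 hU)
  filter_upwards [generic_ne hl] with x hx hxU
  exact hx (hle hxU)

theorem eventually_affine_ne {a b : ℝ} (hb : b ≠ 0) :
    ∀ᶠ e : ℝ in 𝓝[>] 0, a + e * b ≠ 0 := by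
  by_cases ha : a = 0
  · filter_upwards [self_mem_nhdsWithin] with e he
    rw [ha, zero_add]
    exact mul_ne_zero (ne_of_gt he) hb
  · have : Tendsto (fun e : ℝ => a + e * b) (𝓝[>] 0) (𝓝 (a + 0 * b)) :=
      ((by fun_prop : Continuous fun e : ℝ => a + e * b).tendsto 0).mono_left nhdsWithin_le_nhds
    exact this.eventually_ne (by simpa using ha)

theorem eventually_affine_le (a b c : ℝ) :
    ∀ᶠ e : ℝ in 𝓝[>] 0, (a + e * b ≤ c ↔ a ≤ c ∧ (a = c → b ≤ 0)) := by
  have ht : Tendsto (fun e : ℝ => a + e * b) (𝓝[>] 0) (𝓝 a) := by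
    have h := ((by fun_prop : Continuous fun e : ℝ => a + e * b).tendsto 0).mono_left
      (nhdsWithin_le_nhds (s := Set.Ioi (0 : ℝ)))
    simpa using h
  rcases lt_trichotomy a c with h | h | h
  · filter_upwards [ht.eventually_lt_const h] with e he
    exact ⟨fun _ => ⟨h.le, fun h' => absurd h' h.ne⟩, fun _ => he.le⟩
  · subst h
    filter_upwards [self_mem_nhdsWithin] with e he
    have he : (0 : ℝ) < e := he
    simp only [add_le_iff_nonpos_right, le_refl, true_imp_iff, true_and]
    constructor
    · intro h
      by_contra hb
      exact absurd (mul_pos he (not_le.1 hb)) (not_lt.2 h)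
    · intro h
      exact mul_nonpos_of_nonneg_of_nonpos he.le h
  · filter_upwards [ht.eventually_const_lt h] with e he
    exact ⟨fun h' => absurd h' (not_le.2 he), fun h' => absurd h'.1 (not_le.2 h)⟩

/-- Genericity can be tested on one functional at a time, and a functional that does not vanish at
`z` vanishes at most once on the line through `c` in direction `z`. Thus any point, however special,
is approached through generic ones. -/
theorem generic_line (c : W) {P : W → Prop} (h : ∀ᶠ z in generic W, P z) :
    ∀ᶠ z in generic W, ∀ᶠ e : ℝ in 𝓝[>] 0, P (c + e • z) := by
  have : Filter.bind (generic W) (fun z => map (fun e : ℝ => c + e • z) (𝓝[>] 0)) ≤ generic W :=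
    le_generic fun l hl => by
      change ∀ᶠ z in generic W, ∀ᶠ e : ℝ in 𝓝[>] 0, l (c + e • z) ≠ 0
      filter_upwards [generic_ne hl] with z hz
      simpa using eventually_affine_ne (a := l c) hz
  exact this h

/-- A non-zero functional `l` takes the value `l (0, u) + e * l (v, 0)`. If it is non-zero on the
second factor, a generic `u` suffices; otherwise a generic `v` does. The order of the quantifiers
permits an infinitesimal first coordinate. -/
theorem generic_prod {P : V × W → Prop} (h : ∀ᶠ z in generic (V × W), P z) :
    ∀ᶠ u in generic W, ∀ᶠ v in generic V, ∀ᶠ e : ℝ in 𝓝[>] 0, P (e • v, u) := by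
  have : Filter.bind (generic W) (fun u => Filter.bind (generic V)
      (fun v => map (fun e : ℝ => (e • v, u)) (𝓝[>] 0))) ≤ generic (V × W) :=
    le_generic fun l hl => by
      change ∀ᶠ u in generic W, ∀ᶠ v in generic V, ∀ᶠ e : ℝ in 𝓝[>] 0, l (e • v, u) ≠ 0
      have key : ∀ u v (e : ℝ), l (e • v, u) = l (0, u) + e * l (v, 0) := fun u v e => by
        rw [← smul_eq_mul, ← map_smul, ← map_add]
        simp
      by_cases hk : l ∘ₗ LinearMap.inr ℝ V W = 0
      · have hm : l ∘ₗ LinearMap.inl ℝ V W ≠ 0 := fun hm => hl (LinearMap.prod_ext hm hk)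
        refine .of_forall fun u => ?_
        filter_upwards [generic_ne hm] with v hv
        simp only [key]
        exact eventually_affine_ne hv
      · filter_upwards [generic_ne hk] with u hu
        refine .of_forall fun v => ?_
        simp only [key]
        by_cases hv : l (v, 0) = 0
        · simpa [hv] using hu
        · exact eventually_affine_ne hv
  exact this h

theorem generic_neg {P : W → Prop} (h : ∀ᶠ z in generic W, P z) :
    ∀ᶠ z in generic W, P (-z) := by
  have : map (fun z : W => -z) (generic W) ≤ generic W := le_generic fun l hl => by
    change ∀ᶠ z in generic W, l (-z) ≠ 0
    filter_upwards [generic_ne hl] with z hz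
    simpa using hz
  exact this h

theorem exists_isOpen_dense_of_generic {n : ℕ} {s : Set (Fin n → ℝ)}
    (hs : s ∈ generic (Fin n → ℝ)) : ∃ U ⊆ s, IsOpen U ∧ Dense U := by
  obtain ⟨t, ht, hne, hts⟩ := exists_finite_of_mem_generic hs
  refine ⟨_, hts, ?_, ?_⟩
  · have : {x : Fin n → ℝ | ∀ l ∈ t, l x ≠ 0} = ⋂ l ∈ t, {x | l x ≠ 0} := by ext; simp
    rw [this]
    exact ht.isOpen_biInter fun l _ =>
      isOpen_ne_fun (LinearMap.continuous_of_finiteDimensional l) continuous_const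
  · have hg : {x : Fin n → ℝ | ∀ l ∈ t, l x ≠ 0} ∈ generic (Fin n → ℝ) := by
      have := (ht.eventually_all (l := generic (Fin n → ℝ))
        (p := fun l x => l x ≠ 0)).2 fun l hl => generic_ne (hne l hl)
      exact this
    intro x
    obtain ⟨z, hz⟩ := (generic_line x hg).exists
    refine mem_closure_of_tendsto (f := fun e : ℝ => x + e • z) (b := 𝓝[>] 0) ?_ hz
    have h := ((by fun_prop : Continuous fun e : ℝ => x + e • z).tendsto 0).mono_left
      (nhdsWithin_le_nhds (s := Set.Ioi (0 : ℝ)))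
    simpa using h

end Generic

/-! ### Constancy of a weighted count along a generic segment -/

section Degree

variable {W ι : Type*} [AddCommGroup W] [Module ℝ W]

/-- The direction `u` points from `x` into the cone `{y | ∀ φ ∈ Φ, φ y ≤ 0}`. -/
def PointsInto (Φ : Finset (Module.Dual ℝ W)) (x u : W) : Prop :=
  ∀ φ ∈ Φ, φ x ≤ 0 ∧ (φ x = 0 → φ u ≤ 0)

/-- Just after leaving `x` in direction `u`, a functional that vanishes at the current point also
vanishes at `u`. The condition on the direction is then empty, and looking forwards or backwards
gives the same answer. -/
theorem eventually_pointsInto (Φ : Finset (Module.Dual ℝ W)) (x u : W) :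
    ∀ᶠ e : ℝ in 𝓝[>] 0, (PointsInto Φ (x + e • u) u ↔ PointsInto Φ x u) ∧
      (PointsInto Φ (x + e • u) (-u) ↔ PointsInto Φ x u) := by
  have h1 : ∀ᶠ e : ℝ in 𝓝[>] 0, ∀ φ ∈ Φ, (φ (x + e • u) ≤ 0 ↔ φ x ≤ 0 ∧ (φ x = 0 → φ u ≤ 0)) ∧
      (φ (x + e • u) = 0 → φ u = 0) := by
    refine (Finset.eventually_all Φ).2 fun φ _ => ?_
    simp only [map_add, map_smul, smul_eq_mul]
    by_cases hb : φ u = 0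
    · filter_upwards [eventually_affine_le (φ x) (φ u) 0] with e he
      exact ⟨he, fun _ => hb⟩
    · filter_upwards [eventually_affine_le (φ x) (φ u) 0, eventually_affine_ne (a := φ x) hb]
        with e he he'
      exact ⟨he, fun h => absurd h he'⟩
  filter_upwards [h1] with e he
  constructor <;> refine forall₂_congr fun φ hφ => ?_
  · rw [← (he φ hφ).1]
    exact and_iff_left fun h => ((he φ hφ).2 h).le
  · rw [← (he φ hφ).1, map_neg]
    exact and_iff_left fun h => by rw [(he φ hφ).2 h, neg_zero]

theorem eventually_nhds_of_right_left {P : ℝ → Prop} {t : ℝ} (h0 : P t)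
    (h : ∀ᶠ e : ℝ in 𝓝[>] 0, P (t + e) ∧ P (t - e)) : ∀ᶠ s in 𝓝 t, P s := by
  obtain ⟨d, hd, hP⟩ := mem_nhdsGT_iff_exists_Ioo_subset.1 h
  rw [Set.mem_Ioi] at hd
  filter_upwards [Metric.ball_mem_nhds t hd] with s hs
  rw [Metric.mem_ball, Real.dist_eq] at hs
  rcases lt_trichotomy s t with h1 | h1 | h1
  · rw [abs_of_neg (by linarith)] at hs
    have := (hP (a := t - s) ⟨by linarith, by linarith⟩).2
    simpa using this
  · exact h1 ▸ h0
  · rw [abs_of_pos (by linarith)] at hs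
    have := (hP (a := s - t) ⟨by linarith, by linarith⟩).1
    simpa using this

open Classical in
/-- A weighted count of polyhedral cones whose value does not change across the walls is
generically constant. -/
theorem exists_generic_count (I : Finset ι) (Φ : ι → Finset (Module.Dual ℝ W)) (c : ι → ℝ)
    (hcross : ∀ x : W, (∀ i ∈ I, (∀ φ ∈ Φ i, φ x ≤ 0) → ∀ φ ∈ Φ i, ∀ ψ ∈ Φ i, φ ≠ 0 → φ x = 0 →
        ψ x = 0 → ∃ a : ℝ, ψ = a • φ) → ∀ u : W,
      (∑ i ∈ I, if PointsInto (Φ i) x u then c i else 0) =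
        ∑ i ∈ I, if PointsInto (Φ i) x (-u) then c i else 0) :
    ∃ m : ℝ, ∀ᶠ v in generic W, (∑ i ∈ I, if ∀ φ ∈ Φ i, φ v ≤ 0 then c i else 0) = m := by
  have hg0 : ∀ᶠ v : W in generic W, ∀ i ∈ I, ∀ φ ∈ Φ i, φ ≠ 0 → φ v ≠ 0 := by
    refine (Finset.eventually_all I).2 fun i _ => (Finset.eventually_all (Φ i)).2 fun φ _ => ?_
    by_cases h : φ = 0
    · exact .of_forall fun v h' => absurd h h'
    · filter_upwards [generic_ne h] with v hv _ using hv
  obtain ⟨v0, hv0⟩ := hg0.exists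
  -- `φ v0 • ψ - ψ v0 • φ` vanishes at `v0` and wherever both `φ` and `ψ` vanish. If it is non-zero
  -- at `v1`, the line through `v0` and `v1` meets its kernel only at `v0`, and so misses the
  -- intersection of two distinct walls.
  have hg1 : ∀ᶠ v : W in generic W, ∀ i ∈ I, ∀ φ ∈ Φ i, ∀ ψ ∈ Φ i,
      φ v0 • ψ - ψ v0 • φ ≠ 0 → (φ v0 • ψ - ψ v0 • φ) v ≠ 0 := by
    refine (Finset.eventually_all I).2 fun i _ => (Finset.eventually_all (Φ i)).2 fun φ _ =>
      (Finset.eventually_all (Φ i)).2 fun ψ _ => ?_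
    by_cases h : φ v0 • ψ - ψ v0 • φ = 0
    · exact .of_forall fun v h' => absurd h h'
    · filter_upwards [generic_ne h] with v hv _ using hv
  refine ⟨∑ i ∈ I, if ∀ φ ∈ Φ i, φ v0 ≤ 0 then c i else 0, ?_⟩
  filter_upwards [hg0, hg1] with v1 hv1 hv01
  set u := v1 - v0 with hu
  have hgood : ∀ t : ℝ, ∀ i ∈ I, ∀ φ ∈ Φ i, ∀ ψ ∈ Φ i, φ ≠ 0 → φ (v0 + t • u) = 0 →
      ψ (v0 + t • u) = 0 → ∃ a : ℝ, ψ = a • φ := by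
    intro t i hi φ hφ ψ hψ h0 h1 h2
    have hφ0 := hv0 i hi φ hφ h0
    by_cases hd : φ v0 • ψ - ψ v0 • φ = 0
    · refine ⟨(φ v0)⁻¹ * ψ v0, ?_⟩
      rw [mul_smul, ← sub_eq_zero.1 hd, smul_smul, inv_mul_cancel₀ hφ0, one_smul]
    · exfalso
      have hd1 := hv01 i hi φ hφ ψ hψ hd
      have hx : (φ v0 • ψ - ψ v0 • φ) (v0 + t • u) = 0 := by simp [-map_add, h1, h2]
      have h00 : (φ v0 • ψ - ψ v0 • φ) v0 = 0 := by simp; ring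
      rw [map_add, map_smul, hu, map_sub, h00] at hx
      have ht : t = 0 := by
        rw [zero_add, sub_zero, smul_eq_mul] at hx
        exact (mul_eq_zero.1 hx).resolve_right hd1
      rw [ht] at h1
      exact hφ0 (by simpa using h1)
  -- `H t` is the count immediately after `t`. It is locally constant to the right by construction;
  -- immediately before `t` the count is the one in direction `-u`, and `hcross` identifies the two.
  -- At `0` and `1` no wall is met and `H` is the plain count.
  let H : ℝ → ℝ := fun t => ∑ i ∈ I, if PointsInto (Φ i) (v0 + t • u) u then c i else 0
  have hloc : IsLocallyConstant H := by
    refine (IsLocallyConstant.iff_eventually_eq _).2 fun t => ?_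
    refine eventually_nhds_of_right_left rfl ?_
    have e1 := (Finset.eventually_all I).2 fun i (_ : i ∈ I) =>
      eventually_pointsInto (Φ i) (v0 + t • u) u
    have e2 := (Finset.eventually_all I).2 fun i (_ : i ∈ I) =>
      eventually_pointsInto (Φ i) (v0 + t • u) (-u)
    filter_upwards [e1, e2] with e he1 he2
    constructor
    · refine Finset.sum_congr rfl fun i hi => ?_
      have := (he1 i hi).1
      rw [show v0 + (t + e) • u = v0 + t • u + e • u by module]
      simp only [this]
    · have hc := hcross (v0 + t • u) (fun i hi _ => hgood t i hi) u
      change (∑ i ∈ I, _) = ∑ i ∈ I, _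
      rw [hc]
      refine Finset.sum_congr rfl fun i hi => ?_
      have := (he2 i hi).2
      rw [neg_neg] at this
      rw [show v0 + (t - e) • u = v0 + t • u + e • (-u) by module]
      simp only [this]
  have hend : ∀ t : ℝ, (∀ i ∈ I, ∀ φ ∈ Φ i, φ ≠ 0 → φ (v0 + t • u) ≠ 0) →
      H t = ∑ i ∈ I, if ∀ φ ∈ Φ i, φ (v0 + t • u) ≤ 0 then c i else 0 := fun t ht => by
    refine Finset.sum_congr rfl fun i hi => ?_
    congr 1
    refine propext (forall₂_congr fun φ hφ => and_iff_left fun h => ?_)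
    by_cases h0 : φ = 0
    · simp [h0]
    · exact absurd h (ht i hi φ hφ h0)
  have h01 := hloc.apply_eq_of_preconnectedSpace 1 0
  rw [hend 1 (by simpa [hu] using hv1), hend 0 (by simpa using hv0)] at h01
  simpa [hu] using h01

end Degree

/-! ### Polyhedra, tangent cones and lineality spaces -/

section TangentCone

variable {V W : Type*} [AddCommGroup V] [Module ℝ V] [AddCommGroup W] [Module ℝ W]

/-- Finite intersections of closed half-spaces. -/
def IsPoly (σ : Set V) : Prop :=
  ∃ A : Finset (Module.Dual ℝ V × ℝ), σ = {x | ∀ a ∈ A, a.1 x ≤ a.2}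

/-- Finite intersections of closed linear half-spaces. -/
def IsPolyCone (σ : Set V) : Prop :=
  ∃ A : Finset (Module.Dual ℝ V), σ = {x | ∀ a ∈ A, a x ≤ 0}

/-- The directions in which one can leave `y` without leaving `σ` at once. -/
def tcone (y : V) (σ : Set V) : Set V :=
  {z | ∀ᶠ e : ℝ in 𝓝[>] 0, y + e • z ∈ σ}

/-- The lineality space of `tcone y σ`. -/
def lin (y : V) (σ : Set V) : Submodule ℝ V :=
  Submodule.span ℝ {z | z ∈ tcone y σ ∧ -z ∈ tcone y σ}

/-- `w` lies in the algebraic relative interior of the convex set `γ`. -/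
def InRel (w : V) (γ : Set V) : Prop :=
  w ∈ γ ∧ ∀ x ∈ γ, ∃ d : ℝ, 0 < d ∧ w + d • (w - x) ∈ γ

theorem mem_tcone {y z : V} {σ : Set V} :
    z ∈ tcone y σ ↔ ∀ᶠ e : ℝ in 𝓝[>] 0, y + e • z ∈ σ := Iff.rfl

theorem tcone_mono {y : V} {σ τ : Set V} (h : σ ⊆ τ) : tcone y σ ⊆ tcone y τ :=
  fun _ hz => (mem_tcone.1 hz).mono fun _ he => h he

theorem tcone_inter (y : V) (σ τ : Set V) : tcone y (σ ∩ τ) = tcone y σ ∩ tcone y τ :=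
  Set.ext fun _ => by
    simp only [mem_tcone, Set.mem_inter_iff, eventually_and]

theorem tcone_prod (y : V × W) (σ : Set V) (τ : Set W) :
    tcone y (σ ×ˢ τ) = tcone y.1 σ ×ˢ tcone y.2 τ :=
  Set.ext fun _ => by
    simp only [mem_tcone, Set.mem_prod, Prod.fst_add, Prod.snd_add, Prod.smul_fst, Prod.smul_snd,
      eventually_and]

theorem lin_mono {y : V} {σ τ : Set V} (h : σ ⊆ τ) : lin y σ ≤ lin y τ :=
  Submodule.span_mono fun _ hz => ⟨tcone_mono h hz.1, tcone_mono h hz.2⟩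

theorem IsPolyCone.isPoly {σ : Set V} (h : IsPolyCone σ) : IsPoly σ := by
  classical
  obtain ⟨A, rfl⟩ := h
  exact ⟨A.image fun a => (a, 0), by ext; simp⟩

theorem IsPoly.inter {σ τ : Set V} (h : IsPoly σ) (h' : IsPoly τ) : IsPoly (σ ∩ τ) := by
  classical
  obtain ⟨A, rfl⟩ := h
  obtain ⟨B, rfl⟩ := h'
  refine ⟨A ∪ B, ?_⟩
  ext x
  simp only [Set.mem_inter_iff, Set.mem_ofPred_eq, Finset.mem_union]
  exact ⟨fun h a ha => ha.elim (h.1 a) (h.2 a), fun h => ⟨fun a ha => h a (.inl ha),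
    fun a ha => h a (.inr ha)⟩⟩

theorem IsPolyCone.prod {σ : Set V} {τ : Set W} (h : IsPolyCone σ) (h' : IsPolyCone τ) :
    IsPolyCone (σ ×ˢ τ) := by
  classical
  obtain ⟨A, rfl⟩ := h
  obtain ⟨B, rfl⟩ := h'
  refine ⟨A.image (fun a => a ∘ₗ LinearMap.fst ℝ V W) ∪ B.image fun b => b ∘ₗ LinearMap.snd ℝ V W, ?_⟩
  ext x
  simp only [Set.mem_prod, Set.mem_ofPred_eq, Finset.mem_union, Finset.mem_image]
  constructor
  · rintro h _ (⟨a, ha, rfl⟩ | ⟨a, ha, rfl⟩)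
    exacts [h.1 a ha, h.2 a ha]
  · exact fun h => ⟨fun a ha => h _ (.inl ⟨a, ha, rfl⟩), fun a ha => h _ (.inr ⟨a, ha, rfl⟩)⟩

theorem eventually_mem_ineq (A : Finset (Module.Dual ℝ V × ℝ)) (y z : V) :
    ∀ᶠ e : ℝ in 𝓝[>] 0, ((∀ a ∈ A, a.1 (y + e • z) ≤ a.2) ↔
      ((∀ a ∈ A, a.1 y ≤ a.2) ∧ ∀ a ∈ A, a.1 y = a.2 → a.1 z ≤ 0)) := by
  filter_upwards [(Finset.eventually_all A).2 fun a _ => eventually_affine_le (a.1 y) (a.1 z) a.2]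
    with e he
  rw [← forall₂_and]
  exact forall₂_congr fun a ha => by simpa using he a ha

theorem mem_tcone_ineq {A : Finset (Module.Dual ℝ V × ℝ)} {y z : V} :
    z ∈ tcone y {x | ∀ a ∈ A, a.1 x ≤ a.2} ↔
      ((∀ a ∈ A, a.1 y ≤ a.2) ∧ ∀ a ∈ A, a.1 y = a.2 → a.1 z ≤ 0) := by
  change (∀ᶠ e : ℝ in 𝓝[>] 0, ∀ a ∈ A, a.1 (y + e • z) ≤ a.2) ↔ _
  rw [eventually_congr (eventually_mem_ineq A y z)]
  exact eventually_const

theorem IsPoly.mem_of_tcone {σ : Set V} (h : IsPoly σ) {y z : V} (hz : z ∈ tcone y σ) : y ∈ σ := by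
  obtain ⟨A, rfl⟩ := h
  exact (mem_tcone_ineq.1 hz).1

/-- Along a ray, membership in a polyhedron cannot oscillate near the starting point, so leaving the
set is an eventual property as well. -/
theorem IsPoly.eventually_mem_iff {σ : Set V} (h : IsPoly σ) (y z : V) :
    ∀ᶠ e : ℝ in 𝓝[>] 0, (y + e • z ∈ σ ↔ z ∈ tcone y σ) := by
  obtain ⟨A, rfl⟩ := h
  filter_upwards [eventually_mem_ineq A y z] with e he
  rw [mem_tcone_ineq, ← he]

theorem IsPoly.isPolyCone_tcone {σ : Set V} (h : IsPoly σ) {y : V} (hy : y ∈ σ) :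
    IsPolyCone (tcone y σ) := by
  classical
  obtain ⟨A, rfl⟩ := h
  refine ⟨(A.filter fun a => a.1 y = a.2).image Prod.fst, ?_⟩
  ext z
  rw [mem_tcone_ineq]
  simp only [Finset.mem_image, Finset.mem_filter, Set.mem_ofPred_eq]
  constructor
  · rintro ⟨-, h⟩ _ ⟨a, ⟨ha, h1⟩, rfl⟩
    exact h a ha h1
  · exact fun h => ⟨hy, fun a ha h1 => h _ ⟨a, ⟨ha, h1⟩, rfl⟩⟩

theorem IsPolyCone.add_mem {σ : Set V} (h : IsPolyCone σ) {x y : V} (hx : x ∈ σ) (hy : y ∈ σ) :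
    x + y ∈ σ := by
  obtain ⟨A, rfl⟩ := h
  intro a ha
  rw [map_add]
  exact add_nonpos (hx a ha) (hy a ha)

theorem IsPolyCone.smul_mem {σ : Set V} (h : IsPolyCone σ) {x : V} (hx : x ∈ σ) {c : ℝ}
    (hc : 0 ≤ c) : c • x ∈ σ := by
  obtain ⟨A, rfl⟩ := h
  intro a ha
  rw [map_smul]
  exact mul_nonpos_of_nonneg_of_nonpos hc (hx a ha)

theorem IsPolyCone.zero_mem {σ : Set V} (h : IsPolyCone σ) : (0 : V) ∈ σ := by
  obtain ⟨A, rfl⟩ := h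
  intro a _
  simp

theorem IsPoly.convex {σ : Set V} (h : IsPoly σ) : Convex ℝ σ := by
  obtain ⟨A, rfl⟩ := h
  intro x hx y hy s t hs ht hst a ha
  rw [map_add, map_smul, map_smul, smul_eq_mul, smul_eq_mul]
  calc s * a.1 x + t * a.1 y ≤ s * a.2 + t * a.2 := by
        have := hx a ha
        have := hy a ha
        gcongr
    _ = a.2 := by rw [← add_mul, hst, one_mul]

theorem _root_.Convex.sub_mem_tcone {σ : Set V} (h : Convex ℝ σ) {w x : V} (hw : w ∈ σ)
    (hx : x ∈ σ) : x - w ∈ tcone w σ := by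
  filter_upwards [Ioo_mem_nhdsGT (zero_lt_one (α := ℝ))] with e he
  exact h.add_smul_sub_mem hw hx ⟨he.1.le, he.2.le⟩

theorem _root_.Convex.mem_tcone_of {σ : Set V} (h : Convex ℝ σ) {w z : V} (hw : w ∈ σ) {d : ℝ}
    (hd : 0 < d) (hz : w + d • z ∈ σ) : z ∈ tcone w σ := by
  filter_upwards [Ioo_mem_nhdsGT hd] with e he
  have := h.add_smul_sub_mem hw hz (t := e / d) ⟨div_nonneg he.1.le hd.le, (div_le_one hd).2 he.2.le⟩
  rwa [add_sub_cancel_left, smul_smul, div_mul_cancel₀ _ hd.ne'] at this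

theorem exists_pos_of_eventually {P : ℝ → Prop} (h : ∀ᶠ e : ℝ in 𝓝[>] 0, P e) : ∃ e, 0 < e ∧ P e :=
  ((eventually_mem_nhdsWithin (a := (0 : ℝ)) (s := Set.Ioi 0)).and h).exists

theorem IsPoly.mem_lin {σ : Set V} (h : IsPoly σ) {y z : V} (hy : y ∈ σ) :
    z ∈ lin y σ ↔ z ∈ tcone y σ ∧ -z ∈ tcone y σ := by
  refine ⟨fun hz => ?_, fun hz => Submodule.subset_span hz⟩
  have hc := h.isPolyCone_tcone hy
  induction hz using Submodule.span_induction with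
  | mem x hx => exact hx
  | zero => simpa using hc.zero_mem
  | add x y _ _ hx hy => exact ⟨hc.add_mem hx.1 hy.1, by
      rw [neg_add]; exact hc.add_mem hx.2 hy.2⟩
  | smul a x _ hx =>
    rcases le_total 0 a with ha | ha
    · exact ⟨hc.smul_mem hx.1 ha, by rw [← smul_neg]; exact hc.smul_mem hx.2 ha⟩
    · refine ⟨?_, ?_⟩
      · rw [← neg_smul_neg]; exact hc.smul_mem hx.2 (neg_nonneg.2 ha)
      · rw [← neg_smul]; exact hc.smul_mem hx.1 (neg_nonneg.2 ha)

theorem IsPoly.add_mem_tcone_of_lin {σ : Set V} (h : IsPoly σ) {y z g : V} (hy : y ∈ σ)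
    (hz : z ∈ tcone y σ) (hg : g ∈ lin y σ) : z + g ∈ tcone y σ :=
  (h.isPolyCone_tcone hy).add_mem hz ((h.mem_lin hy).1 hg).1

theorem IsPoly.sub_mem_tcone_of_lin {σ : Set V} (h : IsPoly σ) {y z g : V} (hy : y ∈ σ)
    (hz : z ∈ tcone y σ) (hg : g ∈ lin y σ) : z - g ∈ tcone y σ := by
  rw [sub_eq_add_neg]
  exact h.add_mem_tcone_of_lin hy hz (neg_mem hg)

theorem lin_le_span (y : V) (σ : Set V) : lin y σ ≤ Submodule.span ℝ (tcone y σ) :=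
  Submodule.span_mono fun _ h => h.1

theorem IsPoly.span_tcone {σ : Set V} (h : IsPoly σ) {w : V} (hw : w ∈ σ) :
    Submodule.span ℝ (tcone w σ) = vectorSpan ℝ σ := by
  apply le_antisymm
  · refine Submodule.span_le.2 fun z hz => ?_
    obtain ⟨e, he, hz⟩ := exists_pos_of_eventually hz
    have := vsub_mem_vectorSpan ℝ hz hw
    rw [vsub_eq_sub, add_sub_cancel_left] at this
    simpa [smul_smul, he.ne'] using Submodule.smul_mem _ e⁻¹ this
  · rw [vectorSpan_eq_span_vsub_set_right ℝ hw]
    refine Submodule.span_mono ?_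
    rintro _ ⟨x, hx, rfl⟩
    exact h.convex.sub_mem_tcone hw hx

theorem IsPoly.tcone_subset_vectorSpan {σ : Set V} (h : IsPoly σ) {w : V} :
    tcone w σ ⊆ vectorSpan ℝ σ := fun z hz => by
  rw [← h.span_tcone (h.mem_of_tcone hz)]
  exact Submodule.subset_span hz

theorem InRel.sub_mem_tcone {γ : Set V} (hγ : Convex ℝ γ) {w x : V} (h : InRel w γ) (hx : x ∈ γ) :
    w - x ∈ tcone w γ := by
  obtain ⟨d, hd, h'⟩ := h.2 x hx
  exact hγ.mem_tcone_of h.1 hd h'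

theorem IsPoly.lin_eq_vectorSpan_of_inRel {σ : Set V} (h : IsPoly σ) {w : V} (hw : InRel w σ) :
    lin w σ = vectorSpan ℝ σ := by
  apply le_antisymm ((lin_le_span _ _).trans (h.span_tcone hw.1).le)
  rw [vectorSpan_eq_span_vsub_set_right ℝ hw.1]
  refine Submodule.span_mono ?_
  rintro _ ⟨x, hx, rfl⟩
  exact ⟨h.convex.sub_mem_tcone hw.1 hx, by simpa using hw.sub_mem_tcone h.convex hx⟩

theorem IsPoly.inRel_of_lin_eq {σ : Set V} (h : IsPoly σ) {w : V} (hw : w ∈ σ)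
    (hl : vectorSpan ℝ σ ≤ lin w σ) : InRel w σ := by
  refine ⟨hw, fun x hx => ?_⟩
  have := ((h.mem_lin hw).1 (hl (vsub_mem_vectorSpan ℝ hw hx))).1
  exact exists_pos_of_eventually this

theorem IsPoly.tcone_of_inRel {σ : Set V} (h : IsPoly σ) {w : V} (hw : InRel w σ) :
    tcone w σ = vectorSpan ℝ σ := by
  refine h.tcone_subset_vectorSpan.antisymm fun z hz => ?_
  rw [SetLike.mem_coe, ← h.lin_eq_vectorSpan_of_inRel hw, h.mem_lin hw.1] at hz
  exact hz.1

/-- The point `w'` is a convex combination, with positive weights, of `w` and the point `w' + d •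
(w' - w)` of `γ`. A small move from `w` inside `σ` therefore induces a move from `w'`. -/
theorem InRel.tcone_subset {γ σ : Set V} (hσ : Convex ℝ σ) (hγ : γ ⊆ σ) {w w' : V} (hw : w ∈ γ)
    (hw' : InRel w' γ) : tcone w σ ⊆ tcone w' σ := by
  intro z hz
  obtain ⟨d, hd, hd'⟩ := hw'.2 w hw
  obtain ⟨e, he, he'⟩ := exists_pos_of_eventually hz
  have hpos : 0 < 1 + d := by linarith
  refine hσ.mem_tcone_of (hγ hw'.1) (d := d * e / (1 + d)) (by positivity) ?_
  have := hσ (hγ hd') he' (a := 1 / (1 + d)) (b := d / (1 + d)) (by positivity) (by positivity)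
    (by field_simp)
  convert this using 1
  have h1 : (1 : ℝ) = 1 / (1 + d) + d / (1 + d) := by field_simp
  have h2 : d * e / (1 + d) = d / (1 + d) * e := by ring
  have h3 : w' = (1 / (1 + d) + d / (1 + d)) • w' := by rw [← h1, one_smul]
  rw [h2]
  nth_rewrite 1 [h3]
  have h4 : d / (1 + d) = 1 / (1 + d) * d := by ring
  rw [h4]
  module

/-- A link of a link is a link at a nearby point: for small `e` the constraints active at `w + e •
y` are those active at `w` whose linear part vanishes at `y`. -/
theorem IsPoly.eventually_tcone_add {σ : Set V} (h : IsPoly σ) {w : V} (hw : w ∈ σ) (y : V) :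
    ∀ᶠ e : ℝ in 𝓝[>] 0, (w + e • y ∈ σ ↔ y ∈ tcone w σ) ∧
      (y ∈ tcone w σ → tcone (w + e • y) σ = tcone y (tcone w σ)) := by
  classical
  obtain ⟨A, rfl⟩ := h
  have h1 : ∀ᶠ e : ℝ in 𝓝[>] 0, ∀ a ∈ A, a.1 w = a.2 → a.1 y ≠ 0 → a.1 w + e * a.1 y ≠ a.2 := by
    refine (Finset.eventually_all A).2 fun a _ => ?_
    by_cases hy : a.1 y = 0
    · exact .of_forall fun e _ h' => absurd hy h'
    · filter_upwards [eventually_affine_ne (a := 0) hy] with e he h1 _ h2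
      rw [h1, add_eq_left] at h2
      exact he (by rw [h2, zero_add])
  have h2 : ∀ᶠ e : ℝ in 𝓝[>] 0, ∀ a ∈ A, a.1 w ≠ a.2 → a.1 w + e * a.1 y ≠ a.2 := by
    refine (Finset.eventually_all A).2 fun a _ => ?_
    by_cases hy : a.1 y = 0
    · exact .of_forall fun e h' => by simpa [hy] using h'
    · filter_upwards [eventually_affine_ne (a := a.1 w - a.2) hy] with e he _ h2
      apply he
      rw [← h2]; ring
  have hcone : tcone w {x | ∀ a ∈ A, a.1 x ≤ a.2} =
      {x | ∀ a ∈ (A.filter fun a => a.1 w = a.2).image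
        (fun a => ((a.1, 0) : Module.Dual ℝ V × ℝ)), a.1 x ≤ a.2} := by
    ext z
    rw [mem_tcone_ineq]
    simp only [Finset.mem_image, Finset.mem_filter, Set.mem_ofPred_eq]
    constructor
    · rintro ⟨-, h⟩ _ ⟨a, ⟨ha, h1⟩, rfl⟩
      exact h a ha h1
    · exact fun h => ⟨hw, fun a ha h1 => h _ ⟨a, ⟨ha, h1⟩, rfl⟩⟩
  filter_upwards [IsPoly.eventually_mem_iff ⟨A, rfl⟩ w y, h1, h2] with e he h1 h2
  refine ⟨he, fun hy => ?_⟩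
  ext z
  have hy' := he.2 hy
  rw [mem_tcone_ineq, and_iff_right hy', hcone, mem_tcone_ineq]
  rw [hcone, Set.mem_ofPred_eq] at hy
  rw [and_iff_right hy]
  simp only [Finset.mem_image, Finset.mem_filter]
  constructor
  · rintro h _ ⟨a, ⟨ha, h3⟩, rfl⟩ h4
    exact h a ha (by simpa [h3] using Or.inr h4)
  · intro h a ha h3
    rw [map_add, map_smul, smul_eq_mul] at h3
    have h4 : a.1 w = a.2 := by
      by_contra h5
      exact h2 a ha h5 h3
    have h5 : a.1 y = 0 := by
      by_contra h5
      exact h1 a ha h4 h5 h3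
    exact h (a.1, 0) ⟨a, ⟨ha, h4⟩, rfl⟩ h5

theorem mem_tcone_cone {A : Finset (Module.Dual ℝ V)} {y z : V} :
    z ∈ tcone y {x | ∀ a ∈ A, a x ≤ 0} ↔
      ((∀ a ∈ A, a y ≤ 0) ∧ ∀ a ∈ A, a y = 0 → a z ≤ 0) := by
  classical
  have := mem_tcone_ineq (A := A.image fun a => (a, (0 : ℝ))) (y := y) (z := z)
  simpa only [Finset.mem_image, forall_exists_index, and_imp, forall_apply_eq_imp_iff₂] using this

theorem mem_lin_cone {A : Finset (Module.Dual ℝ V)} {y z : V} (hy : ∀ a ∈ A, a y ≤ 0) :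
    z ∈ lin y {x | ∀ a ∈ A, a x ≤ 0} ↔ ∀ a ∈ A, a y = 0 → a z = 0 := by
  rw [IsPoly.mem_lin (IsPolyCone.isPoly ⟨A, rfl⟩) hy, mem_tcone_cone, mem_tcone_cone]
  simp only [map_neg, neg_nonpos]
  exact ⟨fun h a ha h0 => le_antisymm (h.1.2 a ha h0) (h.2.2 a ha h0),
    fun h => ⟨⟨hy, fun a ha h0 => (h a ha h0).le⟩, ⟨hy, fun a ha h0 => (h a ha h0).ge⟩⟩⟩

/-- A generic value of `M` is attained on a polyhedral cone only at points at which the lineality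
space of the tangent cone is mapped onto the target. -/
theorem IsPolyCone.generic_map_lin {C : Set V} (h : IsPolyCone C) (M : V →ₗ[ℝ] W) :
    ∀ᶠ u in generic W, ∀ z ∈ C, M z = u → (lin z C).map M = ⊤ := by
  classical
  obtain ⟨A, rfl⟩ := id h
  -- The lineality space at `z` is the common kernel of the constraints active at `z` and contains
  -- `z` itself. Only finitely many such kernels occur, and `u` avoids those of their images that
  -- are proper.
  have : ∀ᶠ u in generic W, ∀ S ∈ A.powerset,
      (⨅ a ∈ S, LinearMap.ker a).map M ≠ ⊤ → u ∉ (⨅ a ∈ S, LinearMap.ker a).map M := by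
    refine (Finset.eventually_all _).2 fun S _ => ?_
    by_cases h : (⨅ a ∈ S, LinearMap.ker a).map M = ⊤
    · exact .of_forall fun u h' => absurd h h'
    · filter_upwards [generic_notMem h] with u hu _ using hu
  filter_upwards [this] with u hu z hz hMz
  have hlin : lin z {x | ∀ a ∈ A, a x ≤ 0} = ⨅ a ∈ A.filter (fun a => a z = 0), LinearMap.ker a := by
    ext y
    rw [mem_lin_cone hz]
    simp
  by_contra hc
  rw [hlin] at hc
  refine hu _ (Finset.mem_powerset.2 (Finset.filter_subset _ _)) hc ⟨z, ?_, hMz⟩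
  simp +contextual

end TangentCone

/-! ### The degree of a linear map on a balanced family of cones -/

section BalancedDegree

variable {V W ι : Type*} [AddCommGroup V] [Module ℝ V] [AddCommGroup W] [Module ℝ W]

-- The jump of one half-space cone across a wall: the weight involves `|r|`, the side on which the
-- cone lies is the sign of `r`, and together they give the signed quantity `m * r`, which is linear
-- in the lattice normal. For `r = 0` the weight is zero, so no information on the sides is needed.
open Classical in
theorem sub_ite_eq_mul_sign {m r l w : ℝ} (hw : w = m * |r|) {p q : Prop}
    (hp : r ≠ 0 → (p ↔ 0 ≤ r * l)) (hq : r ≠ 0 → (q ↔ 0 ≤ r * -l)) :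
    ((if p then w else 0) - if q then w else 0) = m * r * SignType.sign l := by
  subst hw
  by_cases hr : r = 0
  · simp [hr]
  · simp only [hp hr, hq hr]
    rcases lt_or_gt_of_ne hr with hr | hr <;> rcases lt_trichotomy l 0 with hl | hl | hl
    · have h1 : 0 < r * l := mul_pos_of_neg_of_neg hr hl
      rw [if_pos h1.le, if_neg (by linarith), sign_neg hl, abs_of_neg hr]
      simp
    · simp [hl]
    · have h1 : r * l < 0 := mul_neg_of_neg_of_pos hr hl
      rw [if_neg h1.not_ge, if_pos (by linarith), sign_pos hl, abs_of_neg hr]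
      simp
    · have h1 : r * l < 0 := mul_neg_of_pos_of_neg hr hl
      rw [if_neg h1.not_ge, if_pos (by linarith), sign_neg hl, abs_of_pos hr]
      simp
    · simp [hl]
    · have h1 : 0 < r * l := mul_pos hr hl
      rw [if_pos h1.le, if_neg (by linarith), sign_pos hl, abs_of_pos hr]
      simp

/-- If all constraints active at a point are multiples of a single one after transport by `s`, the
lineality space there is the image of the hyperplane `φ ∘ₗ s = 0`: the point lies in the interior of
a ridge. -/
theorem finrank_lin_add_one [FiniteDimensional ℝ W] {A : Finset (Module.Dual ℝ V)}
    {E : Submodule ℝ V} {L : V →ₗ[ℝ] W} {s : W →ₗ[ℝ] V} (hCE : {x | ∀ a ∈ A, a x ≤ 0} ⊆ (E : Set V))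
    (hLs : ∀ w, L (s w) = w) (hsL : ∀ z ∈ E, s (L z) = z) {x : W} (hx : ∀ a ∈ A, a (s x) ≤ 0)
    {φ : Module.Dual ℝ V} (hφA : φ ∈ A) (hφ : φ ∘ₗ s ≠ 0) (hφx : φ (s x) = 0)
    (hprop : ∀ ψ ∈ A, ψ (s x) = 0 → ∃ a : ℝ, ψ ∘ₗ s = a • (φ ∘ₗ s)) :
    Module.finrank ℝ (lin (s x) {x | ∀ a ∈ A, a x ≤ 0}) + 1 = Module.finrank ℝ W := by
  have hlin : lin (s x) {x | ∀ a ∈ A, a x ≤ 0} = (LinearMap.ker (φ ∘ₗ s)).map s := by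
    ext z
    rw [mem_lin_cone hx, Submodule.mem_map]
    constructor
    · intro h
      have hzE : z ∈ E := by
        have hz : z ∈ tcone (s x) {x | ∀ a ∈ A, a x ≤ 0} :=
          mem_tcone_cone.2 ⟨hx, fun a ha h0 => (h a ha h0).le⟩
        obtain ⟨e, he, hz⟩ := exists_pos_of_eventually hz
        have h1 : e • z ∈ E := by
          simpa using E.sub_mem (hCE hz) (hCE hx)
        simpa [smul_smul, he.ne'] using E.smul_mem e⁻¹ h1
      exact ⟨L z, by simpa [hsL z hzE] using h φ hφA hφx, hsL z hzE⟩
    · rintro ⟨w, hw, rfl⟩ a ha h0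
      obtain ⟨c, hc⟩ := hprop a ha h0
      rw [LinearMap.mem_ker] at hw
      exact (LinearMap.congr_fun hc w).trans (by rw [LinearMap.smul_apply, hw, smul_zero])
  have hinj : Function.Injective s := Function.LeftInverse.injective hLs
  rw [hlin, ← (Submodule.equivMapOfInjective s hinj _).finrank_eq]
  exact Module.Dual.finrank_ker_add_one_of_ne_zero hφ

open Classical in
/-- The degree of a linear map on a weighted family of polyhedral cones of the dimension of the
target is generically constant if the family is balanced along its ridges. -/
theorem exists_generic_degree [FiniteDimensional ℝ V] [FiniteDimensional ℝ W] (I : Finset ι)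
    (C : ι → Set V) (E : ι → Submodule ℝ V) (L : V →ₗ[ℝ] W) (wt : ι → ℝ)
    (hC : ∀ i ∈ I, IsPolyCone (C i)) (hCE : ∀ i ∈ I, C i ⊆ E i)
    (hfin : ∀ i ∈ I, Module.finrank ℝ (E i) = Module.finrank ℝ W)
    (hwt : ∀ i ∈ I, ¬ Disjoint (E i) (LinearMap.ker L) → wt i = 0)
    (hbal : ∀ i ∈ I, ∀ y ∈ C i, Module.finrank ℝ (lin y (C i)) + 1 = Module.finrank ℝ W →
      ∃ (l : Module.Dual ℝ W) (m r : ι → ℝ), (∑ j ∈ I with y ∈ C j, m j * r j) = 0 ∧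
        ∀ j ∈ I, y ∈ C j → wt j = m j * |r j| ∧
          (r j ≠ 0 → ∀ z ∈ E j, (z ∈ tcone y (C j) ↔ 0 ≤ r j * l (L z)))) :
    ∃ m : ℝ, ∀ᶠ w in generic W, (∑ i ∈ I, if w ∈ L '' C i then wt i else 0) = m := by
  -- If `E i` meets the kernel of `L` trivially, `L` maps it isomorphically to `W`. With `s` the
  -- inverse, the image of the cone is cut out by the functionals `a ∘ₗ s`. All other cones have
  -- weight zero.
  have hex : ∀ i, ∃ (A : Finset (Module.Dual ℝ V)) (s : W →ₗ[ℝ] V), i ∈ I →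
      Disjoint (E i) (LinearMap.ker L) → C i = {x | ∀ a ∈ A, a x ≤ 0} ∧ (∀ w, L (s w) = w) ∧
        (∀ w, s w ∈ E i) ∧ ∀ z ∈ E i, s (L z) = z := by
    intro i
    by_cases hi : i ∈ I
    swap
    · exact ⟨∅, 0, fun h => absurd h hi⟩
    by_cases hd : Disjoint (E i) (LinearMap.ker L)
    swap
    · exact ⟨∅, 0, fun _ h => absurd h hd⟩
    obtain ⟨A, hA⟩ := hC i hi
    have hinj : Function.Injective (L.domRestrict (E i)) := by
      rw [← LinearMap.ker_eq_bot, LinearMap.ker_eq_bot']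
      rintro ⟨z, hz⟩ h0
      exact Subtype.ext (Submodule.disjoint_def.1 hd z hz h0)
    let f := LinearEquiv.ofInjectiveOfFinrankEq (L.domRestrict (E i)) hinj (hfin i hi)
    refine ⟨A, (E i).subtype ∘ₗ f.symm.toLinearMap, fun _ _ => ⟨hA, fun w => ?_, fun w => ?_,
      fun z hz => ?_⟩⟩
    · exact f.apply_symm_apply w
    · exact (f.symm w).2
    · exact congrArg Subtype.val (f.symm_apply_apply ⟨z, hz⟩)
  choose A s hAs using hex
  set J := I.filter fun i => Disjoint (E i) (LinearMap.ker L) with hJ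
  have hJmem : ∀ i ∈ J, i ∈ I ∧ Disjoint (E i) (LinearMap.ker L) := fun i hi => by
    simpa [hJ] using hi
  have hpt : ∀ i ∈ J, ∀ x u, PointsInto ((A i).image fun a => a ∘ₗ s i) x u ↔
      s i u ∈ tcone (s i x) (C i) := by
    intro i hi x u
    rw [(hAs i (hJmem i hi).1 (hJmem i hi).2).1, mem_tcone_cone, ← forall₂_and]
    simp [PointsInto]
  obtain ⟨m, hm⟩ := exists_generic_count J (fun i => (A i).image fun a => a ∘ₗ s i) wt (by
    intro x hx u
    -- The cones are grouped by their point over `x`: balancing is a statement at one point of the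
    -- source, and the jumps cancel in each group separately.
    rw [← sub_eq_zero, ← Finset.sum_sub_distrib,
      ← Finset.sum_fiberwise_of_maps_to (t := J.image fun i => s i x) (g := fun i => s i x)
        (fun i hi => Finset.mem_image_of_mem _ hi)]
    refine Finset.sum_eq_zero fun y _ => ?_
    by_cases hridge : ∃ i ∈ J, s i x = y ∧ y ∈ C i ∧
        Module.finrank ℝ (lin y (C i)) + 1 = Module.finrank ℝ W
    · obtain ⟨i0, hi0, rfl, hy, hr⟩ := hridge
      set y := s i0 x with hydef
      have hLy : L y = x := (hAs i0 (hJmem i0 hi0).1 (hJmem i0 hi0).2).2.1 x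
      obtain ⟨l, m, r, hsum, hlr⟩ := hbal i0 (hJmem i0 hi0).1 y hy hr
      have hterm : ∀ i ∈ J.filter (fun i => s i x = y),
          ((if PointsInto ((A i).image fun a => a ∘ₗ s i) x u then wt i else 0) -
            if PointsInto ((A i).image fun a => a ∘ₗ s i) x (-u) then wt i else 0) =
          if y ∈ C i then m i * r i * SignType.sign (l u) else 0 := by
        intro i hi
        obtain ⟨hiJ, hiy⟩ := Finset.mem_filter.1 hi
        obtain ⟨-, h2, h3, -⟩ := hAs i (hJmem i hiJ).1 (hJmem i hiJ).2
        simp only [hpt i hiJ, hiy]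
        by_cases hyC : y ∈ C i
        · rw [if_pos hyC]
          obtain ⟨hw, hz⟩ := hlr i (hJmem i hiJ).1 hyC
          refine sub_ite_eq_mul_sign hw (fun h0 => ?_) (fun h0 => ?_)
          · rw [hz h0 _ (h3 u), h2]
          · rw [hz h0 _ (h3 _), h2, map_neg]
        · rw [if_neg hyC, if_neg fun h => hyC ((hC i (hJmem i hiJ).1).isPoly.mem_of_tcone h),
            if_neg fun h => hyC ((hC i (hJmem i hiJ).1).isPoly.mem_of_tcone h), sub_zero]
      rw [Finset.sum_congr rfl hterm, ← Finset.sum_filter, ← Finset.sum_mul, Finset.filter_filter]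
      -- The cones on which `L` is not injective also enter the balancing relation, but their weight
      -- is zero and so `m j * r j` vanishes.
      have : (∑ i ∈ J with s i x = y ∧ y ∈ C i, m i * r i) = ∑ j ∈ I with y ∈ C j, m j * r j := by
        refine Finset.sum_subset (fun i hi => ?_) fun i hi hi' => ?_
        · obtain ⟨h1, -, h2⟩ := Finset.mem_filter.1 hi
          exact Finset.mem_filter.2 ⟨(hJmem i h1).1, h2⟩
        · obtain ⟨h1, h2⟩ := Finset.mem_filter.1 hi
          have h3 : ¬ Disjoint (E i) (LinearMap.ker L) := fun h3 => hi' (by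
            refine Finset.mem_filter.2 ⟨Finset.mem_filter.2 ⟨h1, h3⟩, ?_, h2⟩
            rw [← hLy]
            exact (hAs i h1 h3).2.2.2 y (hCE i h1 h2))
          have h4 := (hlr i h1 h2).1
          rw [hwt i h1 h3] at h4
          rcases mul_eq_zero.1 h4.symm with h | h
          · rw [h, zero_mul]
          · rw [abs_eq_zero.1 h, mul_zero]
      rw [this, hsum, zero_mul]
    · push Not at hridge
      refine Finset.sum_eq_zero fun i hi => ?_
      obtain ⟨hiJ, hiy⟩ := Finset.mem_filter.1 hi
      obtain ⟨h1, h2, h3, h4⟩ := hAs i (hJmem i hiJ).1 (hJmem i hiJ).2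
      by_cases hyC : y ∈ C i
      · have hxA : ∀ a ∈ A i, a (s i x) ≤ 0 := by
          rw [hiy]
          rw [h1] at hyC
          exact hyC
        -- Away from ridges no proper wall of a cone through `y` is active, so every direction
        -- points into the cone and its two terms cancel.
        have hact : ∀ a ∈ A i, a (s i x) = 0 → a ∘ₗ s i = 0 := by
          intro a ha ha0
          by_contra hne
          refine hridge i hiJ hiy hyC ?_
          rw [h1, ← hiy]
          have hCE' := hCE i (hJmem i hiJ).1
          rw [h1] at hCE'
          refine finrank_lin_add_one hCE' h2 h4 hxA ha hne ha0 fun ψ hψ hψ0 => ?_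
          exact hx i hiJ (by simpa using hxA) _ (Finset.mem_image_of_mem _ ha) _
            (Finset.mem_image_of_mem _ hψ) hne ha0 hψ0
        have hall : ∀ u, PointsInto ((A i).image fun a => a ∘ₗ s i) x u := by
          intro u φ hφ
          obtain ⟨a, ha, rfl⟩ := Finset.mem_image.1 hφ
          refine ⟨hxA a ha, fun h0 => ?_⟩
          rw [hact a ha h0]
          simp
        rw [if_pos (hall _), if_pos (hall _), sub_self]
      · rw [hpt i hiJ, hpt i hiJ, hiy,
          if_neg fun h => hyC ((hC i (hJmem i hiJ).1).isPoly.mem_of_tcone h),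
          if_neg fun h => hyC ((hC i (hJmem i hiJ).1).isPoly.mem_of_tcone h), sub_zero])
  refine ⟨m, hm.mono fun w hw => ?_⟩
  rw [← hw]
  symm
  refine (Finset.sum_congr rfl fun i hi => ?_).trans
    (Finset.sum_subset (Finset.filter_subset _ _) fun i hi hi' => ?_)
  · obtain ⟨h1, h2, h3, h4⟩ := hAs i (hJmem i hi).1 (hJmem i hi).2
    congr 1
    simp only [Finset.mem_image, forall_exists_index, and_imp, forall_apply_eq_imp_iff₂]
    refine propext ⟨fun h => ⟨s i w, by rw [h1]; exact h, h2 w⟩, ?_⟩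
    rintro ⟨z, hz, rfl⟩
    intro a ha
    rw [LinearMap.comp_apply, h4 z (hCE i (hJmem i hi).1 hz)]
    rw [h1] at hz
    exact hz a ha
  · rw [hwt i hi fun h => hi' (Finset.mem_filter.2 ⟨hi, h⟩), ite_self]

end BalancedDegree

/-! ### Lattices and indices of subgroups -/

section Index

variable {Λ Λ' W W' : Type*} [AddCommGroup Λ] [AddCommGroup Λ'] [AddCommGroup W] [Module ℝ W]
  [AddCommGroup W'] [Module ℝ W']

/-- `j` embeds `Λ` as a full lattice: homomorphisms to `ℤ` extend to linear functionals. -/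
structure IsLat (j : Λ →+ W) : Prop where
  span : Submodule.span ℝ (Set.range j) = ⊤
  extend : ∀ l : Λ →+ ℤ, ∃ L : Module.Dual ℝ W, ∀ x, L (j x) = l x

/-- `index = 0` encodes infinite index. An infinite finitely generated abelian group has `ℤ` as a
direct summand, and `l` is the projection of the quotient to it. -/
theorem exists_surjective_of_index_eq_zero [AddGroup.FG Λ] {H : AddSubgroup Λ}
    (h : H.index = 0) : ∃ l : Λ →+ ℤ, Function.Surjective l ∧ H ≤ l.ker := by
  obtain ⟨n, ι, hι, p, hp, e, ⟨f⟩⟩ := AddCommGroup.equiv_free_prod_directSum_zmod (Λ ⧸ H)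
  rcases Nat.eq_zero_or_pos n with rfl | hn
  · exfalso
    have hfin : Finite (Λ ⧸ H) := by
      classical
      have : ∀ i, NeZero (p i ^ e i) := fun i => ⟨pow_ne_zero _ (hp i).ne_zero⟩
      have : Finite (DirectSum ι fun i => ZMod (p i ^ e i)) :=
        Finite.of_equiv _ (DirectSum.addEquivProd fun i => ZMod (p i ^ e i)).symm.toEquiv
      exact Finite.of_equiv _ f.symm.toEquiv
    exact AddSubgroup.index_ne_zero_of_finite h
  · let g : (Fin n →₀ ℤ) × (DirectSum ι fun i => ZMod (p i ^ e i)) →+ ℤ :=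
      (Finsupp.applyAddHom (⟨0, hn⟩ : Fin n)).comp (AddMonoidHom.fst _ _)
    refine ⟨(g.comp f.toAddMonoidHom).comp (QuotientAddGroup.mk' H), ?_, ?_⟩
    · intro z
      obtain ⟨x, hx⟩ := QuotientAddGroup.mk'_surjective H (f.symm (Finsupp.single ⟨0, hn⟩ z, 0))
      refine ⟨x, ?_⟩
      change g (f (QuotientAddGroup.mk' H x)) = z
      rw [hx, f.apply_symm_apply]
      simp [g]
    · intro x hx
      have : QuotientAddGroup.mk' H x = 0 := by simpa using hx
      change g (f (QuotientAddGroup.mk' H x)) = 0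
      rw [this, map_zero, map_zero]

/-- For finite index, a non-zero multiple of every lattice vector lies in `H`. For infinite index, a
non-zero homomorphism to `ℤ` kills `H`, and its real extension is a non-zero functional that kills
the span. -/
theorem IsLat.index_ne_zero_iff [AddGroup.FG Λ] {j : Λ →+ W} (hj : IsLat j) (H : AddSubgroup Λ) :
    H.index ≠ 0 ↔ Submodule.span ℝ (j '' H) = ⊤ := by
  constructor
  · intro h
    rw [eq_top_iff, ← hj.span, Submodule.span_le]
    rintro _ ⟨x, rfl⟩
    have h1 : j (H.index • x) ∈ Submodule.span ℝ (j '' H) :=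
      Submodule.subset_span ⟨_, H.nsmul_index_mem x, rfl⟩
    rw [map_nsmul, ← Nat.cast_smul_eq_nsmul ℝ] at h1
    have h2 := Submodule.smul_mem _ (H.index : ℝ)⁻¹ h1
    rwa [smul_smul, inv_mul_cancel₀ (Nat.cast_ne_zero.2 h), one_smul] at h2
  · intro h h0
    obtain ⟨l, hl, hH⟩ := exists_surjective_of_index_eq_zero h0
    obtain ⟨L, hL⟩ := hj.extend l
    have h1 : L = 0 := by
      rw [← LinearMap.ker_eq_top, eq_top_iff, ← h, Submodule.span_le]
      rintro _ ⟨x, hx, rfl⟩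
      have := hH hx
      rw [AddMonoidHom.mem_ker] at this
      simp [hL, this]
    obtain ⟨x, hx⟩ := hl 1
    have := hL x
    rw [h1, hx] at this
    simp at this

/-- The index of `H + ℤ v`, where `H` has infinite index, is up to a constant the absolute value of
a homomorphism to `ℤ` that vanishes on `H`. -/
theorem exists_index_sup_zmultiples [AddGroup.FG Λ] {H : AddSubgroup Λ} (h : H.index = 0) :
    ∃ (l : Λ →+ ℤ) (k : ℕ), H ≤ l.ker ∧
      ∀ v, (H ⊔ AddSubgroup.zmultiples v).index = k * (l v).natAbs := by
  obtain ⟨l, hl, hH⟩ := exists_surjective_of_index_eq_zero h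
  refine ⟨l, H.relIndex l.ker, hH, fun v => ?_⟩
  have hmap : (H ⊔ AddSubgroup.zmultiples v).map l = AddSubgroup.zmultiples (l v) := by
    rw [AddSubgroup.map_sup, (AddSubgroup.map_eq_bot_iff _).2 hH, bot_sup_eq,
      AddMonoidHom.map_zmultiples]
  -- The chain `H + ℤ v ≤ H + ℤ v + ker l ≤ Λ` splits the index. The upper factor is the index of `ℤ
  -- (l v)` in `ℤ`; the lower one is that of `H` in `ker l` if `l v ≠ 0`, since then `H + ℤ v` meets
  -- `ker l` in `H`.
  have h1 : (H ⊔ AddSubgroup.zmultiples v ⊔ l.ker).index = (l v).natAbs := by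
    have := AddSubgroup.index_map (H ⊔ AddSubgroup.zmultiples v) l
    rw [hmap, AddMonoidHom.range_eq_top.2 hl, AddSubgroup.index_top, mul_one] at this
    rw [← this, Int.index_zmultiples]
  have h2 := AddSubgroup.relIndex_mul_index
    (le_sup_left : H ⊔ AddSubgroup.zmultiples v ≤ H ⊔ AddSubgroup.zmultiples v ⊔ l.ker)
  rw [h1, AddSubgroup.relIndex_sup_left] at h2
  rw [← h2]
  by_cases h0 : l v = 0
  · simp [h0]
  · congr 1
    rw [← AddSubgroup.inf_relIndex_right (H ⊔ AddSubgroup.zmultiples v)]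
    congr 1
    ext x
    rw [AddSubgroup.mem_inf, AddSubgroup.mem_sup]
    constructor
    · rintro ⟨⟨y, hy, z, hz, rfl⟩, hx⟩
      obtain ⟨c, rfl⟩ := AddSubgroup.mem_zmultiples_iff.1 hz
      have h3 := hH hy
      rw [AddMonoidHom.mem_ker] at h3 hx
      rw [map_add, h3, zero_add, map_zsmul, smul_eq_mul, mul_eq_zero, or_iff_left h0] at hx
      simpa [hx] using hy
    · exact fun hx => ⟨⟨x, hx, 0, zero_mem _, add_zero x⟩, hH hx⟩

/-- Multiplicativity of the index along the projection to `Λ`: the factors belong to the image of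
`H` and to its fibre over `0`. All lattice indices of product maps are computed in this way. -/
theorem index_eq_map_fst_mul (H : AddSubgroup (Λ × Λ')) :
    H.index = (H.map (AddMonoidHom.fst Λ Λ')).index * (H.comap (AddMonoidHom.inr Λ Λ')).index := by
  have h1 := AddSubgroup.index_map H (AddMonoidHom.fst Λ Λ')
  rw [AddMonoidHom.range_eq_top.2 Prod.fst_surjective, AddSubgroup.index_top, mul_one] at h1
  rw [h1, AddSubgroup.index_comap]
  have h2 : (AddMonoidHom.inr Λ Λ').range = (AddMonoidHom.fst Λ Λ').ker := by
    ext ⟨a, b⟩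
    rw [AddMonoidHom.mem_range, AddMonoidHom.mem_ker]
    exact ⟨fun ⟨c, hc⟩ => (congrArg Prod.fst hc).symm, fun h => ⟨b, Prod.ext h.symm rfl⟩⟩
  rw [h2, ← AddSubgroup.relIndex_sup_left _ H, mul_comm,
    AddSubgroup.relIndex_mul_index le_sup_left]

theorem IsLat.prod {j : Λ →+ W} {j' : Λ' →+ W'} (hj : IsLat j) (hj' : IsLat j') :
    IsLat (j.prodMap j') := by
  constructor
  · rw [eq_top_iff]
    rintro ⟨w, w'⟩ -
    have h1 : ∀ w ∈ Submodule.span ℝ (Set.range j),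
        (w, (0 : W')) ∈ Submodule.span ℝ (Set.range (j.prodMap j')) := by
      intro w hw
      have := Submodule.mem_map_of_mem (f := LinearMap.inl ℝ W W') hw
      rw [Submodule.map_span] at this
      refine Submodule.span_mono ?_ this
      rintro _ ⟨_, ⟨x, rfl⟩, rfl⟩
      exact ⟨(x, 0), by simp⟩
    have h2 : ∀ w ∈ Submodule.span ℝ (Set.range j'),
        ((0 : W), w) ∈ Submodule.span ℝ (Set.range (j.prodMap j')) := by
      intro w hw
      have := Submodule.mem_map_of_mem (f := LinearMap.inr ℝ W W') hw
      rw [Submodule.map_span] at this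
      refine Submodule.span_mono ?_ this
      rintro _ ⟨_, ⟨x, rfl⟩, rfl⟩
      exact ⟨(0, x), by simp⟩
    rw [hj.span] at h1
    rw [hj'.span] at h2
    simpa using add_mem (h1 w trivial) (h2 w' trivial)
  · intro l
    obtain ⟨L, hL⟩ := hj.extend (l.comp (AddMonoidHom.inl Λ Λ'))
    obtain ⟨L', hL'⟩ := hj'.extend (l.comp (AddMonoidHom.inr Λ Λ'))
    refine ⟨L.coprod L', fun x => ?_⟩
    simp only [AddMonoidHom.prodMap_def, LinearMap.coprod_apply, AddMonoidHom.prod_apply,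
      AddMonoidHom.comp_apply, AddMonoidHom.coe_fst, AddMonoidHom.coe_snd, hL, hL']
    rw [← Int.cast_add, AddMonoidHom.inl_apply, AddMonoidHom.inr_apply, ← map_add]
    simp

theorem isLat_int : IsLat (Int.castAddHom ℝ) := by
  constructor
  · rw [eq_top_iff]
    intro x _
    have : (1 : ℝ) ∈ Submodule.span ℝ (Set.range (Int.castAddHom ℝ)) :=
      Submodule.subset_span ⟨1, by simp⟩
    simpa using Submodule.smul_mem _ x this
  · intro l
    refine ⟨(l 1 : ℝ) • LinearMap.id, fun x => ?_⟩
    have : l x = x * l 1 := by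
      rw [← smul_eq_mul, ← map_zsmul]; simp
    simp [this, mul_comm]

@[simp] theorem incl_apply {n : ℕ} (x : Fin n → ℤ) (i : Fin n) : incl n x i = (x i : ℝ) := rfl

theorem isLat_incl (n : ℕ) : IsLat (incl n) := by
  constructor
  · rw [eq_top_iff]
    intro x _
    rw [pi_eq_sum_univ' x]
    refine sum_mem fun i _ => Submodule.smul_mem _ _ (Submodule.subset_span ⟨Pi.single i 1, ?_⟩)
    ext k
    by_cases h : i = k
    · subst h; simp
    · simp [Ne.symm h]
  · intro l
    refine ⟨∑ i, (l (Pi.single i 1) : ℝ) • LinearMap.proj i, fun x => ?_⟩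
    have : l x = ∑ i, x i * l (Pi.single i 1) := by
      conv_lhs => rw [← Finset.univ_sum_single x]
      rw [map_sum]
      refine Finset.sum_congr rfl fun i _ => ?_
      rw [← smul_eq_mul, ← map_zsmul, ← Pi.single_smul]
      simp
    simp [this, mul_comm]

end Index

/-! ### Rational subspaces and their lattice points -/

section Rational

variable {n : ℕ}

/-- The linear functional with integral coefficients `a`. -/
def intDual (a : Fin n → ℤ) : Module.Dual ℝ (Fin n → ℝ) :=
  ∑ j, (a j : ℝ) • LinearMap.proj j

theorem intDual_apply (a : Fin n → ℤ) (x : Fin n → ℝ) : intDual a x = ∑ j, (a j : ℝ) * x j := by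
  simp [intDual]

theorem exists_intDual_incl (a : Fin n → ℤ) :
    ∃ l : (Fin n → ℤ) →+ ℤ, ∀ x, intDual a (incl n x) = l x := by
  refine ⟨∑ j, (a j) • (Pi.evalAddMonoidHom (fun _ => ℤ) j), fun x => ?_⟩
  simp [intDual_apply]

/-- Subspaces of `ℝⁿ` that are cut out by functionals with integral coefficients. -/
def IsRatSub (E : Submodule ℝ (Fin n → ℝ)) : Prop :=
  ∃ A : Set (Fin n → ℤ), ∀ x, x ∈ E ↔ ∀ a ∈ A, intDual a x = 0

/-- The lattice points of a subspace. -/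
def latPts (E : Submodule ℝ (Fin n → ℝ)) : AddSubgroup (Fin n → ℤ) :=
  E.toAddSubgroup.comap (incl n)

theorem mem_latPts {E : Submodule ℝ (Fin n → ℝ)} {x : Fin n → ℤ} :
    x ∈ latPts E ↔ incl n x ∈ E := Iff.rfl

theorem latticeOf_eq (σ : Set (Fin n → ℝ)) : latticeOf σ = latPts (vectorSpan ℝ σ) := rfl

theorem IsRatSub.inf {E F : Submodule ℝ (Fin n → ℝ)} (hE : IsRatSub E) (hF : IsRatSub F) :
    IsRatSub (E ⊓ F) := by
  obtain ⟨A, hA⟩ := hE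
  obtain ⟨B, hB⟩ := hF
  refine ⟨A ∪ B, fun x => ?_⟩
  rw [Submodule.mem_inf, hA, hB]
  simp only [Set.mem_union, or_imp, forall_and]

theorem exists_smul_eq_incl (q : Fin n → ℚ) :
    ∃ (D : ℕ) (z : Fin n → ℤ), D ≠ 0 ∧ ∀ i, (z i : ℚ) = D * q i := by
  refine ⟨∏ i, (q i).den, fun i => (∏ k ∈ Finset.univ.erase i, (q k).den) * (q i).num, ?_, ?_⟩
  · exact Finset.prod_ne_zero_iff.2 fun i _ => (q i).den_nz
  · intro i
    rw [← Finset.prod_erase_mul _ _ (Finset.mem_univ i)]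
    push_cast
    rw [mul_assoc, Rat.den_mul_eq_num]

/-- Expand the coordinates of a point of `E` in a basis of `ℝ` over `ℚ`. Each coefficient vector is
rational and satisfies the same integral equations, so it lies in `E`; clearing denominators makes
it a lattice point. The point itself is a real combination of these vectors. -/
theorem IsRatSub.span_latPts {E : Submodule ℝ (Fin n → ℝ)} (hE : IsRatSub E) :
    Submodule.span ℝ (incl n '' (latPts E : Set (Fin n → ℤ))) = E := by
  apply le_antisymm
  · rw [Submodule.span_le]
    rintro _ ⟨x, hx, rfl⟩
    exact hx
  obtain ⟨A, hA⟩ := hE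
  intro x hx
  let b := Module.Basis.ofVectorSpace ℚ ℝ
  have key : ∀ β, (fun i => ((b.repr (x i) β : ℚ) : ℝ)) ∈
      Submodule.span ℝ (incl n '' (latPts E : Set (Fin n → ℤ))) := by
    intro β
    obtain ⟨D, z, hD, hz⟩ := exists_smul_eq_incl fun i => b.repr (x i) β
    have hz' : incl n z = (D : ℝ) • fun i => ((b.repr (x i) β : ℚ) : ℝ) := by
      ext i
      have := congrArg (fun t : ℚ => (t : ℝ)) (hz i)
      simpa using this
    have hzE : z ∈ latPts E := by
      rw [mem_latPts, hA]
      intro a ha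
      have h0 := (hA x).1 hx a ha
      rw [hz', map_smul, intDual_apply]
      have h1 : (∑ j, (a j : ℚ) * b.repr (x j) β) = 0 := by
        have : b.repr (∑ j, (a j : ℚ) • x j) β = 0 := by
          have h2 : (∑ j, (a j : ℚ) • x j) = 0 := by
            rw [← h0, intDual_apply]
            exact Finset.sum_congr rfl fun j _ => by simp [Rat.smul_def]
          rw [h2]; simp
        rw [← this, map_sum, Finsupp.finsetSum_apply]
        exact Finset.sum_congr rfl fun j _ => by simp
      have h2 := congrArg (fun t : ℚ => (t : ℝ)) h1
      push_cast at h2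
      rw [h2, smul_zero]
    have h3 := Submodule.smul_mem (Submodule.span ℝ (incl n '' (latPts E : Set (Fin n → ℤ))))
      (D : ℝ)⁻¹ (Submodule.subset_span ⟨z, hzE, rfl⟩)
    rwa [hz', smul_smul, inv_mul_cancel₀ (Nat.cast_ne_zero.2 hD), one_smul] at h3
  classical
  let S := Finset.univ.biUnion fun i => (b.repr (x i)).support
  have hx : x = ∑ β ∈ S, b β • fun i => ((b.repr (x i) β : ℚ) : ℝ) := by
    ext i
    rw [Finset.sum_apply]
    conv_lhs => rw [← b.linearCombination_repr (x i), Finsupp.linearCombination_apply,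
      Finsupp.sum_of_support_subset (s := S) _ (Finset.subset_biUnion_of_mem
        (fun i => (b.repr (x i)).support) (Finset.mem_univ i)) _ (by simp)]
    exact Finset.sum_congr rfl fun β _ => by simp [Rat.smul_def, mul_comm]
  rw [hx]
  exact sum_mem fun β _ => Submodule.smul_mem _ _ (key β)

theorem span_le_of_latPts_sup {T E : Submodule ℝ (Fin n → ℝ)} (hE : IsRatSub E) {v : Fin n → ℤ}
    (h : latPts T ⊔ AddSubgroup.zmultiples v = latPts E) :
    E ≤ T ⊔ Submodule.span ℝ {incl n v} := by
  rw [← hE.span_latPts, Submodule.span_le, ← h]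
  rintro _ ⟨z, hz, rfl⟩
  obtain ⟨a, ha, b, hb, rfl⟩ := AddSubgroup.mem_sup.1 hz
  obtain ⟨c, rfl⟩ := AddSubgroup.mem_zmultiples_iff.1 hb
  rw [map_add, map_zsmul, ← Int.cast_smul_eq_zsmul ℝ]
  exact Submodule.add_mem_sup ha (Submodule.smul_mem _ _ (Submodule.mem_span_singleton_self _))

theorem IsRationalPolyhedron.isPoly {σ : Set (Fin n → ℝ)} (h : IsRationalPolyhedron σ) :
    IsPoly σ := by
  classical
  obtain ⟨m, a, b, rfl⟩ := h
  refine ⟨Finset.univ.image fun i => (intDual (a i), b i), ?_⟩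
  ext x
  simp [intDual_apply]

theorem IsRationalPolyhedron.inter {σ τ : Set (Fin n → ℝ)} (h : IsRationalPolyhedron σ)
    (h' : IsRationalPolyhedron τ) : IsRationalPolyhedron (σ ∩ τ) := by
  obtain ⟨m, a, b, rfl⟩ := h
  obtain ⟨m', a', b', rfl⟩ := h'
  refine ⟨m + m', Fin.append a a', Fin.append b b', ?_⟩
  ext x
  simp only [Set.mem_inter_iff, Set.mem_ofPred_eq]
  constructor
  · rintro ⟨h, h'⟩ i
    refine Fin.addCases (fun i => ?_) (fun i => ?_) i
    · simpa using h i
    · simpa using h' i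
  · intro h
    exact ⟨fun i => by simpa using h (Fin.castAdd m' i), fun i => by simpa using h (Fin.natAdd m i)⟩

theorem IsRationalPolyhedron.isRatSub_lin {σ : Set (Fin n → ℝ)} (h : IsRationalPolyhedron σ)
    {w : Fin n → ℝ} (hw : w ∈ σ) : IsRatSub (lin w σ) := by
  have hp := h.isPoly
  obtain ⟨m, a, b, rfl⟩ := h
  have key : ∀ z, z ∈ tcone w {x | ∀ i, ∑ j, (a i j : ℝ) * x j ≤ b i} ↔
      ∀ i, intDual (a i) w = b i → intDual (a i) z ≤ 0 := by
    classical
    intro z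
    have := mem_tcone_ineq (A := Finset.univ.image fun i => (intDual (a i), b i)) (y := w) (z := z)
    simp only [Finset.mem_image, Finset.mem_univ, true_and, forall_exists_index,
      forall_apply_eq_imp_iff, intDual_apply] at this
    simp only [intDual_apply]
    exact this.trans (and_iff_right hw)
  refine ⟨{c | ∃ i, intDual (a i) w = b i ∧ c = a i}, fun x => ?_⟩
  rw [hp.mem_lin hw, key, key]
  simp only [map_neg, neg_nonpos]
  constructor
  · rintro ⟨h1, h2⟩ c ⟨i, hi, rfl⟩
    exact le_antisymm (h1 i hi) (h2 i hi)
  · intro h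
    exact ⟨fun i hi => (h _ ⟨i, hi, rfl⟩).le, fun i hi => (h _ ⟨i, hi, rfl⟩).ge⟩

end Rational

/-! ### Relative interiors, links and faces of polyhedra -/

section Faces

variable {n : ℕ}

theorem inRel_of_mem_intrinsicInterior {γ : Set (Fin n → ℝ)} {w : Fin n → ℝ}
    (hw : w ∈ intrinsicInterior ℝ γ) : InRel w γ := by
  refine ⟨intrinsicInterior_subset hw, fun x hx => ?_⟩
  obtain ⟨y, hy, rfl⟩ := mem_intrinsicInterior.1 hw
  have hxs : x ∈ affineSpan ℝ γ := subset_affineSpan ℝ γ hx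
  let f : ℝ → affineSpan ℝ γ := fun d => ⟨AffineMap.lineMap (y : Fin n → ℝ) x (-d),
    AffineMap.lineMap_mem _ y.2 hxs⟩
  have hf : Continuous f := by
    refine Continuous.subtype_mk ?_ _
    simp only [AffineMap.lineMap_apply_module']
    fun_prop
  have h0 : f 0 = y := Subtype.ext (by simp [f])
  have h1 : ∀ᶠ d in 𝓝 (0 : ℝ), f d ∈ ((↑) ⁻¹' γ : Set (affineSpan ℝ γ)) :=
    hf.continuousAt.eventually_mem (by rw [h0]; exact mem_interior_iff_mem_nhds.1 hy)
  obtain ⟨d, hd, hd'⟩ := exists_pos_of_eventually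
    (nhdsWithin_le_nhds (s := Set.Ioi (0 : ℝ)) h1)
  refine ⟨d, hd, ?_⟩
  have : (y : Fin n → ℝ) + d • ((y : Fin n → ℝ) - x) = f d := by
    simp only [f, AffineMap.lineMap_apply_module']
    module
  rw [this]
  exact hd'

theorem exists_inRel {γ : Set (Fin n → ℝ)} (hc : Convex ℝ γ) (hne : γ.Nonempty) :
    ∃ w, InRel w γ :=
  let ⟨w, hw⟩ := hne.intrinsicInterior hc
  ⟨w, inRel_of_mem_intrinsicInterior hw⟩

theorem inRel_singleton (w : Fin n → ℝ) : InRel w {w} := by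
  refine ⟨rfl, ?_⟩
  rintro x rfl
  exact ⟨1, one_pos, by simp⟩

theorem IsPoly.linkCone_eq {σ : Set (Fin n → ℝ)} (h : IsPoly σ) (w : Fin n → ℝ) :
    linkCone w σ = tcone w σ := by
  ext u
  constructor
  · rintro ⟨d, hd, hu⟩
    filter_upwards [Ioo_mem_nhdsGT hd] with e he using hu e ⟨he.1.le, he.2.le⟩
  · intro hu
    obtain ⟨d, hd, hu'⟩ := mem_nhdsGT_iff_exists_Ioo_subset.1 hu
    rw [Set.mem_Ioi] at hd
    refine ⟨d / 2, half_pos hd, fun e he => ?_⟩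
    rcases he.1.eq_or_lt with rfl | h0
    · simpa using h.mem_of_tcone hu
    · exact hu' (a := e) ⟨h0, by linarith [he.2]⟩

theorem IsPoly.linkAlong_eq {γ σ : Set (Fin n → ℝ)} (h : IsPoly σ) (hγ : Convex ℝ γ)
    (hs : γ ⊆ σ) {w : Fin n → ℝ} (hw : InRel w γ) : linkAlong γ σ = tcone w σ := by
  apply Set.Subset.antisymm
  · refine Set.iUnion₂_subset fun w' hw' => ?_
    rw [h.linkCone_eq]
    exact hw.tcone_subset h.convex hs (intrinsicInterior_subset hw')
  · obtain ⟨w', hw'⟩ := Set.Nonempty.intrinsicInterior hγ ⟨w, hw.1⟩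
    refine Set.Subset.trans ?_ (Set.subset_biUnion_of_mem hw')
    rw [h.linkCone_eq]
    exact (inRel_of_mem_intrinsicInterior hw').tcone_subset h.convex hs hw.1

theorem linkAlong_mono {γ σ τ : Set (Fin n → ℝ)} (h : σ ⊆ τ) : linkAlong γ σ ⊆ linkAlong γ τ :=
  Set.iUnion₂_mono fun _ _ _ ⟨d, hd, hu⟩ => ⟨d, hd, fun e he => h (hu e he)⟩

theorem IsFace.subset {σ τ : Set (Fin n → ℝ)} (h : IsFace σ τ) : τ ⊆ σ := h.2.subset

theorem IsFace.exists_functional {σ τ : Set (Fin n → ℝ)} (h : IsFace σ τ) :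
    ∃ l : (Fin n → ℝ) →L[ℝ] ℝ, τ = {x | x ∈ σ ∧ ∀ y ∈ σ, l y ≤ l x} :=
  h.2 h.1

theorem isFace_self {σ : Set (Fin n → ℝ)} (h : σ.Nonempty) : IsFace σ σ :=
  ⟨h, fun _ => ⟨0, by ext; simp⟩⟩

/-- Faces are extreme: a point of `σ` belongs to the face as soon as the face contains a point that
the segment from it can be prolonged beyond. -/
theorem IsFace.mem_of_add {σ τ : Set (Fin n → ℝ)} (h : IsFace σ τ) {w x : Fin n → ℝ} (hw : w ∈ τ)
    (hx : x ∈ σ) {d : ℝ} (hd : 0 < d) (hd' : w + d • (w - x) ∈ σ) : x ∈ τ := by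
  obtain ⟨l, rfl⟩ := h.exists_functional
  have h1 := hw.2 _ hd'
  rw [map_add, map_smul, map_sub, smul_eq_mul] at h1
  have h2 : 0 ≤ l x - l w := by
    by_contra h3
    nlinarith [mul_pos hd (by linarith : 0 < l w - l x)]
  exact ⟨hx, fun y hy => (hw.2 y hy).trans (by linarith)⟩

theorem IsFace.mem_of_mem_segment {σ τ : Set (Fin n → ℝ)} (h : IsFace σ τ) {w x : Fin n → ℝ}
    (hw : w ∈ τ) (hx : x ∈ σ) {d : ℝ} (hd : 0 < d) (hd' : w + d • (x - w) ∈ τ) : x ∈ τ := by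
  obtain ⟨l, rfl⟩ := h.exists_functional
  have h1 := hd'.2 _ hw.1
  rw [map_add, map_smul, map_sub, smul_eq_mul] at h1
  have h2 : 0 ≤ l x - l w := by
    by_contra h3
    nlinarith [mul_pos hd (by linarith : 0 < l w - l x)]
  exact ⟨hx, fun y hy => (hw.2 y hy).trans (by linarith)⟩

theorem IsFace.convex {σ τ : Set (Fin n → ℝ)} (h : IsFace σ τ) (hσ : Convex ℝ σ) : Convex ℝ τ :=
  h.2.convex hσ

/-- The smallest face of the polyhedron `P` that contains the point `w`. -/
def minFace (w : Fin n → ℝ) (P : Set (Fin n → ℝ)) : Set (Fin n → ℝ) :=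
  {x | x ∈ P ∧ w - x ∈ tcone w P}

theorem IsPoly.isFace_minFace {P : Set (Fin n → ℝ)} (h : IsPoly P) {w : Fin n → ℝ} (hw : w ∈ P) :
    IsFace P (minFace w P) := by
  classical
  refine ⟨⟨w, hw, ?_⟩, fun _ => ?_⟩
  · simpa using (h.isPolyCone_tcone hw).zero_mem
  obtain ⟨A, rfl⟩ := h
  -- The sum of the constraints active at `w` exposes the minimal face: it attains the sum of the
  -- bounds only where each of these constraints is an equality.
  set B := A.filter fun a => a.1 w = a.2 with hB
  refine ⟨LinearMap.toContinuousLinearMap (∑ a ∈ B, a.1), ?_⟩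
  have hlw : (∑ a ∈ B, a.1) w = ∑ a ∈ B, a.2 := by
    rw [LinearMap.sum_apply]
    exact Finset.sum_congr rfl fun a ha => (Finset.mem_filter.1 ha).2
  have hle : ∀ y ∈ {x | ∀ a ∈ A, a.1 x ≤ a.2}, ∀ a ∈ B, a.1 y ≤ a.2 := fun y hy a ha =>
    hy a (Finset.mem_filter.1 ha).1
  ext x
  simp only [LinearMap.coe_toContinuousLinearMap']
  refine and_congr_right fun hx => ?_
  rw [mem_tcone_ineq, and_iff_right (show ∀ a ∈ A, a.1 w ≤ a.2 from hw)]
  constructor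
  · intro hx' y hy
    rw [LinearMap.sum_apply, LinearMap.sum_apply]
    refine Finset.sum_le_sum fun a ha => ?_
    have := hx' a (Finset.mem_filter.1 ha).1 (Finset.mem_filter.1 ha).2
    rw [map_sub, (Finset.mem_filter.1 ha).2] at this
    linarith [hle y hy a ha]
  · intro hx' a ha haw
    have h1 := hx' w hw
    rw [hlw, LinearMap.sum_apply] at h1
    have h2 := (Finset.sum_eq_sum_iff_of_le (hle x hx)).1
      (le_antisymm (Finset.sum_le_sum (hle x hx)) h1) a (Finset.mem_filter.2 ⟨ha, haw⟩)
    rw [map_sub, haw, h2, sub_self]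

theorem IsPoly.inRel_minFace {P : Set (Fin n → ℝ)} (h : IsPoly P) {w : Fin n → ℝ} (hw : w ∈ P) :
    InRel w (minFace w P) := by
  refine ⟨⟨hw, by simpa using (h.isPolyCone_tcone hw).zero_mem⟩, fun x hx => ?_⟩
  obtain ⟨d, hd, hd'⟩ := exists_pos_of_eventually hx.2
  refine ⟨d, hd, hd', ?_⟩
  have : w - (w + d • (w - x)) = d • (x - w) := by module
  rw [this]
  exact (h.isPolyCone_tcone hw).smul_mem (h.convex.sub_mem_tcone hw hx.1) hd.le

theorem IsPoly.vectorSpan_minFace {P : Set (Fin n → ℝ)} (h : IsPoly P) {w : Fin n → ℝ}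
    (hw : w ∈ P) : vectorSpan ℝ (minFace w P) = lin w P := by
  have hwm := (h.inRel_minFace hw).1
  apply le_antisymm
  · rw [vectorSpan_eq_span_vsub_set_right ℝ hwm, Submodule.span_le]
    rintro _ ⟨x, hx, rfl⟩
    rw [SetLike.mem_coe, h.mem_lin hw]
    exact ⟨h.convex.sub_mem_tcone hw hx.1, by simpa using hx.2⟩
  · intro z hz
    obtain ⟨h1, h2⟩ := (h.mem_lin hw).1 hz
    obtain ⟨e, he, he'⟩ := exists_pos_of_eventually h1
    have h3 : w + e • z ∈ minFace w P := by
      refine ⟨he', ?_⟩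
      have : w - (w + e • z) = e • -z := by module
      rw [this]
      exact (h.isPolyCone_tcone hw).smul_mem h2 he.le
    have h4 := vsub_mem_vectorSpan ℝ h3 hwm
    rw [vsub_eq_sub, add_sub_cancel_left] at h4
    simpa [smul_smul, he.ne'] using Submodule.smul_mem _ e⁻¹ h4

theorem IsFace.eq_minFace {P F : Set (Fin n → ℝ)} (hP : Convex ℝ P) (h : IsFace P F)
    {w : Fin n → ℝ} (hw : InRel w F) : F = minFace w P := by
  apply Set.Subset.antisymm
  · intro x hx
    obtain ⟨d, hd, hd'⟩ := hw.2 x hx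
    exact ⟨h.subset hx, hP.mem_tcone_of (h.subset hw.1) hd (h.subset hd')⟩
  · rintro x ⟨hx, hx'⟩
    obtain ⟨d, hd, hd'⟩ := exists_pos_of_eventually hx'
    exact h.mem_of_add hw.1 hx hd hd'

theorem minFace_inter (w : Fin n → ℝ) (P Q : Set (Fin n → ℝ)) :
    minFace w (P ∩ Q) = minFace w P ∩ minFace w Q := by
  ext x
  simp only [minFace, tcone_inter, Set.mem_inter_iff, Set.mem_ofPred_eq]
  tauto

theorem IsFace.minFace_eq {P F : Set (Fin n → ℝ)} (h : IsFace P F) {w : Fin n → ℝ} (hw : w ∈ F) :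
    minFace w F = minFace w P := by
  ext x
  constructor
  · exact fun hx => ⟨h.subset hx.1, tcone_mono h.subset hx.2⟩
  · rintro ⟨hx, hx'⟩
    obtain ⟨d, hd, hd'⟩ := exists_pos_of_eventually hx'
    refine ⟨h.mem_of_add hw hx hd hd', ?_⟩
    have hxF := h.mem_of_add hw hx hd hd'
    filter_upwards [hx', self_mem_nhdsWithin] with e he he0
    have he0 : 0 < e := he0
    refine h.mem_of_add hw he (inv_pos.2 he0) ?_
    have : w + e⁻¹ • (w - (w + e • (w - x))) = x := by
      rw [sub_add_cancel_left, smul_neg, smul_smul, inv_mul_cancel₀ he0.ne', one_smul]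
      abel
    rw [this]
    exact hx

/-- Exposed faces of convex sets are not transitive in general. For polyhedra every face is the
minimal face of any of its relative interior points, and minimal faces do not change when `P` is
replaced by a face through the point. -/
theorem IsFace.trans {P F G : Set (Fin n → ℝ)} (hP : IsPoly P) (h : IsFace P F)
    (h' : IsFace F G) : IsFace P G := by
  obtain ⟨w, hw⟩ := exists_inRel (h'.convex (h.convex hP.convex)) h'.1
  rw [h'.eq_minFace (h.convex hP.convex) hw, h.minFace_eq (h'.subset hw.1)]
  exact hP.isFace_minFace (h.subset (h'.subset hw.1))

theorem IsFace.inter {P Q F G : Set (Fin n → ℝ)} (h : IsFace P F) (h' : IsFace Q G)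
    (hne : (F ∩ G).Nonempty) : IsFace (P ∩ Q) (F ∩ G) := by
  refine ⟨hne, fun _ => ?_⟩
  obtain ⟨w, hw, hw'⟩ := hne
  obtain ⟨l, hl⟩ := h.exists_functional
  obtain ⟨m, hm⟩ := h'.exists_functional
  refine ⟨l + m, ?_⟩
  ext x
  rw [hl] at hw ⊢
  rw [hm] at hw' ⊢
  simp only [Set.mem_inter_iff, Set.mem_ofPred_eq, add_apply]
  constructor
  · rintro ⟨⟨h1, h2⟩, h3, h4⟩
    exact ⟨⟨h1, h3⟩, fun y hy => add_le_add (h2 y hy.1) (h4 y hy.2)⟩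
  · rintro ⟨⟨h1, h2⟩, h3⟩
    have h4 := h3 w ⟨hw.1, hw'.1⟩
    have h5 := hw.2 x h1
    have h6 := hw'.2 x h2
    exact ⟨⟨h1, fun y hy => (hw.2 y hy).trans (by linarith)⟩, h2,
      fun y hy => (hw'.2 y hy).trans (by linarith)⟩

theorem IsFace.eq_of_vectorSpan {P F : Set (Fin n → ℝ)} (hP : IsPoly P) (h : IsFace P F)
    (hv : vectorSpan ℝ P ≤ vectorSpan ℝ F) : F = P := by
  obtain ⟨w, hw⟩ := exists_inRel (h.convex hP.convex) h.1
  refine h.subset.antisymm fun x hx => ?_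
  rw [h.eq_minFace hP.convex hw]
  refine ⟨hx, ?_⟩
  have h1 := hv (vsub_mem_vectorSpan ℝ hx (h.subset hw.1))
  rw [h.eq_minFace hP.convex hw, hP.vectorSpan_minFace (h.subset hw.1),
    hP.mem_lin (h.subset hw.1)] at h1
  simpa using h1.2

theorem vectorSpan_tcone {σ : Set (Fin n → ℝ)} (h : IsPoly σ) {w : Fin n → ℝ} (hw : w ∈ σ) :
    vectorSpan ℝ (tcone w σ) = vectorSpan ℝ σ := by
  rw [← h.span_tcone hw, vectorSpan_eq_span_vsub_set_right ℝ (h.isPolyCone_tcone hw).zero_mem]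
  simp

theorem IsRationalPolyhedron.isRatSub_vectorSpan {σ : Set (Fin n → ℝ)}
    (h : IsRationalPolyhedron σ) (hne : σ.Nonempty) : IsRatSub (vectorSpan ℝ σ) := by
  obtain ⟨w, hw⟩ := exists_inRel h.isPoly.convex hne
  rw [← h.isPoly.lin_eq_vectorSpan_of_inRel hw]
  exact h.isRatSub_lin hw.1

end Faces

/-! ### Links of complexes and multiplicities as finite sums -/

namespace WeightedComplex

variable {n : ℕ} {X Y : WeightedComplex n}

theorem IsPolyhedralComplex.isPoly (hX : X.IsPolyhedralComplex) {σ : Set (Fin n → ℝ)}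
    (h : σ ∈ X.cells) : IsPoly σ := (hX.rational σ h).isPoly

theorem IsPolyhedralComplex.subset_of_inRel (hX : X.IsPolyhedralComplex) {γ σ σ' : Set (Fin n → ℝ)}
    (hσ : σ ∈ X.cells) (hσ' : σ' ∈ X.cells) (hγ : γ ⊆ σ) {w : Fin n → ℝ} (hw : InRel w γ)
    (hw' : w ∈ σ') : γ ⊆ σ' := by
  intro x hx
  obtain ⟨d, hd, hd'⟩ := hw.2 x hx
  exact ((hX.inter_face σ hσ σ' hσ' ⟨w, hγ hw.1, hw'⟩).1.mem_of_add ⟨hγ hw.1, hw'⟩ (hγ hx) hd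
    (hγ hd')).2

/-- Every segment from `w` in `σ` starts in the face `σ ∩ σ'`, and by extremality the face contains
its end. Consequently distinct facets through `w` have distinct tangent cones, and no multiplicities
are merged in a link. -/
theorem IsPolyhedralComplex.subset_of_tcone_subset (hX : X.IsPolyhedralComplex)
    {σ σ' : Set (Fin n → ℝ)} (hσ : σ ∈ X.cells) (hσ' : σ' ∈ X.cells) {w : Fin n → ℝ} (hw : w ∈ σ)
    (h : tcone w σ ⊆ tcone w σ') : σ ⊆ σ' := by
  intro x hx
  have h1 := h ((hX.isPoly hσ).convex.sub_mem_tcone hw hx)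
  have hw' := (hX.isPoly hσ').mem_of_tcone h1
  have h2 := (hX.isPoly hσ).convex.sub_mem_tcone hw hx
  have h3 : x - w ∈ tcone w (σ ∩ σ') := by rw [tcone_inter]; exact ⟨h2, h1⟩
  obtain ⟨d, hd, hd'⟩ := exists_pos_of_eventually h3
  exact ((hX.inter_face σ hσ σ' hσ' ⟨w, hw, hw'⟩).1.mem_of_mem_segment ⟨hw, hw'⟩ hx hd hd').2

theorem IsFacet.eq_of_subset {σ σ' : Set (Fin n → ℝ)} (h : X.IsFacet σ) (h' : σ' ∈ X.cells)
    (hs : σ ⊆ σ') : σ = σ' :=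
  h.eq_of_le h' hs

theorem IsPolyhedralComplex.exists_facet (hX : X.IsPolyhedralComplex) {σ : Set (Fin n → ℝ)}
    (h : σ ∈ X.cells) : ∃ σ', X.IsFacet σ' ∧ σ ⊆ σ' := by
  obtain ⟨σ', h1, h2⟩ := hX.finite.exists_le_maximal h
  exact ⟨σ', h2, h1⟩

theorem IsPolyhedralComplex.eq_of_tcone_eq (hX : X.IsPolyhedralComplex) {σ σ' : Set (Fin n → ℝ)}
    (hσ : X.IsFacet σ) (hσ' : X.IsFacet σ') {w : Fin n → ℝ} (hw : w ∈ σ)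
    (h : tcone w σ = tcone w σ') : σ = σ' :=
  hσ.eq_of_subset hσ'.1 (hX.subset_of_tcone_subset hσ.1 hσ'.1 hw h.le)

/-- The facets that contain the point `w`. -/
noncomputable def IsPolyhedralComplex.facetsAt (hX : X.IsPolyhedralComplex) (w : Fin n → ℝ) :
    Finset (Set (Fin n → ℝ)) :=
  (hX.finite.subset (t := {σ | X.IsFacet σ ∧ w ∈ σ}) fun _ h => h.1.1).toFinset

theorem IsPolyhedralComplex.mem_facetsAt {hX : X.IsPolyhedralComplex} {w : Fin n → ℝ}
    {σ : Set (Fin n → ℝ)} : σ ∈ hX.facetsAt w ↔ X.IsFacet σ ∧ w ∈ σ := by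
  simp [facetsAt]

section Link

variable (hX : X.IsPolyhedralComplex) {γ : Set (Fin n → ℝ)} (hγ : Convex ℝ γ) {w : Fin n → ℝ}
  (hw : InRel w γ) (hγX : ∀ σ ∈ X.cells, w ∈ σ → γ ⊆ σ)
include hX hγ hw hγX

theorem IsPolyhedralComplex.isFacet_link_iff {C : Set (Fin n → ℝ)} :
    (X.link γ).IsFacet C ↔ ∃ σ, X.IsFacet σ ∧ w ∈ σ ∧ C = tcone w σ := by
  have hlink : ∀ σ ∈ X.cells, γ ⊆ σ → linkAlong γ σ = tcone w σ := fun σ hσ hs =>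
    (hX.isPoly hσ).linkAlong_eq hγ hs hw
  constructor
  · rintro ⟨⟨σ, hσ, hs, rfl⟩, hmax⟩
    obtain ⟨σ', hσ', hss⟩ := hX.exists_facet hσ
    refine ⟨σ', hσ', hss (hs hw.1), ?_⟩
    rw [← hlink σ' hσ'.1 (hs.trans hss)]
    exact (linkAlong_mono hss).antisymm
      (hmax ⟨σ', hσ'.1, hs.trans hss, rfl⟩ (linkAlong_mono hss))
  · rintro ⟨σ, hσ, hwσ, rfl⟩
    refine ⟨⟨σ, hσ.1, hγX σ hσ.1 hwσ, (hlink σ hσ.1 (hγX σ hσ.1 hwσ)).symm⟩, ?_⟩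
    rintro _ ⟨σ', hσ', hs', rfl⟩ hle
    rw [hlink σ' hσ' hs'] at hle ⊢
    have := hσ.eq_of_subset hσ' (hX.subset_of_tcone_subset hσ.1 hσ' hwσ hle)
    rw [this]

theorem IsPolyhedralComplex.link_mult {σ : Set (Fin n → ℝ)} (hσ : X.IsFacet σ) (hwσ : w ∈ σ) :
    (X.link γ).mult (tcone w σ) = X.mult σ := by
  change (∑ᶠ (τ : Set (Fin n → ℝ)) (_ : X.IsFacet τ ∧ γ ⊆ τ ∧ tcone w σ = linkAlong γ τ),
    X.mult τ) = _
  have : ∀ τ, (X.IsFacet τ ∧ γ ⊆ τ ∧ tcone w σ = linkAlong γ τ) ↔ τ = σ := by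
    intro τ
    constructor
    · rintro ⟨h1, h2, h3⟩
      rw [(hX.isPoly h1.1).linkAlong_eq hγ h2 hw] at h3
      exact (hX.eq_of_tcone_eq hσ h1 hwσ h3).symm
    · rintro rfl
      exact ⟨hσ, hγX τ hσ.1 hwσ, ((hX.isPoly hσ.1).linkAlong_eq hγ (hγX τ hσ.1 hwσ) hw).symm⟩
  simp only [this, finsum_cond_eq_left]

theorem IsPolyhedralComplex.mem_link_supp {u : Fin n → ℝ} :
    u ∈ (X.link γ).supp ↔ ∃ σ, X.IsFacet σ ∧ w ∈ σ ∧ X.mult σ ≠ 0 ∧ u ∈ tcone w σ := by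
  constructor
  · rintro ⟨C, hC, hm, hu⟩
    obtain ⟨σ, h1, h2, rfl⟩ := (hX.isFacet_link_iff hγ hw hγX).1 hC
    exact ⟨σ, h1, h2, by rwa [hX.link_mult hγ hw hγX h1 h2] at hm, hu⟩
  · rintro ⟨σ, h1, h2, hm, hu⟩
    exact ⟨_, (hX.isFacet_link_iff hγ hw hγX).2 ⟨σ, h1, h2, rfl⟩,
      by rwa [hX.link_mult hγ hw hγX h1 h2], hu⟩

end Link

theorem isFacet_reflect_iff {C : Set (Fin n → ℝ)} : X.reflect.IsFacet C ↔ X.IsFacet (-C) := by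
  constructor
  · rintro ⟨h1, h2⟩
    refine ⟨h1, fun D hD hle => ?_⟩
    have := h2 (y := -D) (by simpa [reflect] using hD) (Set.neg_subset_neg.1 (by simpa using hle))
    exact Set.neg_subset_neg.1 (by simpa using this)
  · rintro ⟨h1, h2⟩
    refine ⟨h1, fun D hD hle => ?_⟩
    exact Set.neg_subset_neg.1 (h2 hD (Set.neg_subset_neg.2 hle))

theorem mem_reflect_supp {u : Fin n → ℝ} : u ∈ X.reflect.supp ↔ -u ∈ X.supp := by
  constructor
  · rintro ⟨C, hC, hm, hu⟩
    exact ⟨-C, isFacet_reflect_iff.1 hC, hm, by simpa using hu⟩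
  · rintro ⟨C, hC, hm, hu⟩
    exact ⟨-C, isFacet_reflect_iff.2 (by simpa using hC), by simpa [reflect] using hm,
      by simpa using hu⟩

theorem latticeOf_neg (C : Set (Fin n → ℝ)) : latticeOf (-C) = latticeOf C := by
  have : vectorSpan ℝ (-C) = vectorSpan ℝ C := by
    rw [vectorSpan_def, vectorSpan_def]
    have : -C -ᵥ -C = -(C -ᵥ C) := by
      ext x
      simp only [Set.mem_vsub, Set.mem_neg, vsub_eq_sub]
      constructor
      · rintro ⟨a, ha, b, hb, rfl⟩
        exact ⟨-a, ha, -b, hb, by abel⟩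
      · rintro ⟨a, ha, b, hb, h⟩
        exact ⟨-a, by simpa, -b, by simpa, by rw [← neg_neg x, ← h]; abel⟩
    rw [this, Submodule.span_neg]
  rw [latticeOf_eq, latticeOf_eq, this]

open Classical in
/-- The multiplicity of the difference of two links as a sum over pairs of facets. -/
theorem sumMult_link (hX : X.IsPolyhedralComplex) (hY : Y.IsPolyhedralComplex)
    {γ : Set (Fin n → ℝ)} (hγ : Convex ℝ γ) {w : Fin n → ℝ} (hw : InRel w γ)
    (hγX : ∀ σ ∈ X.cells, w ∈ σ → γ ⊆ σ) (hγY : ∀ σ ∈ Y.cells, w ∈ σ → γ ⊆ σ) (v : Fin n → ℝ) :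
    (X.link γ).sumMult (Y.link γ).reflect v = ∑ P ∈ hX.facetsAt w ×ˢ hY.facetsAt w,
      if v ∈ tcone w P.1 - tcone w P.2 then
        X.mult P.1 * Y.mult P.2 * ((latticeOf P.1 ⊔ latticeOf P.2).index : ℚ) else 0 := by
  let g : Set (Fin n → ℝ) × Set (Fin n → ℝ) → Set (Fin n → ℝ) × Set (Fin n → ℝ) :=
    fun P => (tcone w P.1, -tcone w P.2)
  set T := (hX.facetsAt w ×ˢ hY.facetsAt w).filter fun P => v ∈ tcone w P.1 - tcone w P.2 with hT
  have hTmem : ∀ P, P ∈ T ↔ ((X.IsFacet P.1 ∧ w ∈ P.1) ∧ Y.IsFacet P.2 ∧ w ∈ P.2) ∧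
      v ∈ tcone w P.1 - tcone w P.2 := fun P => by
    simp [hT, IsPolyhedralComplex.mem_facetsAt]
  have hset : ∀ P : Set (Fin n → ℝ) × Set (Fin n → ℝ), ((X.link γ).IsFacet P.1 ∧
      (Y.link γ).reflect.IsFacet P.2 ∧ v ∈ P.1 + P.2) ↔ P ∈ g '' (T : Set _) := by
    rintro ⟨C, D⟩
    simp only [isFacet_reflect_iff, hX.isFacet_link_iff hγ hw hγX, hY.isFacet_link_iff hγ hw hγY]
    constructor
    · rintro ⟨⟨σ, h1, h2, rfl⟩, ⟨τ, h3, h4, h5⟩, hv⟩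
      rw [neg_eq_iff_eq_neg] at h5
      subst h5
      refine ⟨(σ, τ), ?_, rfl⟩
      rw [Finset.mem_coe, hTmem]
      exact ⟨⟨⟨h1, h2⟩, h3, h4⟩, by rwa [sub_eq_add_neg]⟩
    · rintro ⟨⟨σ, τ⟩, hP, h⟩
      rw [Finset.mem_coe, hTmem] at hP
      obtain ⟨⟨⟨h1, h2⟩, h3, h4⟩, hv⟩ := hP
      simp only [g, Prod.mk.injEq] at h
      obtain ⟨rfl, rfl⟩ := h
      exact ⟨⟨σ, h1, h2, rfl⟩, ⟨τ, h3, h4, neg_neg _⟩, by rwa [← sub_eq_add_neg]⟩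
  have hinj : Set.InjOn g (T : Set _) := by
    rintro ⟨σ, τ⟩ hP ⟨σ', τ'⟩ hP' h
    rw [Finset.mem_coe, hTmem] at hP hP'
    simp only [g, Prod.mk.injEq, neg_inj] at h
    exact Prod.ext (hX.eq_of_tcone_eq hP.1.1.1 hP'.1.1.1 hP.1.1.2 h.1)
      (hY.eq_of_tcone_eq hP.1.2.1 hP'.1.2.1 hP.1.2.2 h.2)
  rw [sumMult]
  simp only [hset]
  rw [finsum_mem_image hinj, finsum_mem_coe_finset, ← Finset.sum_filter]
  refine Finset.sum_congr rfl fun P hP => ?_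
  obtain ⟨⟨⟨h1, h2⟩, h3, h4⟩, -⟩ := (hTmem P).1 hP
  have e1 : latticeOf (tcone w P.1) = latticeOf P.1 := by
    rw [latticeOf_eq, vectorSpan_tcone (hX.isPoly h1.1) h2, latticeOf_eq]
  have e2 : latticeOf (tcone w P.2) = latticeOf P.2 := by
    rw [latticeOf_eq, vectorSpan_tcone (hY.isPoly h3.1) h4, latticeOf_eq]
  simp only [g, latticeOf_neg, e1, e2, hX.link_mult hγ hw hγX h1 h2]
  rw [show (Y.link γ).reflect.mult (-tcone w P.2) = Y.mult P.2 by
    simp only [reflect, neg_neg]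
    exact hY.link_mult hγ hw hγY h3 h4]

end WeightedComplex

/-! ### Homomorphisms of lattices and their real extensions -/

section LatticeMaps

variable {Λ Λ' W W' : Type*} [AddCommGroup Λ] [AddCommGroup Λ'] [AddCommGroup W] [Module ℝ W]
  [AddCommGroup W'] [Module ℝ W']

theorem span_image_map {j : Λ →+ W} {j' : Λ' →+ W'} {L : Λ →+ Λ'} {Lr : W →ₗ[ℝ] W'}
    (hL : ∀ x, Lr (j x) = j' (L x)) (G : AddSubgroup Λ) :
    Submodule.span ℝ (j' '' (G.map L : Set Λ')) = (Submodule.span ℝ (j '' (G : Set Λ))).map Lr := by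
  rw [Submodule.map_span, AddSubgroup.coe_map, Set.image_image, Set.image_image]
  simp only [hL]

theorem span_image_prod (j : Λ →+ W) (j' : Λ' →+ W') (G : AddSubgroup Λ) (G' : AddSubgroup Λ') :
    Submodule.span ℝ (j.prodMap j' '' (G.prod G' : Set (Λ × Λ'))) =
      (Submodule.span ℝ (j '' (G : Set Λ))).prod (Submodule.span ℝ (j' '' (G' : Set Λ'))) := by
  apply le_antisymm
  · rw [Submodule.span_le]
    rintro _ ⟨⟨x, y⟩, ⟨hx, hy⟩, rfl⟩
    exact ⟨Submodule.subset_span ⟨x, hx, rfl⟩, Submodule.subset_span ⟨y, hy, rfl⟩⟩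
  · rintro ⟨w, w'⟩ ⟨hw, hw'⟩
    have h1 := Submodule.mem_map_of_mem (f := LinearMap.inl ℝ W W') hw
    have h2 := Submodule.mem_map_of_mem (f := LinearMap.inr ℝ W W') hw'
    rw [Submodule.map_span] at h1 h2
    have h3 : (w, w') = LinearMap.inl ℝ W W' w + LinearMap.inr ℝ W W' w' := by simp
    rw [h3]
    refine add_mem (Submodule.span_mono ?_ h1) (Submodule.span_mono ?_ h2)
    · rintro _ ⟨_, ⟨x, hx, rfl⟩, rfl⟩
      exact ⟨(x, 0), ⟨hx, zero_mem _⟩, by simp⟩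
    · rintro _ ⟨_, ⟨x, hx, rfl⟩, rfl⟩
      exact ⟨(0, x), ⟨zero_mem _, hx⟩, by simp⟩

theorem sup_zmultiples_prod (A : AddSubgroup Λ) (B : AddSubgroup Λ') (v : Λ) :
    (A ⊔ AddSubgroup.zmultiples v).prod B = A.prod B ⊔ AddSubgroup.zmultiples (v, 0) := by
  apply le_antisymm
  · rintro ⟨x, y⟩ ⟨hx, hy⟩
    obtain ⟨a, ha, b, hb, rfl⟩ := AddSubgroup.mem_sup.1 hx
    obtain ⟨c, rfl⟩ := AddSubgroup.mem_zmultiples_iff.1 hb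
    exact AddSubgroup.mem_sup.2 ⟨(a, y), ⟨ha, hy⟩, c • (v, 0),
      AddSubgroup.mem_zmultiples_iff.2 ⟨c, rfl⟩, by simp⟩
  · refine sup_le (AddSubgroup.prod_mono le_sup_left le_rfl) ?_
    rw [AddSubgroup.zmultiples_le]
    exact ⟨AddSubgroup.mem_sup_right (AddSubgroup.mem_zmultiples v), zero_mem _⟩

theorem span_latPts_prod {n : ℕ} {E F : Submodule ℝ (Fin n → ℝ)} (hE : IsRatSub E)
    (hF : IsRatSub F) : Submodule.span ℝ ((incl n).prodMap (incl n) ''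
      ((latPts E).prod (latPts F) : Set ((Fin n → ℤ) × (Fin n → ℤ)))) = E.prod F := by
  rw [span_image_prod, hE.span_latPts, hF.span_latPts]

theorem finrank_submodule_prod {V V' : Type*} [AddCommGroup V] [Module ℝ V] [AddCommGroup V']
    [Module ℝ V'] [FiniteDimensional ℝ V] [FiniteDimensional ℝ V'] (E : Submodule ℝ V)
    (F : Submodule ℝ V') :
    Module.finrank ℝ (E.prod F) = Module.finrank ℝ E + Module.finrank ℝ F := by
  let f : E.prod F ≃ₗ[ℝ] E × F :=
    { toFun := fun x => (⟨x.1.1, x.2.1⟩, ⟨x.1.2, x.2.2⟩)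
      invFun := fun x => ⟨(x.1, x.2), x.1.2, x.2.2⟩
      map_add' := fun _ _ => rfl
      map_smul' := fun _ _ => rfl
      left_inv := fun _ => rfl
      right_inv := fun _ => rfl }
  rw [f.finrank_eq, Module.finrank_prod]

/-- The image of a product of lattices of points has finite index exactly if the real extension
of the homomorphism is surjective on the product of the subspaces. -/
theorem index_map_prod_ne_zero_iff {n : ℕ} [AddGroup.FG Λ] {j : Λ →+ W} (hj : IsLat j)
    {L : (Fin n → ℤ) × (Fin n → ℤ) →+ Λ} {Lr : (Fin n → ℝ) × (Fin n → ℝ) →ₗ[ℝ] W}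
    (hL : ∀ x, Lr ((incl n).prodMap (incl n) x) = j (L x)) {E F : Submodule ℝ (Fin n → ℝ)}
    (hE : IsRatSub E) (hF : IsRatSub F) :
    (((latPts E).prod (latPts F)).map L).index ≠ 0 ↔ (E.prod F).map Lr = ⊤ := by
  rw [hj.index_ne_zero_iff, span_image_map hL, span_latPts_prod hE hF]

end LatticeMaps

/-! ### Balancing of products of links -/

namespace WeightedComplex

variable {n p q : ℕ} {X Y : WeightedComplex n}

/-- The point `w + e • y` with small `e` serves all cells at once. Statements about tangent cones of
the link at `y` become statements about `X` at `x`, so it is never necessary to prove separately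
that a link is balanced. -/
theorem IsPolyhedralComplex.exists_translate (hX : X.IsPolyhedralComplex) (w y : Fin n → ℝ) :
    ∃ x, ∀ σ ∈ X.cells, (x ∈ σ ↔ y ∈ tcone w σ) ∧
      (y ∈ tcone w σ → tcone x σ = tcone y (tcone w σ)) := by
  have : ∀ᶠ e : ℝ in 𝓝[>] 0, ∀ σ ∈ X.cells, (w + e • y ∈ σ ↔ y ∈ tcone w σ) ∧
      (y ∈ tcone w σ → tcone (w + e • y) σ = tcone y (tcone w σ)) := by
    refine (hX.finite.eventually_all).2 fun σ hσ => ?_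
    have hp := hX.isPoly hσ
    by_cases hw : w ∈ σ
    · exact hp.eventually_tcone_add hw y
    · filter_upwards [hp.eventually_mem_iff w y] with e he
      exact ⟨he, fun h => absurd (hp.mem_of_tcone h) hw⟩
  obtain ⟨e, he⟩ := this.exists
  exact ⟨_, he⟩

theorem IsPolyhedralComplex.eq_of_inRel (hX : X.IsPolyhedralComplex) {σ σ' : Set (Fin n → ℝ)}
    (hσ : X.IsFacet σ) (hσ' : X.IsFacet σ') {x : Fin n → ℝ} (hx : x ∈ σ) (hx' : x ∈ σ')
    (hl : vectorSpan ℝ σ ≤ lin x σ) : σ = σ' :=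
  hσ.eq_of_subset hσ'.1 (hX.subset_of_inRel hσ.1 hσ'.1 subset_rfl
    ((hX.isPoly hσ.1).inRel_of_lin_eq hx hl) hx')

theorem IsPolyhedralComplex.isRatSub (hX : X.IsPolyhedralComplex) {σ : Set (Fin n → ℝ)}
    (hσ : σ ∈ X.cells) : IsRatSub (vectorSpan ℝ σ) :=
  (hX.rational σ hσ).isRatSub_vectorSpan (hX.nonempty σ hσ)

theorem mem_span_rat_le {E : Submodule ℝ (Fin n → ℝ)} {x : Fin n → ℝ}
    (hx : x ∈ Submodule.span ℚ (incl n '' (latPts E : Set (Fin n → ℤ)))) : x ∈ E := by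
  have : Submodule.span ℚ (incl n '' (latPts E : Set (Fin n → ℤ))) ≤ E.restrictScalars ℚ := by
    rw [Submodule.span_le]
    rintro _ ⟨x, hx, rfl⟩
    exact hx
  exact this hx

/-- Near a ridge of `X` and the interior of a facet of `Y` the lattice indices are the absolute
values of a functional on the balanced lattice normals. -/
theorem IsTropicalCycle.exists_ridge_functional {Λ W : Type*} [AddCommGroup Λ] [AddGroup.FG Λ]
    [AddCommGroup W] [Module ℝ W] [FiniteDimensional ℝ W] {j : Λ →+ W} (hj : IsLat j)
    {L : (Fin n → ℤ) × (Fin n → ℤ) →+ Λ} {Lr : (Fin n → ℝ) × (Fin n → ℝ) →ₗ[ℝ] W}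
    (hL : ∀ x, Lr ((incl n).prodMap (incl n) x) = j (L x)) (hX : X.IsTropicalCycle p)
    {w : Fin n → ℝ} {σ₁ : Set (Fin n → ℝ)} (hσ₁ : X.IsFacet σ₁)
    {F : Submodule ℝ (Fin n → ℝ)} (hF : IsRatSub F)
    (hdim : dim σ₁ + Module.finrank ℝ F = Module.finrank ℝ W) {y : Fin n → ℝ}
    (hy : y ∈ tcone w σ₁) (hlin : Module.finrank ℝ (lin y (tcone w σ₁)) + 1 = dim σ₁) :
    ∃ (l : Module.Dual ℝ W) (c : ℝ) (r : Set (Fin n → ℝ) → ℝ),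
      (∑ᶠ (σ : Set (Fin n → ℝ)) (_ : X.IsFacet σ ∧ y ∈ tcone w σ), (X.mult σ : ℝ) * r σ) = 0 ∧
      ∀ σ, X.IsFacet σ → y ∈ tcone w σ →
        ((((latticeOf σ).prod (latPts F)).map L).index : ℝ) = c * |r σ| ∧
        (r σ ≠ 0 → ∀ z₁ ∈ vectorSpan ℝ σ, ∀ z₂ ∈ F,
          (z₁ ∈ tcone y (tcone w σ) ↔ 0 ≤ r σ * l (Lr (z₁, z₂)))) := by
  have hXc := hX.isPolyhedralComplex
  obtain ⟨x, hx⟩ := hXc.exists_translate w y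
  have hx₁ := (hx σ₁ hσ₁.1).1.2 hy
  have hp₁ := hXc.isPoly hσ₁.1
  have hlin' : Module.finrank ℝ (lin x σ₁) + 1 = dim σ₁ := by
    rw [← hlin]
    unfold lin
    rw [(hx σ₁ hσ₁.1).2 hy]
  set τ := minFace x σ₁ with hτ
  have hτF : IsFace σ₁ τ := hp₁.isFace_minFace hx₁
  have hτX : τ ∈ X.cells := hXc.face_mem σ₁ hσ₁.1 τ hτF
  have hxτ : InRel x τ := hp₁.inRel_minFace hx₁
  have hTspan : vectorSpan ℝ τ = lin x σ₁ := hp₁.vectorSpan_minFace hx₁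
  have hτdim : dim τ + 1 = dim σ₁ := by rw [dim, hTspan, hlin']
  have hpure := hX.pure σ₁ hσ₁
  obtain ⟨v, hv, hsum⟩ := hX.balanced τ hτX (by omega)
  have hcond : ∀ σ, (X.IsFacet σ ∧ y ∈ tcone w σ) ↔ (X.IsFacet σ ∧ τ ⊆ σ) := fun σ =>
    and_congr_right fun hσ => by
      rw [← (hx σ hσ.1).1]
      exact ⟨fun h => hXc.subset_of_inRel hσ₁.1 hσ.1 hτF.subset hxτ h, fun h => h hxτ.1⟩
  have hT := hXc.isRatSub hτX
  set H := ((latticeOf τ).prod (latPts F)).map L with hH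
  -- The product of the spans of the ridge and of `F` has dimension one less than `W`, so the image
  -- of its lattice has infinite index. The functional `l` comes from this, and the values `l (v σ)`
  -- give the indices.
  have hH0 : H.index = 0 := by
    by_contra h
    have h1 := (index_map_prod_ne_zero_iff hj hL hT hF).1 h
    have h2 := Submodule.finrank_map_le Lr ((vectorSpan ℝ τ).prod F)
    rw [h1, finrank_top, finrank_submodule_prod] at h2
    have h3 : Module.finrank ℝ (vectorSpan ℝ τ) = dim τ := rfl
    omega
  obtain ⟨l₀, k, hl₀, hk⟩ := exists_index_sup_zmultiples hH0
  obtain ⟨l, hl⟩ := hj.extend l₀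
  have hker : ∀ z ∈ (vectorSpan ℝ τ).prod F, l (Lr z) = 0 := by
    have : (vectorSpan ℝ τ).prod F ≤ LinearMap.ker (l ∘ₗ Lr) := by
      rw [← span_latPts_prod hT hF, Submodule.span_le]
      rintro _ ⟨z, hz, rfl⟩
      have h1 : l₀ (L z) = 0 := hl₀ ⟨z, hz, rfl⟩
      change l (Lr _) = 0
      rw [hL, hl, h1, Int.cast_zero]
    exact fun z hz => this hz
  have hr : ∀ σ, l (Lr (incl n (v σ), 0)) = l₀ (L (v σ, 0)) := fun σ => by
    rw [← hl, ← hL]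
    simp
  refine ⟨l, k, fun σ => l (Lr (incl n (v σ), 0)), ?_, fun σ hσ hyσ => ?_⟩
  · simp only [hcond]
    have hfin : {σ | X.IsFacet σ ∧ τ ⊆ σ}.Finite := hXc.finite.subset fun σ h => h.1.1
    have h1 : ∀ f : Set (Fin n → ℝ) → (Fin n → ℝ), (∑ᶠ (σ : Set (Fin n → ℝ))
        (_ : X.IsFacet σ ∧ τ ⊆ σ), f σ) = ∑ σ ∈ hfin.toFinset, f σ := fun f =>
      finsum_mem_eq_finite_toFinset_sum f hfin
    have h2 : ∀ f : Set (Fin n → ℝ) → ℝ, (∑ᶠ (σ : Set (Fin n → ℝ))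
        (_ : X.IsFacet σ ∧ τ ⊆ σ), f σ) = ∑ σ ∈ hfin.toFinset, f σ := fun f =>
      finsum_mem_eq_finite_toFinset_sum f hfin
    rw [h1] at hsum
    rw [h2]
    -- The functional kills the span of the ridge, hence the balanced sum of lattice normals.
    have h3 : (l ∘ₗ Lr ∘ₗ LinearMap.inl ℝ (Fin n → ℝ) (Fin n → ℝ))
        (∑ σ ∈ hfin.toFinset, X.mult σ • incl n (v σ)) = 0 :=
      hker (_, 0) ⟨mem_span_rat_le hsum, zero_mem F⟩
    rw [map_sum] at h3
    rw [← h3]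
    refine Finset.sum_congr rfl fun σ _ => ?_
    rw [← Rat.cast_smul_eq_qsmul ℝ, map_smul]
    rfl
  have hτσ : τ ⊆ σ := ((hcond σ).1 ⟨hσ, hyσ⟩).2
  obtain ⟨hvlink, hvgen⟩ := hv σ hσ hτσ
  have hp := hXc.isPoly hσ.1
  have hxσ := hτσ hxτ.1
  rw [hp.linkAlong_eq (hτF.convex hp₁.convex) hτσ hxτ] at hvlink
  constructor
  · change _ = (k : ℝ) * |l (Lr (incl n (v σ), 0))|
    rw [← hvgen, sup_zmultiples_prod, AddSubgroup.map_sup, AddMonoidHom.map_zmultiples, hk, hr]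
    push_cast
    rw [Nat.cast_natAbs, Int.cast_abs]
  intro hr0 z₁ hz₁ z₂ hz₂
  have hTlin : vectorSpan ℝ τ ≤ lin x σ := by
    rw [← (hXc.isPoly hτX).lin_eq_vectorSpan_of_inRel hxτ]
    exact lin_mono hτσ
  have hspan : vectorSpan ℝ σ ≤ vectorSpan ℝ τ ⊔ Submodule.span ℝ {incl n (v σ)} :=
    span_le_of_latPts_sup (hXc.isRatSub hσ.1) hvgen
  obtain ⟨t, ht, s, hs, hts⟩ := Submodule.mem_sup.1 (hspan hz₁)
  obtain ⟨c, rfl⟩ := Submodule.mem_span_singleton.1 hs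
  have hval : l (Lr (z₁, z₂)) = c * l (Lr (incl n (v σ), 0)) := by
    have : ((z₁, z₂) : (Fin n → ℝ) × (Fin n → ℝ)) = (t, z₂) + c • (incl n (v σ), 0) := by
      rw [← hts]; simp
    rw [this, map_add, map_add, hker (t, z₂) ⟨ht, hz₂⟩, map_smul, map_smul, zero_add, smul_eq_mul]
  rw [hval, show ∀ a : ℝ, a * (c * a) = c * (a * a) from fun a => by ring,
    mul_nonneg_iff_of_pos_right (mul_self_pos.2 hr0), ← (hx σ hσ.1).2 hyσ, ← hts]
  constructor
  · intro hz
    by_contra hc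
    rw [not_le] at hc
    have h1 : c • incl n (v σ) ∈ tcone x σ := by
      have := hp.sub_mem_tcone_of_lin hxσ hz (hTlin ht)
      rwa [add_sub_cancel_left] at this
    have h2 : -incl n (v σ) ∈ tcone x σ := by
      have := (hp.isPolyCone_tcone hxσ).smul_mem h1 (inv_nonneg.2 (neg_nonneg.2 hc.le))
      rwa [smul_smul, ← neg_inv, neg_mul, inv_mul_cancel₀ hc.ne, neg_one_smul] at this
    -- A negative `c` makes both `v σ` and its negative tangent, so that `x` is a relative interior
    -- point of `σ`. Then `σ = σ₁`, contradicting that `x` lies on a ridge of `σ₁`.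
    have h3 : vectorSpan ℝ σ ≤ lin x σ := hspan.trans (sup_le hTlin (by
      rw [Submodule.span_singleton_le_iff_mem]
      exact (hp.mem_lin hxσ).2 ⟨hvlink, h2⟩))
    have h4 := hXc.eq_of_inRel hσ hσ₁ hxσ hx₁ h3
    subst h4
    have h5 := Submodule.finrank_mono h3
    have h6 : Module.finrank ℝ (vectorSpan ℝ σ) = dim σ := rfl
    omega
  · intro hc
    rw [add_comm]
    exact hp.add_mem_tcone_of_lin hxσ ((hp.isPolyCone_tcone hxσ).smul_mem hvlink hc) (hTlin ht)

/-- A relative interior point of one facet cone of the link lies in no other. In a ridge of a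
product the factor that is a facet is therefore unique. -/
theorem IsPolyhedralComplex.eq_of_vectorSpan_le_lin (hX : X.IsPolyhedralComplex)
    {σ σ' : Set (Fin n → ℝ)} (hσ : X.IsFacet σ) (hσ' : X.IsFacet σ') {w y : Fin n → ℝ}
    (hy : y ∈ tcone w σ) (hy' : y ∈ tcone w σ') (hl : vectorSpan ℝ σ ≤ lin y (tcone w σ)) :
    σ' = σ := by
  obtain ⟨x, hx⟩ := hX.exists_translate w y
  refine (hX.eq_of_inRel hσ hσ' ((hx σ hσ.1).1.2 hy) ((hx σ' hσ'.1).1.2 hy') ?_).symm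
  unfold lin at hl ⊢
  rwa [(hx σ hσ.1).2 hy]

theorem lin_prod {V V' : Type*} [AddCommGroup V] [Module ℝ V] [AddCommGroup V'] [Module ℝ V']
    {σ : Set V} {τ : Set V'} (hσ : IsPolyCone σ) (hτ : IsPolyCone τ) {y : V × V'}
    (hy : y ∈ σ ×ˢ τ) : lin y (σ ×ˢ τ) = (lin y.1 σ).prod (lin y.2 τ) := by
  ext z
  rw [(hσ.prod hτ).isPoly.mem_lin hy, Submodule.mem_prod, hσ.isPoly.mem_lin hy.1,
    hτ.isPoly.mem_lin hy.2, tcone_prod]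
  exact and_and_and_comm

theorem IsPolyhedralComplex.lin_tcone_le (hX : X.IsPolyhedralComplex) {σ : Set (Fin n → ℝ)}
    (hσ : X.IsFacet σ) {w y : Fin n → ℝ} (hw : w ∈ σ) :
    lin y (tcone w σ) ≤ vectorSpan ℝ σ := by
  have hp := hX.isPoly hσ.1
  refine (lin_le_span _ _).trans ?_
  rw [Submodule.span_le, ← vectorSpan_tcone hp hw]
  exact (hp.isPolyCone_tcone hw).isPoly.tcone_subset_vectorSpan

open Classical in
/-- The degree of an integral linear map on the product of the links of two tropical cycles is
generically constant. -/
theorem exists_generic_pairDegree {Λ W : Type*} [AddCommGroup Λ] [AddGroup.FG Λ]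
    [AddCommGroup W] [Module ℝ W] [FiniteDimensional ℝ W] {j : Λ →+ W} (hj : IsLat j)
    {L : (Fin n → ℤ) × (Fin n → ℤ) →+ Λ} {Lr : (Fin n → ℝ) × (Fin n → ℝ) →ₗ[ℝ] W}
    (hL : ∀ x, Lr ((incl n).prodMap (incl n) x) = j (L x)) (hX : X.IsTropicalCycle p)
    (hY : Y.IsTropicalCycle q) (hdim : Module.finrank ℝ W + (p + q) = n + n) (w : Fin n → ℝ) :
    ∃ m : ℝ, ∀ᶠ z in generic W, (∑ P ∈ hX.isPolyhedralComplex.facetsAt w ×ˢ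
      hY.isPolyhedralComplex.facetsAt w, if z ∈ Lr '' (tcone w P.1 ×ˢ tcone w P.2) then
        (X.mult P.1 * Y.mult P.2 *
          (((latticeOf P.1).prod (latticeOf P.2)).map L).index : ℝ) else 0) = m := by
  have hXc := hX.isPolyhedralComplex
  have hYc := hY.isPolyhedralComplex
  have hmem : ∀ P ∈ hXc.facetsAt w ×ˢ hYc.facetsAt w,
      (X.IsFacet P.1 ∧ w ∈ P.1) ∧ Y.IsFacet P.2 ∧ w ∈ P.2 := fun P hP => by
    simpa [IsPolyhedralComplex.mem_facetsAt] using hP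
  have hfin : ∀ P ∈ hXc.facetsAt w ×ˢ hYc.facetsAt w,
      dim P.1 + dim P.2 = Module.finrank ℝ W := fun P hP => by
    have h1 := hX.pure _ (hmem P hP).1.1
    have h2 := hY.pure _ (hmem P hP).2.1
    omega
  refine exists_generic_degree (hXc.facetsAt w ×ˢ hYc.facetsAt w)
    (fun P => tcone w P.1 ×ˢ tcone w P.2)
    (fun P => (vectorSpan ℝ P.1).prod (vectorSpan ℝ P.2)) Lr _ ?_ ?_ ?_ ?_ ?_
  · intro P hP
    obtain ⟨⟨h1, h2⟩, h3, h4⟩ := hmem P hP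
    exact ((hXc.isPoly h1.1).isPolyCone_tcone h2).prod ((hYc.isPoly h3.1).isPolyCone_tcone h4)
  · rintro P hP ⟨x, y⟩ ⟨hx, hy⟩
    obtain ⟨⟨h1, h2⟩, h3, h4⟩ := hmem P hP
    exact ⟨(hXc.isPoly h1.1).tcone_subset_vectorSpan hx,
      (hYc.isPoly h3.1).tcone_subset_vectorSpan hy⟩
  · intro P hP
    rw [finrank_submodule_prod]
    exact hfin P hP
  · intro P hP hd
    obtain ⟨⟨h1, h2⟩, h3, h4⟩ := hmem P hP
    have : (((latticeOf P.1).prod (latticeOf P.2)).map L).index = 0 := by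
      by_contra h0
      -- Finite index makes `Lr` surjective on the product of the spans, and by equality of
      -- dimensions injective.
      have h5 := (index_map_prod_ne_zero_iff hj hL (hXc.isRatSub h1.1) (hYc.isRatSub h3.1)).1 h0
      apply hd
      have h6 : Function.Surjective
          (Lr.domRestrict ((vectorSpan ℝ P.1).prod (vectorSpan ℝ P.2))) := by
        rw [← LinearMap.range_eq_top, LinearMap.range_domRestrict, h5]
      have h7 : Module.finrank ℝ ((vectorSpan ℝ P.1).prod (vectorSpan ℝ P.2)) =
          Module.finrank ℝ W := by
        rw [finrank_submodule_prod]
        exact hfin P hP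
      have h8 := (LinearMap.injective_iff_surjective_of_finrank_eq_finrank h7).2 h6
      rw [Submodule.disjoint_def]
      intro z hz hz0
      exact congrArg Subtype.val (@h8 ⟨z, hz⟩ 0 (by simpa using hz0))
    rw [this]
    simp
  · rintro ⟨σ₁, σ₂⟩ hP ⟨y₁, y₂⟩ ⟨hy₁, hy₂⟩ hrank
    obtain ⟨⟨h1, h2⟩, h3, h4⟩ := hmem _ hP
    have hd := hfin _ hP
    dsimp only at h1 h2 h3 h4 hd hy₁ hy₂ hrank
    have hc₁ := (hXc.isPoly h1.1).isPolyCone_tcone h2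
    have hc₂ := (hYc.isPoly h3.1).isPolyCone_tcone h4
    rw [lin_prod hc₁ hc₂ ⟨hy₁, hy₂⟩, finrank_submodule_prod] at hrank
    dsimp only at hrank
    have hle₁ := hXc.lin_tcone_le h1 (y := y₁) h2
    have hle₂ := hYc.lin_tcone_le h3 (y := y₂) h4
    have hf₁ : Module.finrank ℝ (lin y₁ (tcone w σ₁)) ≤ dim σ₁ := Submodule.finrank_mono hle₁
    have hf₂ : Module.finrank ℝ (lin y₂ (tcone w σ₂)) ≤ dim σ₂ := Submodule.finrank_mono hle₂
    have hfilter : ∀ P, (P ∈ hXc.facetsAt w ×ˢ hYc.facetsAt w ∧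
        (y₁, y₂) ∈ tcone w P.1 ×ˢ tcone w P.2) ↔
        P ∈ (hXc.facetsAt w).filter (fun σ => y₁ ∈ tcone w σ) ×ˢ
          (hYc.facetsAt w).filter (fun σ => y₂ ∈ tcone w σ) := fun P => by
      simp only [Finset.mem_product, Finset.mem_filter, Set.mem_prod]
      exact and_and_and_comm
    have hfinsum : ∀ (Z : WeightedComplex n) (hZ : Z.IsPolyhedralComplex) (y : Fin n → ℝ)
        (f : Set (Fin n → ℝ) → ℝ), (∑ᶠ (σ : Set (Fin n → ℝ)) (_ : Z.IsFacet σ ∧ y ∈ tcone w σ),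
          f σ) = ∑ σ ∈ (hZ.facetsAt w).filter (fun σ => y ∈ tcone w σ), f σ := by
      intro Z hZ y f
      rw [← finsum_mem_coe_finset]
      congr! 3 with σ
      simp only [Finset.coe_filter, IsPolyhedralComplex.mem_facetsAt, Set.mem_ofPred_eq]
      exact ⟨fun h => ⟨⟨h.1, (hZ.isPoly h.1.1).mem_of_tcone h.2⟩, h.2⟩,
        fun h => ⟨h.1.1, h.2⟩⟩
    -- The dimension drops by one in total, so exactly one of the factors is a ridge and the other
    -- point is interior to its facet cone.
    rcases (show (Module.finrank ℝ (lin y₁ (tcone w σ₁)) + 1 = dim σ₁ ∧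
        Module.finrank ℝ (lin y₂ (tcone w σ₂)) = dim σ₂) ∨
        (Module.finrank ℝ (lin y₁ (tcone w σ₁)) = dim σ₁ ∧
        Module.finrank ℝ (lin y₂ (tcone w σ₂)) + 1 = dim σ₂) by omega) with ⟨ha, hb⟩ | ⟨ha, hb⟩
    · have hl₂ : vectorSpan ℝ σ₂ ≤ lin y₂ (tcone w σ₂) :=
        (Submodule.eq_of_le_of_finrank_eq hle₂ hb).ge
      have huniq : (hYc.facetsAt w).filter (fun σ => y₂ ∈ tcone w σ) = {σ₂} := by
        ext σ
        rw [Finset.mem_filter, IsPolyhedralComplex.mem_facetsAt, Finset.mem_singleton]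
        constructor
        · exact fun h => hYc.eq_of_vectorSpan_le_lin h3 h.1.1 hy₂ h.2 hl₂
        · rintro rfl
          exact ⟨⟨h3, h4⟩, hy₂⟩
      obtain ⟨l, c, r, hsum, hr⟩ := hX.exists_ridge_functional hj hL h1 (hYc.isRatSub h3.1) hd hy₁
        ha
      refine ⟨l, fun P => X.mult P.1 * Y.mult P.2 * c, fun P => r P.1, ?_, ?_⟩
      · trans ∑ P ∈ (hXc.facetsAt w).filter (fun σ => y₁ ∈ tcone w σ) ×ˢ
            (hYc.facetsAt w).filter (fun σ => y₂ ∈ tcone w σ), X.mult P.1 * Y.mult P.2 * c * r P.1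
        · refine Finset.sum_congr ?_ fun _ _ => rfl
          ext P
          exact (@Finset.mem_filter _ _ (_) _ _).trans (hfilter P)
        rw [huniq, Finset.sum_product]
        simp only [Finset.sum_singleton]
        rw [hfinsum X hXc] at hsum
        rw [← mul_zero ((Y.mult σ₂ : ℝ) * c), ← hsum, Finset.mul_sum]
        exact Finset.sum_congr rfl fun σ _ => by ring
      · rintro ⟨σ, σ'⟩ hP' ⟨hyσ, hyσ'⟩
        obtain ⟨⟨h5, h6⟩, h7, h8⟩ := hmem _ hP'
        dsimp only at h5 h6 h7 h8 hyσ hyσ'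
        obtain rfl : σ' = σ₂ := hYc.eq_of_vectorSpan_le_lin h3 h7 hy₂ hyσ' hl₂
        obtain ⟨h9, h10⟩ := hr σ h5 hyσ
        refine ⟨?_, fun h0 z hz => ?_⟩
        · dsimp only
          rw [latticeOf_eq σ', h9]
          ring
        · rw [tcone_prod, Set.mem_prod, ← h10 h0 z.1 hz.1 z.2 hz.2]
          exact and_iff_left ((hc₂.isPoly.mem_lin hy₂).1 (hl₂ hz.2)).1
    · have hl₁ : vectorSpan ℝ σ₁ ≤ lin y₁ (tcone w σ₁) :=
        (Submodule.eq_of_le_of_finrank_eq hle₁ ha).ge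
      have huniq : (hXc.facetsAt w).filter (fun σ => y₁ ∈ tcone w σ) = {σ₁} := by
        ext σ
        rw [Finset.mem_filter, IsPolyhedralComplex.mem_facetsAt, Finset.mem_singleton]
        constructor
        · exact fun h => hXc.eq_of_vectorSpan_le_lin h1 h.1.1 hy₁ h.2 hl₁
        · rintro rfl
          exact ⟨⟨h1, h2⟩, hy₁⟩
      -- Exchanging the factors of the source brings a ridge of `Y` into the first place.
      let s : (Fin n → ℤ) × (Fin n → ℤ) →+ (Fin n → ℤ) × (Fin n → ℤ) :=
        AddEquiv.prodComm.toAddMonoidHom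
      have hswap : ∀ x, (Lr ∘ₗ (LinearEquiv.prodComm ℝ (Fin n → ℝ) (Fin n → ℝ)).toLinearMap)
          ((incl n).prodMap (incl n) x) = j ((L.comp s) x) := fun x => hL (x.2, x.1)
      have hmap : ∀ A B : AddSubgroup (Fin n → ℤ), (A.prod B).map (L.comp s) = (B.prod A).map L := by
        intro A B
        rw [← AddSubgroup.map_map]
        congr 1
        ext ⟨a, b⟩
        constructor
        · rintro ⟨⟨c, d⟩, ⟨hc, hd⟩, h⟩
          obtain ⟨rfl, rfl⟩ := Prod.mk.inj h
          exact ⟨hd, hc⟩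
        · exact fun h => ⟨(b, a), ⟨h.2, h.1⟩, rfl⟩
      obtain ⟨l, c, r, hsum, hr⟩ := hY.exists_ridge_functional hj hswap h3 (hXc.isRatSub h1.1)
        (by rw [add_comm]; exact hd) hy₂ hb
      refine ⟨l, fun P => X.mult P.1 * Y.mult P.2 * c, fun P => r P.2, ?_, ?_⟩
      · trans ∑ P ∈ (hXc.facetsAt w).filter (fun σ => y₁ ∈ tcone w σ) ×ˢ
            (hYc.facetsAt w).filter (fun σ => y₂ ∈ tcone w σ), X.mult P.1 * Y.mult P.2 * c * r P.2
        · refine Finset.sum_congr ?_ fun _ _ => rfl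
          ext P
          exact (@Finset.mem_filter _ _ (_) _ _).trans (hfilter P)
        rw [huniq, Finset.sum_product_right]
        simp only [Finset.sum_singleton]
        rw [hfinsum Y hYc] at hsum
        rw [← mul_zero ((X.mult σ₁ : ℝ) * c), ← hsum, Finset.mul_sum]
        exact Finset.sum_congr rfl fun σ _ => by ring
      · rintro ⟨σ', σ⟩ hP' ⟨hyσ', hyσ⟩
        obtain ⟨⟨h5, h6⟩, h7, h8⟩ := hmem _ hP'
        dsimp only at h5 h6 h7 h8 hyσ hyσ'
        obtain rfl : σ' = σ₁ := hXc.eq_of_vectorSpan_le_lin h1 h5 hy₁ hyσ' hl₁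
        obtain ⟨h9, h10⟩ := hr σ h7 hyσ
        rw [hmap] at h9
        refine ⟨?_, fun h0 z hz => ?_⟩
        · dsimp only
          rw [latticeOf_eq σ', h9]
          ring
        · rw [tcone_prod, Set.mem_prod]
          refine Iff.trans ?_ (h10 h0 z.2 hz.2 z.1 hz.1)
          exact and_iff_right ((hc₁.isPoly.mem_lin hy₁).1 (hl₁ hz.1)).1

end WeightedComplex

/-! ### The map `(x, y) ↦ (x - y, M x)` and its lattice index -/

section Difference

variable {n : ℕ} {Λ W : Type*} [AddCommGroup Λ] [AddCommGroup W] [Module ℝ W]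

/-- The homomorphism `(a, b) ↦ (a - b, M a)`. -/
def subProd (M : (Fin n → ℤ) →+ Λ) : (Fin n → ℤ) × (Fin n → ℤ) →+ (Fin n → ℤ) × Λ :=
  AddMonoidHom.prod (AddMonoidHom.fst _ _ - AddMonoidHom.snd _ _) (M.comp (AddMonoidHom.fst _ _))

/-- The linear map `(x, y) ↦ (x - y, M x)`. -/
def subProdₗ (M : (Fin n → ℝ) →ₗ[ℝ] W) : (Fin n → ℝ) × (Fin n → ℝ) →ₗ[ℝ] (Fin n → ℝ) × W :=
  LinearMap.prod (LinearMap.fst ℝ _ _ - LinearMap.snd ℝ _ _) (M ∘ₗ LinearMap.fst ℝ _ _)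

@[simp] theorem subProd_apply (M : (Fin n → ℤ) →+ Λ) (x : (Fin n → ℤ) × (Fin n → ℤ)) :
    subProd M x = (x.1 - x.2, M x.1) := rfl

@[simp] theorem subProdₗ_apply (M : (Fin n → ℝ) →ₗ[ℝ] W) (x : (Fin n → ℝ) × (Fin n → ℝ)) :
    subProdₗ M x = (x.1 - x.2, M x.1) := rfl

theorem subProdₗ_incl {j : Λ →+ W} {M : (Fin n → ℤ) →+ Λ} {Mr : (Fin n → ℝ) →ₗ[ℝ] W}
    (hM : ∀ x, Mr (incl n x) = j (M x)) (x : (Fin n → ℤ) × (Fin n → ℤ)) :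
    subProdₗ Mr ((incl n).prodMap (incl n) x) = (incl n).prodMap j (subProd M x) := by
  simp [AddMonoidHom.prodMap_def, hM]

/-- The projection of the image to the first factor is `A + B`, and the fibre over `0` comes from
the diagonal of `A ∩ B`. This separates the index in the definition of the multiplicity from the
index of the lattice of the intersection. -/
theorem index_map_subProd (M : (Fin n → ℤ) →+ Λ) (A B : AddSubgroup (Fin n → ℤ)) :
    ((A.prod B).map (subProd M)).index = (A ⊔ B).index * ((A ⊓ B).map M).index := by
  rw [index_eq_map_fst_mul]
  congr 2
  · ext x
    rw [AddSubgroup.mem_sup]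
    constructor
    · rintro ⟨_, ⟨⟨a, b⟩, ⟨ha, hb⟩, rfl⟩, rfl⟩
      exact ⟨a, ha, -b, B.neg_mem hb, (sub_eq_add_neg a b).symm⟩
    · rintro ⟨a, ha, b, hb, rfl⟩
      exact ⟨_, ⟨(a, -b), ⟨ha, B.neg_mem hb⟩, rfl⟩, by simp⟩
  · ext x
    constructor
    · rintro ⟨⟨a, b⟩, ⟨ha, hb⟩, h⟩
      obtain ⟨h1, h2⟩ := Prod.mk.inj h
      obtain rfl : a = b := sub_eq_zero.1 h1
      exact ⟨a, ⟨ha, hb⟩, h2⟩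
    · rintro ⟨a, ⟨ha, hb⟩, rfl⟩
      exact ⟨(a, a), ⟨ha, hb⟩, by simp⟩

theorem latPts_inf (E F : Submodule ℝ (Fin n → ℝ)) : latPts (E ⊓ F) = latPts E ⊓ latPts F := rfl

theorem sup_eq_top_of_index_ne_zero {E F : Submodule ℝ (Fin n → ℝ)}
    (h : (latPts E ⊔ latPts F).index ≠ 0) : E ⊔ F = ⊤ := by
  rw [(isLat_incl n).index_ne_zero_iff] at h
  rw [eq_top_iff, ← h, Submodule.span_le]
  rintro _ ⟨x, hx, rfl⟩
  obtain ⟨a, ha, b, hb, rfl⟩ := AddSubgroup.mem_sup.1 hx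
  rw [map_add]
  exact Submodule.add_mem_sup ha hb

theorem index_sup_ne_zero {E F : Submodule ℝ (Fin n → ℝ)} (hE : IsRatSub E) (hF : IsRatSub F)
    (h : E ⊔ F = ⊤) : (latPts E ⊔ latPts F).index ≠ 0 := by
  rw [(isLat_incl n).index_ne_zero_iff, eq_top_iff, ← h]
  refine sup_le ?_ ?_
  · exact hE.span_latPts.ge.trans (Submodule.span_mono (Set.image_mono fun x hx =>
      (le_sup_left : latPts E ≤ latPts E ⊔ latPts F) hx))
  · exact hF.span_latPts.ge.trans (Submodule.span_mono (Set.image_mono fun x hx =>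
      (le_sup_right : latPts F ≤ latPts E ⊔ latPts F) hx))

end Difference

/-! ### Cells of the common refinement and pairs of facets -/

namespace WeightedComplex

variable {n p q : ℕ} {X Y : WeightedComplex n}

theorem finite_commonCells (hX : X.IsPolyhedralComplex) (hY : Y.IsPolyhedralComplex) :
    (X.commonCells Y).Finite := by
  refine (Set.Finite.image2 (fun σ τ => σ ∩ τ) hX.finite hY.finite).subset ?_
  rintro γ ⟨-, σ, hσ, τ, hτ, rfl⟩
  exact ⟨σ, hσ, τ, hτ, rfl⟩

theorem isRational_of_mem_commonCells (hX : X.IsPolyhedralComplex) (hY : Y.IsPolyhedralComplex)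
    {γ : Set (Fin n → ℝ)} (hγ : γ ∈ X.commonCells Y) : IsRationalPolyhedron γ := by
  obtain ⟨-, σ, hσ, τ, hτ, rfl⟩ := hγ
  exact (hX.rational σ hσ).inter (hY.rational τ hτ)

theorem subset_left_of_inRel (hX : X.IsPolyhedralComplex) {γ : Set (Fin n → ℝ)}
    (hγ : γ ∈ X.commonCells Y) {w : Fin n → ℝ} (hw : InRel w γ) :
    ∀ σ ∈ X.cells, w ∈ σ → γ ⊆ σ := by
  obtain ⟨-, σ₁, hσ₁, σ₂, hσ₂, rfl⟩ := hγ
  exact fun σ hσ hwσ => hX.subset_of_inRel hσ₁ hσ Set.inter_subset_left hw hwσ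

theorem subset_right_of_inRel (hY : Y.IsPolyhedralComplex) {γ : Set (Fin n → ℝ)}
    (hγ : γ ∈ X.commonCells Y) {w : Fin n → ℝ} (hw : InRel w γ) :
    ∀ σ ∈ Y.cells, w ∈ σ → γ ⊆ σ := by
  obtain ⟨-, σ₁, hσ₁, σ₂, hσ₂, rfl⟩ := hγ
  exact fun σ hσ hwσ => hY.subset_of_inRel hσ₂ hσ Set.inter_subset_right hw hwσ

theorem subset_of_mem_commonCells (hX : X.IsPolyhedralComplex) (hY : Y.IsPolyhedralComplex)
    {γ γ' : Set (Fin n → ℝ)} (hγ : γ ∈ X.commonCells Y) (hγ' : γ' ∈ X.commonCells Y)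
    {w : Fin n → ℝ} (hw : InRel w γ) (hw' : w ∈ γ') : γ ⊆ γ' := by
  obtain ⟨-, σ₁, hσ₁, σ₂, hσ₂, rfl⟩ := hγ'
  exact Set.subset_inter (subset_left_of_inRel hX hγ hw σ₁ hσ₁ hw'.1)
    (subset_right_of_inRel hY hγ hw σ₂ hσ₂ hw'.2)

/-- The cells of codimension `c` of the common refinement that contain `w`. -/
noncomputable def commonCellsAt (hX : X.IsPolyhedralComplex) (hY : Y.IsPolyhedralComplex) (c : ℕ)
    (w : Fin n → ℝ) : Finset (Set (Fin n → ℝ)) :=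
  ((finite_commonCells hX hY).subset
    (t := {γ | γ ∈ X.commonCells Y ∧ w ∈ γ ∧ dim γ + c = n}) fun _ h => h.1).toFinset

theorem mem_commonCellsAt {hX : X.IsPolyhedralComplex} {hY : Y.IsPolyhedralComplex} {c : ℕ}
    {w : Fin n → ℝ} {γ : Set (Fin n → ℝ)} : γ ∈ commonCellsAt hX hY c w ↔
      γ ∈ X.commonCells Y ∧ w ∈ γ ∧ dim γ + c = n := by
  simp [commonCellsAt]
  tauto

-- The facets are taken at an arbitrary point `w` of `γ`, not only at a relative interior one; those
-- that do not contain `γ` contribute zero. All cells through `w` thus share one index set, and the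
-- order of summation can be exchanged.
open Classical in
theorem sumMult_eq_sum (hX : X.IsPolyhedralComplex) (hY : Y.IsPolyhedralComplex)
    {γ : Set (Fin n → ℝ)} (hγ : γ ∈ X.commonCells Y) {w : Fin n → ℝ} (hw : w ∈ γ)
    (v : Fin n → ℝ) :
    (X.link γ).sumMult (Y.link γ).reflect v = ∑ P ∈ hX.facetsAt w ×ˢ hY.facetsAt w,
      if γ ⊆ P.1 ∧ γ ⊆ P.2 ∧ v ∈ linkAlong γ P.1 - linkAlong γ P.2 then
        X.mult P.1 * Y.mult P.2 * ((latticeOf P.1 ⊔ latticeOf P.2).index : ℚ) else 0 := by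
  have hc := (isRational_of_mem_commonCells hX hY hγ).isPoly.convex
  obtain ⟨x, hx⟩ := exists_inRel hc ⟨w, hw⟩
  have hleft := subset_left_of_inRel hX hγ hx
  have hright := subset_right_of_inRel hY hγ hx
  rw [sumMult_link hX hY hc hx hleft hright]
  have hmem : ∀ (y) (P : Set (Fin n → ℝ) × Set (Fin n → ℝ)), P ∈ hX.facetsAt y ×ˢ hY.facetsAt y ↔
      (X.IsFacet P.1 ∧ y ∈ P.1) ∧ Y.IsFacet P.2 ∧ y ∈ P.2 := fun y P => by
    simp [IsPolyhedralComplex.mem_facetsAt]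
  refine (Finset.sum_congr rfl fun P hP => ?_).trans
    (Finset.sum_subset (fun P hP => ?_) fun P hP hP' => ?_)
  · obtain ⟨⟨h1, h2⟩, h3, h4⟩ := (hmem x P).1 hP
    have h5 := hleft _ h1.1 h2
    have h6 := hright _ h3.1 h4
    rw [(hX.isPoly h1.1).linkAlong_eq hc h5 hx, (hY.isPoly h3.1).linkAlong_eq hc h6 hx]
    simp only [h5, h6, true_and]
  · obtain ⟨⟨h1, h2⟩, h3, h4⟩ := (hmem x P).1 hP
    exact (hmem w P).2 ⟨⟨h1, hleft _ h1.1 h2 hw⟩, h3, hright _ h3.1 h4 hw⟩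
  · refine if_neg fun h => hP' ?_
    obtain ⟨⟨h1, h2⟩, h3, h4⟩ := (hmem w P).1 hP
    exact (hmem x P).2 ⟨⟨h1, h.1 hx.1⟩, h3, h.2.1 hx.1⟩

theorem vectorSpan_eq_of_subset {σ₁ σ₂ γ : Set (Fin n → ℝ)} (h₁ : γ ⊆ σ₁) (h₂ : γ ⊆ σ₂)
    (hd : dim γ = Module.finrank ℝ (vectorSpan ℝ σ₁ ⊓ vectorSpan ℝ σ₂ : Submodule ℝ (Fin n → ℝ))) :
    vectorSpan ℝ γ = vectorSpan ℝ σ₁ ⊓ vectorSpan ℝ σ₂ :=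
  Submodule.eq_of_le_of_finrank_eq (le_inf (vectorSpan_mono ℝ h₁) (vectorSpan_mono ℝ h₂)) hd

/-- A cell of the common refinement that has the dimension of the intersection of the affine hulls
of two facets is the intersection of the facets. -/
theorem eq_inter_of_subset (hX : X.IsPolyhedralComplex) (hY : Y.IsPolyhedralComplex)
    {σ₁ σ₂ γ : Set (Fin n → ℝ)} (hσ₁ : σ₁ ∈ X.cells) (hσ₂ : σ₂ ∈ Y.cells)
    (hγ : γ ∈ X.commonCells Y) (h₁ : γ ⊆ σ₁) (h₂ : γ ⊆ σ₂)
    (hd : dim γ = Module.finrank ℝ (vectorSpan ℝ σ₁ ⊓ vectorSpan ℝ σ₂ : Submodule ℝ (Fin n → ℝ))) :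
    γ = σ₁ ∩ σ₂ := by
  have hp := (isRational_of_mem_commonCells hX hY hγ).isPoly
  obtain ⟨x, hx⟩ := exists_inRel hp.convex hγ.1
  have hspan := vectorSpan_eq_of_subset h₁ h₂ hd
  refine (Set.subset_inter h₁ h₂).antisymm ?_
  have key : ∀ y ∈ σ₁ ∩ σ₂, ∃ d : ℝ, 0 < d ∧ x + d • (x - y) ∈ γ := by
    intro y hy
    have h3 : x - y ∈ vectorSpan ℝ γ := by
      rw [hspan]
      exact ⟨vsub_mem_vectorSpan ℝ (h₁ hx.1) hy.1, vsub_mem_vectorSpan ℝ (h₂ hx.1) hy.2⟩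
    rw [← SetLike.mem_coe, ← hp.tcone_of_inRel hx] at h3
    exact exists_pos_of_eventually h3
  obtain ⟨-, τ₁, hτ₁, τ₂, hτ₂, rfl⟩ := hγ
  intro y hy
  obtain ⟨d, hd, hd'⟩ := key y hy
  exact ⟨((hX.inter_face σ₁ hσ₁ τ₁ hτ₁ ⟨x, h₁ hx.1, hx.1.1⟩).1.mem_of_add ⟨h₁ hx.1, hx.1.1⟩ hy.1 hd
    (h₁ hd')).2, ((hY.inter_face σ₂ hσ₂ τ₂ hτ₂ ⟨x, h₂ hx.1, hx.1.2⟩).1.mem_of_add ⟨h₂ hx.1, hx.1.2⟩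
    hy.2 hd (h₂ hd')).2⟩

/-- For transverse facets and a generic `u`, the point `(e v, u)` with small `e` is hit by the pair
exactly if `v` is hit in the link along the intersection of the facets. -/
theorem eventually_mem_image_subProd_iff {W : Type*} [AddCommGroup W] [Module ℝ W]
    [FiniteDimensional ℝ W] (Mr : (Fin n → ℝ) →ₗ[ℝ] W) {σ₁ σ₂ : Set (Fin n → ℝ)} (hp₁ : IsPoly σ₁)
    (hp₂ : IsPoly σ₂) {w : Fin n → ℝ} (hw₁ : w ∈ σ₁) (hw₂ : w ∈ σ₂)
    (htop : vectorSpan ℝ σ₁ ⊔ vectorSpan ℝ σ₂ = ⊤)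
    (hmap : (vectorSpan ℝ σ₁ ⊓ vectorSpan ℝ σ₂).map Mr = ⊤)
    (hfin : Module.finrank ℝ (vectorSpan ℝ σ₁ ⊓ vectorSpan ℝ σ₂ : Submodule ℝ (Fin n → ℝ)) =
      Module.finrank ℝ W) :
    ∀ᶠ u in generic W, ∀ v : Fin n → ℝ, ∀ᶠ e : ℝ in 𝓝[>] 0,
      ((e • v, u) ∈ subProdₗ Mr '' (tcone w σ₁ ×ˢ tcone w σ₂) ↔
        dim (σ₁ ∩ σ₂) = Module.finrank ℝ W ∧ u ∈ Mr '' tcone w (σ₁ ∩ σ₂) ∧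
          v ∈ linkAlong (σ₁ ∩ σ₂) σ₁ - linkAlong (σ₁ ∩ σ₂) σ₂) := by
  set D := vectorSpan ℝ σ₁ ⊓ vectorSpan ℝ σ₂ with hD
  have hp := hp₁.inter hp₂
  have hc₁ := hp₁.isPolyCone_tcone hw₁
  have hc₂ := hp₂.isPolyCone_tcone hw₂
  have hc := hp.isPolyCone_tcone ⟨hw₁, hw₂⟩
  have hsurj : Function.Surjective (Mr.domRestrict D) := by
    rw [← LinearMap.range_eq_top, LinearMap.range_domRestrict, hmap]
  have hinj : ∀ g ∈ D, Mr g = 0 → g = 0 := fun g hg h0 => by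
    have := (LinearMap.injective_iff_surjective_of_finrank_eq_finrank hfin).2 hsurj
    exact congrArg Subtype.val (@this ⟨g, hg⟩ 0 (by simpa using h0))
  filter_upwards [hc.generic_map_lin Mr] with u hu v
  obtain ⟨⟨z, hzD⟩, hz⟩ := hsurj u
  replace hz : Mr z = u := hz
  -- A decomposition of `v` can be shifted by an element of `D`; since `Mr` maps `D` onto `W`, the
  -- shift can be chosen to give `Mr a = 0`. Then `(z + e • a, z + e • b)` is the only point of the
  -- product of the spans over `(e • v, u)`.
  obtain ⟨a, b, ha, hb, hab, hMa⟩ : ∃ a b, a ∈ vectorSpan ℝ σ₁ ∧ b ∈ vectorSpan ℝ σ₂ ∧ a - b = v ∧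
      Mr a = 0 := by
    obtain ⟨a, ha, b, hb, hab⟩ := Submodule.mem_sup.1 (htop ▸ Submodule.mem_top : v ∈ _)
    obtain ⟨⟨g, hg⟩, hMg⟩ := hsurj (Mr a)
    replace hMg : Mr g = Mr a := hMg
    exact ⟨a - g, -b - g, sub_mem ha hg.1, sub_mem (neg_mem hb) hg.2, by rw [← hab]; abel,
      by rw [map_sub, hMg, sub_self]⟩
  have hsub₁ : ∀ y, tcone y (tcone w σ₁) ⊆ vectorSpan ℝ σ₁ := fun y => by
    rw [← vectorSpan_tcone hp₁ hw₁]
    exact hc₁.isPoly.tcone_subset_vectorSpan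
  have hsub₂ : ∀ y, tcone y (tcone w σ₂) ⊆ vectorSpan ℝ σ₂ := fun y => by
    rw [← vectorSpan_tcone hp₂ hw₂]
    exact hc₂.isPoly.tcone_subset_vectorSpan
  have hCD : vectorSpan ℝ (σ₁ ∩ σ₂) ≤ D := le_inf (vectorSpan_mono ℝ Set.inter_subset_left)
    (vectorSpan_mono ℝ Set.inter_subset_right)
  -- By genericity of `u` the lineality space at `z` is all of `D`. So `z` points from `w` into the
  -- relative interior of `σ₁ ∩ σ₂`, and the links along this cell are the tangent cones at `z`.
  have hz_facts : z ∈ tcone w (σ₁ ∩ σ₂) → lin z (tcone w (σ₁ ∩ σ₂)) = D ∧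
      dim (σ₁ ∩ σ₂) = Module.finrank ℝ W ∧ linkAlong (σ₁ ∩ σ₂) σ₁ = tcone z (tcone w σ₁) ∧
        linkAlong (σ₁ ∩ σ₂) σ₂ = tcone z (tcone w σ₂) := by
    intro hzC
    have h1 := hu z hzC hz
    have h2 : lin z (tcone w (σ₁ ∩ σ₂)) ≤ vectorSpan ℝ (σ₁ ∩ σ₂) := by
      refine (lin_le_span _ _).trans ?_
      rw [Submodule.span_le, ← vectorSpan_tcone hp ⟨hw₁, hw₂⟩]
      exact hc.isPoly.tcone_subset_vectorSpan
    have h3 := Submodule.finrank_map_le Mr (lin z (tcone w (σ₁ ∩ σ₂)))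
    rw [h1, finrank_top, ← hfin] at h3
    have h4 : lin z (tcone w (σ₁ ∩ σ₂)) = D :=
      Submodule.eq_of_le_of_finrank_le (h2.trans hCD) h3
    have h5 : vectorSpan ℝ (σ₁ ∩ σ₂) = D := hCD.antisymm (h4 ▸ h2)
    obtain ⟨e, ⟨e1, e2⟩, e3, e4⟩ := ((hp₁.eventually_tcone_add hw₁ z).and
      ((hp₂.eventually_tcone_add hw₂ z).and (hp.eventually_tcone_add ⟨hw₁, hw₂⟩ z))).exists
    have hx := e4.1.2 hzC
    have hrel : InRel (w + e • z) (σ₁ ∩ σ₂) := by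
      refine hp.inRel_of_lin_eq hx ?_
      rw [h5, ← h4]
      unfold lin
      rw [e4.2 hzC]
    rw [tcone_inter] at hzC
    refine ⟨h4, by rw [dim, h5, hfin], ?_, ?_⟩
    · rw [hp₁.linkAlong_eq hp.convex Set.inter_subset_left hrel, e2 hzC.1]
    · rw [hp₂.linkAlong_eq hp.convex Set.inter_subset_right hrel, e3.2 hzC.2]
  filter_upwards [hc₁.isPoly.eventually_mem_iff z a, hc₂.isPoly.eventually_mem_iff z b,
    self_mem_nhdsWithin] with e he₁ he₂ he0
  have hleft : (e • v, u) ∈ subProdₗ Mr '' (tcone w σ₁ ×ˢ tcone w σ₂) ↔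
      a ∈ tcone z (tcone w σ₁) ∧ b ∈ tcone z (tcone w σ₂) := by
    rw [← he₁, ← he₂]
    constructor
    · rintro ⟨⟨x, y⟩, ⟨hx, hy⟩, h⟩
      obtain ⟨h1, h2⟩ := Prod.mk.inj h
      replace h1 : x - y = e • v := h1
      replace h2 : Mr x = u := h2
      dsimp only at hx hy
      have h3 : x - (z + e • a) = y - (z + e • b) := by
        rw [sub_eq_iff_eq_add] at h1
        rw [h1, ← hab]
        module
      have h4 : x - (z + e • a) ∈ D := by
        refine ⟨sub_mem (hp₁.tcone_subset_vectorSpan hx)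
          (add_mem hzD.1 (Submodule.smul_mem _ _ ha)), ?_⟩
        rw [h3]
        exact sub_mem (hp₂.tcone_subset_vectorSpan hy) (add_mem hzD.2 (Submodule.smul_mem _ _ hb))
      have h5 := hinj _ h4 (by rw [map_sub, map_add, map_smul, h2, hz, hMa]; simp)
      rw [h5] at h3
      rw [← sub_eq_zero.1 h5, ← sub_eq_zero.1 h3.symm]
      exact ⟨hx, hy⟩
    · rintro ⟨h1, h2⟩
      refine ⟨(z + e • a, z + e • b), ⟨h1, h2⟩, ?_⟩
      rw [subProdₗ_apply, Prod.mk.injEq]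
      refine ⟨?_, by rw [map_add, map_smul, hz, hMa]; simp⟩
      rw [← hab]
      module
  rw [hleft]
  constructor
  · rintro ⟨h1, h2⟩
    have hzC : z ∈ tcone w (σ₁ ∩ σ₂) := by
      rw [tcone_inter]
      exact ⟨hc₁.isPoly.mem_of_tcone h1, hc₂.isPoly.mem_of_tcone h2⟩
    obtain ⟨-, h3, h4, h5⟩ := hz_facts hzC
    refine ⟨h3, ⟨z, hzC, hz⟩, ?_⟩
    rw [h4, h5]
    exact ⟨a, h1, b, h2, hab⟩
  · rintro ⟨-, ⟨z', hz', hMz'⟩, hv⟩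
    have hzz : z' = z := by
      have h1 : z' ∈ D := hCD (hp.tcone_subset_vectorSpan hz')
      exact sub_eq_zero.1 (hinj _ (sub_mem h1 hzD) (by rw [map_sub, hMz', hz, sub_self]))
    subst hzz
    obtain ⟨h2, -, h4, h5⟩ := hz_facts hz'
    rw [h4, h5] at hv
    obtain ⟨a', ha', b', hb', hab'⟩ := hv
    have h3 : a' - a = b' - b := by
      have : a' - b' = a - b := by rw [hab]; exact hab'
      calc a' - a = (a' - b') - (a - b) + (b' - b) := by abel
        _ = b' - b := by rw [this, sub_self, zero_add]
    -- Two decompositions of `v` differ by an element of `D`, which is the lineality space at `z`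
    -- and so does not affect membership in the tangent cones.
    have hg : a' - a ∈ D := ⟨sub_mem (hsub₁ _ ha') ha, by
      rw [h3]; exact sub_mem (hsub₂ _ hb') hb⟩
    rw [← h2] at hg
    rw [tcone_inter] at hz' hg
    constructor
    · have := hc₁.isPoly.sub_mem_tcone_of_lin hz'.1 ha' (lin_mono Set.inter_subset_left hg)
      rwa [sub_sub_cancel] at this
    · rw [h3] at hg
      have := hc₂.isPoly.sub_mem_tcone_of_lin hz'.2 hb' (lin_mono Set.inter_subset_right hg)
      rwa [sub_sub_cancel] at this

end WeightedComplex

/-! ### The degree as a sum over cells of the common refinement -/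

namespace WeightedComplex

variable {n p q : ℕ} {X Y : WeightedComplex n}
variable {Λ W : Type*} [AddCommGroup Λ] [AddCommGroup W] [Module ℝ W] {j : Λ →+ W}
  {M : (Fin n → ℤ) →+ Λ} {Mr : (Fin n → ℝ) →ₗ[ℝ] W}

theorem finrank_inf_of_sup_eq_top {d : ℕ} (hpX : X.IsPureOfCodim p) (hpY : Y.IsPureOfCodim q)
    (hdim : d + (p + q) = n) {σ₁ σ₂ : Set (Fin n → ℝ)} (h₁ : X.IsFacet σ₁) (h₂ : Y.IsFacet σ₂)
    (htop : vectorSpan ℝ σ₁ ⊔ vectorSpan ℝ σ₂ = ⊤) :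
    Module.finrank ℝ (vectorSpan ℝ σ₁ ⊓ vectorSpan ℝ σ₂ : Submodule ℝ (Fin n → ℝ)) = d := by
  have h3 := Submodule.finrank_sup_add_finrank_inf_eq (vectorSpan ℝ σ₁) (vectorSpan ℝ σ₂)
  rw [htop, finrank_top, Module.finrank_fin_fun] at h3
  have h4 := hpX σ₁ h₁
  have h5 := hpY σ₂ h₂
  unfold dim at h4 h5
  omega

open Classical in
/-- The contributions of a pair of facets to the cells of the common refinement. -/
theorem sum_commonCellsAt_eq (hX : X.IsPolyhedralComplex) (hY : Y.IsPolyhedralComplex)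
    (hpX : X.IsPureOfCodim p) (hpY : Y.IsPureOfCodim q)
    (hdim : Module.finrank ℝ W + (p + q) = n) {w : Fin n → ℝ} {σ₁ σ₂ : Set (Fin n → ℝ)}
    (h₁ : X.IsFacet σ₁) (h₂ : Y.IsFacet σ₂) (hw₁ : w ∈ σ₁) (hw₂ : w ∈ σ₂)
    (htop : vectorSpan ℝ σ₁ ⊔ vectorSpan ℝ σ₂ = ⊤) (c : ℝ) (u : W) (v : Fin n → ℝ) :
    (∑ γ ∈ commonCellsAt hX hY (p + q) w, if u ∈ Mr '' tcone w γ then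
      (((latticeOf γ).map M).index : ℝ) *
        (if γ ⊆ σ₁ ∧ γ ⊆ σ₂ ∧ v ∈ linkAlong γ σ₁ - linkAlong γ σ₂ then c else 0) else 0) =
    if dim (σ₁ ∩ σ₂) = Module.finrank ℝ W ∧ u ∈ Mr '' tcone w (σ₁ ∩ σ₂) ∧
        v ∈ linkAlong (σ₁ ∩ σ₂) σ₁ - linkAlong (σ₁ ∩ σ₂) σ₂ then
      (((latticeOf σ₁ ⊓ latticeOf σ₂).map M).index : ℝ) * c else 0 := by
  have hfin := finrank_inf_of_sup_eq_top hpX hpY hdim h₁ h₂ htop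
  have hsub : ∀ γ ∈ commonCellsAt hX hY (p + q) w, γ ⊆ σ₁ → γ ⊆ σ₂ → γ = σ₁ ∩ σ₂ := by
    intro γ hγ h3 h4
    obtain ⟨h5, -, h6⟩ := mem_commonCellsAt.1 hγ
    exact eq_inter_of_subset hX hY h₁.1 h₂.1 h5 h3 h4 (by omega)
  by_cases hd : dim (σ₁ ∩ σ₂) = Module.finrank ℝ W
  · have hmem : σ₁ ∩ σ₂ ∈ commonCellsAt hX hY (p + q) w := mem_commonCellsAt.2
      ⟨⟨⟨w, hw₁, hw₂⟩, σ₁, h₁.1, σ₂, h₂.1, rfl⟩, ⟨hw₁, hw₂⟩, by omega⟩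
    have hlat : latticeOf (σ₁ ∩ σ₂) = latticeOf σ₁ ⊓ latticeOf σ₂ := by
      rw [latticeOf_eq, vectorSpan_eq_of_subset Set.inter_subset_left Set.inter_subset_right
        (hd.trans hfin.symm), latPts_inf, latticeOf_eq, latticeOf_eq]
    rw [Finset.sum_eq_single_of_mem _ hmem]
    · rw [hlat]
      by_cases hu : u ∈ Mr '' tcone w (σ₁ ∩ σ₂) <;>
        by_cases hv : v ∈ linkAlong (σ₁ ∩ σ₂) σ₁ - linkAlong (σ₁ ∩ σ₂) σ₂ <;>
        simp [hd, hu, hv]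
    · intro γ hγ hne
      have h : ¬(γ ⊆ σ₁ ∧ γ ⊆ σ₂ ∧ v ∈ linkAlong γ σ₁ - linkAlong γ σ₂) := fun h =>
        hne (hsub γ hγ h.1 h.2.1)
      simp only [if_neg h, mul_zero, ite_self]
  · rw [if_neg fun h => hd h.1]
    refine Finset.sum_eq_zero fun γ hγ => ?_
    have h : ¬(γ ⊆ σ₁ ∧ γ ⊆ σ₂ ∧ v ∈ linkAlong γ σ₁ - linkAlong γ σ₂) := fun h => by
      have := (mem_commonCellsAt.1 hγ).2.2
      rw [hsub γ hγ h.1 h.2.1] at this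
      omega
    simp only [if_neg h, mul_zero, ite_self]

variable [AddGroup.FG Λ] [FiniteDimensional ℝ W]

open Classical in
/-- The contribution of a pair of facets to the degree of `(x, y) ↦ (x - y, M x)` at `(e v, u)`. -/
theorem eventually_pairDegree_eq (hj : IsLat j) (hM : ∀ x, Mr (incl n x) = j (M x))
    (hX : X.IsPolyhedralComplex) (hY : Y.IsPolyhedralComplex) (hpX : X.IsPureOfCodim p)
    (hpY : Y.IsPureOfCodim q) (hdim : Module.finrank ℝ W + (p + q) = n) {w : Fin n → ℝ}
    {σ₁ σ₂ : Set (Fin n → ℝ)} (h₁ : X.IsFacet σ₁) (h₂ : Y.IsFacet σ₂) (hw₁ : w ∈ σ₁) (hw₂ : w ∈ σ₂)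
    (c : ℝ) : ∀ᶠ u in generic W, ∀ v : Fin n → ℝ, ∀ᶠ e : ℝ in 𝓝[>] 0,
      (if (e • v, u) ∈ subProdₗ Mr '' (tcone w σ₁ ×ˢ tcone w σ₂) then
        c * (((latticeOf σ₁).prod (latticeOf σ₂)).map (subProd M)).index else 0) =
      ∑ γ ∈ commonCellsAt hX hY (p + q) w, if u ∈ Mr '' tcone w γ then
        (((latticeOf γ).map M).index : ℝ) *
          (if γ ⊆ σ₁ ∧ γ ⊆ σ₂ ∧ v ∈ linkAlong γ σ₁ - linkAlong γ σ₂ then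
            c * ((latticeOf σ₁ ⊔ latticeOf σ₂).index : ℝ) else 0) else 0 := by
  rw [index_map_subProd]
  by_cases h0 : (latticeOf σ₁ ⊔ latticeOf σ₂).index = 0
  · simp [h0]
  have htop := sup_eq_top_of_index_ne_zero h0
  simp only [sum_commonCellsAt_eq (M := M) (Mr := Mr) hX hY hpX hpY hdim h₁ h₂ hw₁ hw₂ htop]
  by_cases h3 : ((latticeOf σ₁ ⊓ latticeOf σ₂).map M).index = 0
  · simp [h3]
  have hmap : (vectorSpan ℝ σ₁ ⊓ vectorSpan ℝ σ₂).map Mr = ⊤ := by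
    rw [← Ne, latticeOf_eq, latticeOf_eq, ← latPts_inf, hj.index_ne_zero_iff, span_image_map hM,
      ((hX.isRatSub h₁.1).inf (hY.isRatSub h₂.1)).span_latPts] at h3
    exact h3
  filter_upwards [eventually_mem_image_subProd_iff Mr (hX.isPoly h₁.1) (hY.isPoly h₂.1) hw₁ hw₂ htop
    hmap (finrank_inf_of_sup_eq_top hpX hpY hdim h₁ h₂ htop)] with u hu v
  filter_upwards [hu v] with e he
  refine if_congr he ?_ rfl
  push_cast
  ring

open Classical in
/-- Near a point of the common refinement the degree of `(x, y) ↦ (x - y, M x)` is the weighted sum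
of the multiplicities of the cells that are hit by `M`. -/
theorem eventually_sum_pairDegree_eq (hj : IsLat j) (hM : ∀ x, Mr (incl n x) = j (M x))
    (hX : X.IsPolyhedralComplex) (hY : Y.IsPolyhedralComplex) (hpX : X.IsPureOfCodim p)
    (hpY : Y.IsPureOfCodim q) (hdim : Module.finrank ℝ W + (p + q) = n) (w : Fin n → ℝ) :
    ∀ᶠ u in generic W, ∀ v : Fin n → ℝ, ∀ᶠ e : ℝ in 𝓝[>] 0,
      (∑ P ∈ hX.facetsAt w ×ˢ hY.facetsAt w,
        if (e • v, u) ∈ subProdₗ Mr '' (tcone w P.1 ×ˢ tcone w P.2) then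
          (X.mult P.1 * Y.mult P.2 *
            (((latticeOf P.1).prod (latticeOf P.2)).map (subProd M)).index : ℝ) else 0) =
      ∑ γ ∈ commonCellsAt hX hY (p + q) w, if u ∈ Mr '' tcone w γ then
        (((latticeOf γ).map M).index : ℝ) * ((X.link γ).sumMult (Y.link γ).reflect v : ℝ) else 0 := by
  have hmem : ∀ P ∈ hX.facetsAt w ×ˢ hY.facetsAt w,
      (X.IsFacet P.1 ∧ w ∈ P.1) ∧ Y.IsFacet P.2 ∧ w ∈ P.2 := fun P hP => by
    simpa [IsPolyhedralComplex.mem_facetsAt] using hP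
  have hall := (Finset.eventually_all (hX.facetsAt w ×ˢ hY.facetsAt w)).2 fun P hP =>
    eventually_pairDegree_eq hj hM hX hY hpX hpY hdim (hmem P hP).1.1 (hmem P hP).2.1
      (hmem P hP).1.2 (hmem P hP).2.2 ((X.mult P.1 : ℝ) * Y.mult P.2)
  filter_upwards [hall] with u hu v
  filter_upwards [(Finset.eventually_all (hX.facetsAt w ×ˢ hY.facetsAt w)).2
    fun P hP => hu P hP v] with e he
  rw [Finset.sum_congr rfl he, Finset.sum_comm]
  refine Finset.sum_congr rfl fun γ hγ => ?_
  obtain ⟨h1, h2, -⟩ := mem_commonCellsAt.1 hγ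
  by_cases hc : u ∈ Mr '' tcone w γ
  · simp only [if_pos hc]
    rw [← Finset.mul_sum, sumMult_eq_sum hX hY h1 h2, Rat.cast_sum]
    congr 1
    refine Finset.sum_congr rfl fun P _ => ?_
    rw [apply_ite (Rat.cast : ℚ → ℝ)]
    push_cast
    rfl
  · simp only [if_neg hc, Finset.sum_const_zero]

open Classical in
/-- The weighted sum of the multiplicities of the cells of codimension `p + q` at `w` that are hit
by an integral linear map does not depend on the generic point. -/
theorem exists_generic_stableDegree (hj : IsLat j) (hM : ∀ x, Mr (incl n x) = j (M x))
    (hX : X.IsTropicalCycle p) (hY : Y.IsTropicalCycle q)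
    (hdim : Module.finrank ℝ W + (p + q) = n) (w : Fin n → ℝ) :
    ∃ m : ℝ,
      (∀ᶠ z in generic ((Fin n → ℝ) × W), (∑ P ∈ hX.isPolyhedralComplex.facetsAt w ×ˢ
        hY.isPolyhedralComplex.facetsAt w,
        if z ∈ subProdₗ Mr '' (tcone w P.1 ×ˢ tcone w P.2) then
          (X.mult P.1 * Y.mult P.2 *
            (((latticeOf P.1).prod (latticeOf P.2)).map (subProd M)).index : ℝ) else 0) = m) ∧
      ∀ᶠ u in generic W, ∀ᶠ v in generic (Fin n → ℝ),
        (∑ γ ∈ commonCellsAt hX.isPolyhedralComplex hY.isPolyhedralComplex (p + q) w,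
          if u ∈ Mr '' tcone w γ then (((latticeOf γ).map M).index : ℝ) *
            ((X.link γ).sumMult (Y.link γ).reflect v : ℝ) else 0) = m := by
  obtain ⟨m, hm⟩ := exists_generic_pairDegree ((isLat_incl n).prod hj) (subProdₗ_incl hM) hX hY
    (by rw [Module.finrank_prod, Module.finrank_fin_fun]; omega) w
  refine ⟨m, hm, ?_⟩
  filter_upwards [generic_prod hm, eventually_sum_pairDegree_eq hj hM hX.isPolyhedralComplex
    hY.isPolyhedralComplex hX.pure hY.pure hdim w] with u hu hu'
  filter_upwards [hu] with v hv
  obtain ⟨e, he, he'⟩ := (hv.and (hu' v)).exists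
  rw [← he', he]

end WeightedComplex

/-! ### Integral maps that are isomorphisms on a given subspace -/

section Coordinates

variable {n : ℕ}

/-- A `d`-dimensional subspace projects isomorphically to suitable `d` coordinates. -/
theorem exists_coordinates (E : Submodule ℝ (Fin n → ℝ)) {d : ℕ} (hd : Module.finrank ℝ E = d) :
    ∃ g : Fin d → Fin n, ∀ z ∈ E, (∀ k, z (g k) = 0) → z = 0 := by
  let f : Fin n → Module.Dual ℝ E := fun i => (LinearMap.proj i : (Fin n → ℝ) →ₗ[ℝ] ℝ).domRestrict E
  -- A basis of the span of the coordinate functionals is chosen among these functionals. A point of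
  -- `E` killed by the chosen ones is killed by all coordinates, hence is zero.
  obtain ⟨h, hmem, hspan, -⟩ := Submodule.exists_fun_fin_finrank_span_eq ℝ (Set.range f)
  choose g hg using hmem
  have hinj : ∀ z : E, (∀ k, (z : Fin n → ℝ) (g k) = 0) → z = 0 := by
    intro z hz
    have h1 : Submodule.span ℝ (Set.range f) ≤ LinearMap.ker (Module.Dual.eval ℝ E z) := by
      rw [← hspan, Submodule.span_le]
      rintro _ ⟨k, rfl⟩
      rw [← hg k]
      exact hz k
    ext i
    exact h1 (Submodule.subset_span ⟨i, rfl⟩)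
  have hle : Module.finrank ℝ (Submodule.span ℝ (Set.range f)) ≤ d := by
    rw [← hd, ← Subspace.dual_finrank_eq (K := ℝ) (V := E)]
    exact Submodule.finrank_le _
  have hge : d ≤ Module.finrank ℝ (Submodule.span ℝ (Set.range f)) := by
    have := LinearMap.finrank_le_finrank_of_injective
      (f := (LinearMap.funLeft ℝ ℝ g).domRestrict E) (by
        rw [← LinearMap.ker_eq_bot, LinearMap.ker_eq_bot']
        exact fun z hz => hinj z fun k => congrFun hz k)
    rwa [hd, Module.finrank_fin_fun] at this
  obtain rfl := hle.antisymm hge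
  exact ⟨g, fun z hz h => congrArg Subtype.val (hinj ⟨z, hz⟩ h)⟩

/-- There is an integral linear map that maps `E` isomorphically to `ℝᵈ`. -/
theorem exists_integral_iso (E : Submodule ℝ (Fin n → ℝ)) {d : ℕ} (hd : Module.finrank ℝ E = d) :
    ∃ (M : (Fin n → ℤ) →+ (Fin d → ℤ)) (Mr : (Fin n → ℝ) →ₗ[ℝ] (Fin d → ℝ)),
      (∀ x, Mr (incl n x) = incl d (M x)) ∧ E.map Mr = ⊤ := by
  obtain ⟨g, hg⟩ := exists_coordinates E hd
  have hinj : ∀ z ∈ E, LinearMap.funLeft ℝ ℝ g z = 0 → z = 0 := fun z hz h =>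
    hg z hz fun k => congrFun h k
  refine ⟨(LinearMap.funLeft ℤ ℤ g).toAddMonoidHom, LinearMap.funLeft ℝ ℝ g, fun x => rfl, ?_⟩
  refine Submodule.eq_top_of_finrank_eq ?_
  rw [← LinearMap.range_domRestrict, LinearMap.finrank_range_of_inj, hd, Module.finrank_fin_fun]
  rw [← LinearMap.ker_eq_bot, LinearMap.ker_eq_bot']
  exact fun z hz => Subtype.ext (hinj z z.2 hz)

end Coordinates

/-! ### Uniqueness of generic values -/

section GenericValue

variable {n : ℕ} {f : (Fin n → ℝ) → ℚ}

theorem IsGenericValue.unique {m m' : ℚ} (h : IsGenericValue f m) (h' : IsGenericValue f m') :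
    m = m' := by
  obtain ⟨U, hU, hUd, hUm⟩ := h
  obtain ⟨V, hV, hVd, hVm⟩ := h'
  obtain ⟨x, hx⟩ := (hUd.inter_of_isOpen_left hVd hU).nonempty
  rw [← hUm x hx.1, hVm x hx.2]

theorem isGenericValue_of_eventually {m : ℚ} (h : ∀ᶠ v in generic (Fin n → ℝ), f v = m) :
    IsGenericValue f m := by
  obtain ⟨U, hU, hU', hU''⟩ := exists_isOpen_dense_of_generic h
  exact ⟨U, hU', hU'', fun v hv => hU hv⟩

theorem IsGenericValue.genericValue_eq {m : ℚ} (h : IsGenericValue f m) : genericValue f = m := by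
  have h' : ∃ m, IsGenericValue f m := ⟨m, h⟩
  rw [genericValue, dif_pos h']
  exact h'.choose_spec.unique h

end GenericValue

/-! ### Multiplicities are well defined; cells of non-zero multiplicity lie in the stable set -/

namespace WeightedComplex

variable {n p q : ℕ} {X Y : WeightedComplex n}

theorem isFace_inter_of_mem_commonCells (hX : X.IsPolyhedralComplex) (hY : Y.IsPolyhedralComplex)
    {γ γ' : Set (Fin n → ℝ)} (hγ : γ ∈ X.commonCells Y) (hγ' : γ' ∈ X.commonCells Y)
    (hne : (γ ∩ γ').Nonempty) : IsFace γ (γ ∩ γ') := by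
  obtain ⟨-, σ, hσ, τ, hτ, rfl⟩ := hγ
  obtain ⟨-, σ', hσ', τ', hτ', rfl⟩ := hγ'
  have h1 := (hX.inter_face σ hσ σ' hσ' (hne.mono fun x hx => ⟨hx.1.1, hx.2.1⟩)).1
  have h2 := (hY.inter_face τ hτ τ' hτ' (hne.mono fun x hx => ⟨hx.1.2, hx.2.2⟩)).1
  rw [Set.inter_inter_inter_comm] at hne ⊢
  exact h1.inter h2 hne

theorem eq_of_subset_of_dim_eq (hX : X.IsPolyhedralComplex) (hY : Y.IsPolyhedralComplex)
    {γ γ' : Set (Fin n → ℝ)} (hγ : γ ∈ X.commonCells Y) (hγ' : γ' ∈ X.commonCells Y)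
    (hs : γ ⊆ γ') (hd : dim γ = dim γ') : γ = γ' := by
  have hf := isFace_inter_of_mem_commonCells hX hY hγ' hγ
    (by rw [Set.inter_eq_right.2 hs]; exact hγ.1)
  rw [Set.inter_eq_right.2 hs] at hf
  exact hf.eq_of_vectorSpan (isRational_of_mem_commonCells hX hY hγ').isPoly
    (Submodule.eq_of_le_of_finrank_eq (vectorSpan_mono ℝ hs) hd).ge

theorem commonCellsAt_eq_singleton (hX : X.IsPolyhedralComplex) (hY : Y.IsPolyhedralComplex)
    {γ : Set (Fin n → ℝ)} (hγ : γ ∈ X.commonCells Y) {c : ℕ} (hd : dim γ + c = n) {w : Fin n → ℝ}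
    (hw : InRel w γ) : commonCellsAt hX hY c w = {γ} := by
  ext γ'
  rw [mem_commonCellsAt, Finset.mem_singleton]
  constructor
  · rintro ⟨h1, h2, h3⟩
    exact (eq_of_subset_of_dim_eq hX hY hγ h1 (subset_of_mem_commonCells hX hY hγ h1 hw h2)
      (by omega)).symm
  · rintro rfl
    exact ⟨hγ, hw.1, hd⟩

/-- The multiplicity of a cell of the stable intersection is well defined. -/
theorem eventually_sumMult_eq (hX : X.IsTropicalCycle p) (hY : Y.IsTropicalCycle q)
    {γ : Set (Fin n → ℝ)} (hγ : γ ∈ X.commonCells Y) (hd : dim γ + (p + q) = n) :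
    ∀ᶠ v in generic (Fin n → ℝ),
      (X.link γ).sumMult (Y.link γ).reflect v = X.stableMult Y γ := by
  have hXc := hX.isPolyhedralComplex
  have hYc := hY.isPolyhedralComplex
  have hrat := isRational_of_mem_commonCells hXc hYc hγ
  obtain ⟨w, hw⟩ := exists_inRel hrat.isPoly.convex hγ.1
  obtain ⟨M, Mr, hM, htop⟩ := exists_integral_iso (vectorSpan ℝ γ) rfl
  obtain ⟨m, -, hm⟩ := exists_generic_stableDegree (isLat_incl _) hM hX hY
    (by rw [Module.finrank_fin_fun]; exact hd) w
  obtain ⟨u, hu⟩ := hm.exists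
  have hi : ((latticeOf γ).map M).index ≠ 0 := by
    rw [latticeOf_eq, (isLat_incl _).index_ne_zero_iff, span_image_map hM,
      (hrat.isRatSub_vectorSpan hγ.1).span_latPts, htop]
  have hu' : u ∈ Mr '' tcone w γ := by
    rw [hrat.isPoly.tcone_of_inRel hw, ← Submodule.map_coe, htop]
    trivial
  -- At a relative interior point `γ` is the only cell of its dimension, so the invariant degree is
  -- a non-zero index times its multiplicity sum.
  rw [commonCellsAt_eq_singleton hXc hYc hγ hd hw] at hu
  simp only [Finset.sum_singleton, if_pos hu'] at hu
  have key : ∃ r : ℚ, ∀ᶠ v in generic (Fin n → ℝ),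
      (X.link γ).sumMult (Y.link γ).reflect v = r := by
    obtain ⟨v₀, hv₀⟩ := hu.exists
    refine ⟨(X.link γ).sumMult (Y.link γ).reflect v₀, hu.mono fun v hv => ?_⟩
    have := mul_left_cancel₀ (Nat.cast_ne_zero.2 hi) (hv.trans hv₀.symm)
    exact_mod_cast this
  obtain ⟨r, hr⟩ := key
  rwa [show X.stableMult Y γ = r from (isGenericValue_of_eventually hr).genericValue_eq]

open Classical in
/-- The weighted sum of the multiplicities of the cells of the stable intersection at `w` that are
hit by an integral linear map does not depend on the generic point. -/
theorem exists_generic_sum_stableMult {Λ W : Type*} [AddCommGroup Λ] [AddGroup.FG Λ]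
    [AddCommGroup W] [Module ℝ W] [FiniteDimensional ℝ W] {j : Λ →+ W} {M : (Fin n → ℤ) →+ Λ}
    {Mr : (Fin n → ℝ) →ₗ[ℝ] W} (hj : IsLat j) (hM : ∀ x, Mr (incl n x) = j (M x))
    (hX : X.IsTropicalCycle p) (hY : Y.IsTropicalCycle q)
    (hdim : Module.finrank ℝ W + (p + q) = n) (w : Fin n → ℝ) :
    ∃ m : ℝ,
      (∀ᶠ z in generic ((Fin n → ℝ) × W), (∑ P ∈ hX.isPolyhedralComplex.facetsAt w ×ˢ
        hY.isPolyhedralComplex.facetsAt w,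
        if z ∈ subProdₗ Mr '' (tcone w P.1 ×ˢ tcone w P.2) then
          (X.mult P.1 * Y.mult P.2 *
            (((latticeOf P.1).prod (latticeOf P.2)).map (subProd M)).index : ℝ) else 0) = m) ∧
      ∀ᶠ u in generic W,
        (∑ γ ∈ commonCellsAt hX.isPolyhedralComplex hY.isPolyhedralComplex (p + q) w,
          if u ∈ Mr '' tcone w γ then
            (((latticeOf γ).map M).index : ℝ) * (X.stableMult Y γ : ℝ) else 0) = m := by
  obtain ⟨m, hm, hm'⟩ := exists_generic_stableDegree hj hM hX hY hdim w
  refine ⟨m, hm, hm'.mono fun u hu => ?_⟩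
  obtain ⟨v, hv, hv'⟩ := (hu.and ((Finset.eventually_all _).2 fun γ hγ =>
    eventually_sumMult_eq hX hY (mem_commonCellsAt.1 hγ).1 (mem_commonCellsAt.1 hγ).2.2)).exists
  rw [← hv]
  refine Finset.sum_congr rfl fun γ hγ => ?_
  rw [hv' γ hγ]

/-- The generic value is attained at some `v`, where it is a finite sum of integers. -/
theorem exists_int_stableMult (hX : X.IsTropicalCycle p) (hY : Y.IsTropicalCycle q)
    (hXi : ∀ σ, X.IsFacet σ → ∃ k : ℤ, X.mult σ = k)
    (hYi : ∀ σ, Y.IsFacet σ → ∃ k : ℤ, Y.mult σ = k)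
    {γ : Set (Fin n → ℝ)} (hγ : γ ∈ X.commonCells Y) (hd : dim γ + (p + q) = n) :
    ∃ k : ℤ, X.stableMult Y γ = k := by
  classical
  obtain ⟨v, hv⟩ := (eventually_sumMult_eq hX hY hγ hd).exists
  obtain ⟨w, hw⟩ := hγ.1
  rw [← hv, sumMult_eq_sum hX.isPolyhedralComplex hY.isPolyhedralComplex hγ hw]
  have : ∀ P ∈ hX.isPolyhedralComplex.facetsAt w ×ˢ hY.isPolyhedralComplex.facetsAt w,
      (if γ ⊆ P.1 ∧ γ ⊆ P.2 ∧ v ∈ linkAlong γ P.1 - linkAlong γ P.2 then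
        X.mult P.1 * Y.mult P.2 * ((latticeOf P.1 ⊔ latticeOf P.2).index : ℚ) else 0) ∈
      (Int.castRingHom ℚ).range := by
    intro P hP
    simp only [Finset.mem_product, IsPolyhedralComplex.mem_facetsAt] at hP
    obtain ⟨a, ha⟩ := hXi _ hP.1.1
    obtain ⟨b, hb⟩ := hYi _ hP.2.1
    split_ifs
    · exact ⟨a * b * (latticeOf P.1 ⊔ latticeOf P.2).index, by simp [ha, hb]⟩
    · exact zero_mem _
  obtain ⟨k, hk⟩ := sum_mem this
  exact ⟨k, hk.symm⟩

theorem mem_stableSet_iff (hX : X.IsPolyhedralComplex) (hY : Y.IsPolyhedralComplex)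
    {w : Fin n → ℝ} : w ∈ X.stableSet Y ↔ ∀ v, ∃ σ₁ σ₂, X.IsFacet σ₁ ∧ Y.IsFacet σ₂ ∧ w ∈ σ₁ ∧
      w ∈ σ₂ ∧ X.mult σ₁ ≠ 0 ∧ Y.mult σ₂ ≠ 0 ∧ v ∈ tcone w σ₁ - tcone w σ₂ := by
  have hsub : ∀ Z : WeightedComplex n, ∀ σ ∈ Z.cells, w ∈ σ → {w} ⊆ σ := fun Z σ _ h =>
    Set.singleton_subset_iff.2 h
  change (X.link {w}).supp + (Y.link {w}).reflect.supp = Set.univ ↔ _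
  rw [Set.eq_univ_iff_forall]
  refine forall_congr' fun v => ?_
  rw [Set.mem_add]
  simp only [mem_reflect_supp,
    hX.mem_link_supp (convex_singleton w) (inRel_singleton w) (hsub X),
    hY.mem_link_supp (convex_singleton w) (inRel_singleton w) (hsub Y)]
  constructor
  · rintro ⟨a, ⟨σ₁, h1, h2, h3, h4⟩, b, ⟨σ₂, h5, h6, h7, h8⟩, rfl⟩
    exact ⟨σ₁, σ₂, h1, h5, h2, h6, h3, h7, a, h4, -b, h8, by simp⟩
  · rintro ⟨σ₁, σ₂, h1, h5, h2, h6, h3, h7, a, h4, b, h8, rfl⟩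
    exact ⟨a, ⟨σ₁, h1, h2, h3, h4⟩, -b, ⟨σ₂, h5, h6, h7, by simpa⟩, by simp [sub_eq_add_neg]⟩

/-- The difference of two transverse polyhedral cones that contain the intersection of their spans
is closed. -/
theorem mem_sub_of_frequently {C₁ C₂ : Set (Fin n → ℝ)} (h₁ : IsPolyCone C₁) (h₂ : IsPolyCone C₂)
    {E₁ E₂ : Submodule ℝ (Fin n → ℝ)} (hE₁ : C₁ ⊆ E₁) (hE₂ : C₂ ⊆ E₂) (htop : E₁ ⊔ E₂ = ⊤)
    (hD₁ : (E₁ ⊓ E₂ : Submodule ℝ (Fin n → ℝ)) ≤ C₁) (hD₂ : (E₁ ⊓ E₂ : Submodule ℝ (Fin n → ℝ)) ≤ C₂)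
    {v z : Fin n → ℝ} (h : ∃ᶠ e : ℝ in 𝓝[>] 0, v + e • z ∈ C₁ - C₂) : v ∈ C₁ - C₂ := by
  have hdec : ∀ v : Fin n → ℝ, ∃ a ∈ E₁, ∃ b ∈ E₂, a - b = v := fun v => by
    obtain ⟨a, ha, b, hb, h⟩ := Submodule.mem_sup.1 (htop ▸ Submodule.mem_top : v ∈ _)
    exact ⟨a, ha, -b, neg_mem hb, by rw [← h, sub_neg_eq_add]⟩
  obtain ⟨a, ha, b, hb, rfl⟩ := hdec v
  obtain ⟨a', ha', b', hb', rfl⟩ := hdec z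
  have key : ∃ᶠ e : ℝ in 𝓝[>] 0, a + e • a' ∈ C₁ ∧ b + e • b' ∈ C₂ := by
    refine h.mono ?_
    rintro e ⟨x, hx, y, hy, hxy⟩
    have h3 : a + e • a' - x = b + e • b' - y := by
      rw [sub_eq_iff_eq_add] at hxy
      rw [hxy]
      module
    have h4 : a + e • a' - x ∈ E₁ ⊓ E₂ :=
      ⟨sub_mem (add_mem ha (Submodule.smul_mem _ _ ha')) (hE₁ hx), by
        rw [h3]; exact sub_mem (add_mem hb (Submodule.smul_mem _ _ hb')) (hE₂ hy)⟩
    constructor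
    · simpa using h₁.add_mem hx (hD₁ h4)
    · rw [h3] at h4
      simpa using h₂.add_mem hy (hD₂ h4)
  obtain ⟨e, ⟨h3, h4⟩, h5, h6⟩ := (key.and_eventually ((h₁.isPoly.eventually_mem_iff a a').and
    (h₂.isPoly.eventually_mem_iff b b'))).exists
  exact ⟨a, h₁.isPoly.mem_of_tcone (h5.1 h3), b, h₂.isPoly.mem_of_tcone (h6.1 h4), rfl⟩

/-- Any `v` is approached through generic points, at which the multiplicity sum is non-zero and some
pair of facets of non-zero multiplicity contributes. The difference of the cones of such a pair is
closed in the required sense, so it contains `v`. -/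
theorem subset_stableSet (hX : X.IsTropicalCycle p) (hY : Y.IsTropicalCycle q)
    {γ : Set (Fin n → ℝ)} (hγ : γ ∈ X.commonCells Y) (hd : dim γ + (p + q) = n)
    (hm : X.stableMult Y γ ≠ 0) : γ ⊆ X.stableSet Y := by
  classical
  have hXc := hX.isPolyhedralComplex
  have hYc := hY.isPolyhedralComplex
  have hp := (isRational_of_mem_commonCells hXc hYc hγ).isPoly
  obtain ⟨w, hw⟩ := exists_inRel hp.convex hγ.1
  intro ω hω
  rw [mem_stableSet_iff hXc hYc]
  intro v
  obtain ⟨z, hz⟩ := (generic_line v (eventually_sumMult_eq hX hY hγ hd)).exists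
  set I := hXc.facetsAt w ×ˢ hYc.facetsAt w with hI
  have hev : ∀ᶠ e : ℝ in 𝓝[>] 0, ∃ P ∈ I, (γ ⊆ P.1 ∧ γ ⊆ P.2 ∧
      v + e • z ∈ linkAlong γ P.1 - linkAlong γ P.2) ∧ X.mult P.1 ≠ 0 ∧ Y.mult P.2 ≠ 0 ∧
        (latticeOf P.1 ⊔ latticeOf P.2).index ≠ 0 := by
    filter_upwards [hz] with e he
    rw [sumMult_eq_sum hXc hYc hγ hw.1] at he
    obtain ⟨P, hP, hP'⟩ := Finset.exists_ne_zero_of_sum_ne_zero (he.trans_ne hm)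
    rw [ite_ne_right_iff] at hP'
    obtain ⟨h1, h2⟩ := hP'
    simp only [ne_eq, mul_eq_zero, not_or, Nat.cast_eq_zero] at h2
    exact ⟨P, hP, h1, h2.1.1, h2.1.2, h2.2⟩
  -- Only finitely many pairs are available, so a single one serves for arbitrarily small `e`.
  have hfr : ∃ P ∈ I, ∃ᶠ e : ℝ in 𝓝[>] 0, (γ ⊆ P.1 ∧ γ ⊆ P.2 ∧
      v + e • z ∈ linkAlong γ P.1 - linkAlong γ P.2) ∧ X.mult P.1 ≠ 0 ∧ Y.mult P.2 ≠ 0 ∧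
        (latticeOf P.1 ⊔ latticeOf P.2).index ≠ 0 := by
    by_contra hcon
    obtain ⟨e, ⟨P, hP, h1⟩, h2⟩ := (hev.and ((Finset.eventually_all I).2 fun P hP =>
      not_frequently.1 fun h => hcon ⟨P, hP, h⟩)).exists
    exact h2 P hP h1
  obtain ⟨⟨σ₁, σ₂⟩, hP, hfr⟩ := hfr
  simp only [hI, Finset.mem_product, IsPolyhedralComplex.mem_facetsAt] at hP
  obtain ⟨⟨h1, h2⟩, h3, h4⟩ := hP
  obtain ⟨-, ⟨hs₁, hs₂, -⟩, hm₁, hm₂, hidx⟩ := hfr.exists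
  dsimp only at hs₁ hs₂ hm₁ hm₂ hidx
  have hp₁ := hXc.isPoly h1.1
  have hp₂ := hYc.isPoly h3.1
  have htop := sup_eq_top_of_index_ne_zero hidx
  have hspan := vectorSpan_eq_of_subset hs₁ hs₂
    (finrank_inf_of_sup_eq_top hX.pure hY.pure hd h1 h3 htop).symm
  have hD : ∀ σ, γ ⊆ σ →
      ((vectorSpan ℝ σ₁ ⊓ vectorSpan ℝ σ₂ : Submodule ℝ (Fin n → ℝ)) : Set (Fin n → ℝ)) ⊆
        tcone w σ := fun σ hσ => by
    rw [← hspan, ← hp.tcone_of_inRel hw]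
    exact tcone_mono hσ
  obtain ⟨a, ha, b, hb, hab⟩ := mem_sub_of_frequently (hp₁.isPolyCone_tcone h2)
    (hp₂.isPolyCone_tcone h4) hp₁.tcone_subset_vectorSpan hp₂.tcone_subset_vectorSpan htop
    (hD _ hs₁) (hD _ hs₂) (hfr.mono fun e he => by
      rw [← hp₁.linkAlong_eq hp.convex hs₁ hw, ← hp₂.linkAlong_eq hp.convex hs₂ hw]
      exact he.1.2.2)
  obtain ⟨e, he0, he₁, he₂⟩ := exists_pos_of_eventually ((mem_tcone.1 ha).and (mem_tcone.1 hb))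
  -- Passage from `w` to an arbitrary point `ω` of `γ`: the points `w + e • a` and `w + e • b` lie
  -- in the facets, and the directions to them from `ω`, rescaled by `e⁻¹`, again differ by `a - b =
  -- v`.
  refine ⟨σ₁, σ₂, h1, h3, hs₁ hω, hs₂ hω, hm₁, hm₂, e⁻¹ • (w + e • a - ω), ?_,
    e⁻¹ • (w + e • b - ω), ?_, ?_⟩
  · exact (hp₁.isPolyCone_tcone (hs₁ hω)).smul_mem (hp₁.convex.sub_mem_tcone (hs₁ hω) he₁)
      (inv_nonneg.2 he0.le)
  · exact (hp₂.isPolyCone_tcone (hs₂ hω)).smul_mem (hp₂.convex.sub_mem_tcone (hs₂ hω) he₂)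
      (inv_nonneg.2 he0.le)
  · dsimp only at hab ⊢
    rw [← smul_sub, sub_sub_sub_cancel_right, add_sub_add_left_eq_sub, ← smul_sub, smul_smul,
      inv_mul_cancel₀ he0.ne', one_smul, hab]

theorem isStableFacet_iff (hX : X.IsTropicalCycle p) (hY : Y.IsTropicalCycle q)
    {γ : Set (Fin n → ℝ)} : IsStableFacet X Y p q γ ↔
      γ ∈ X.commonCells Y ∧ dim γ + (p + q) = n ∧ X.stableMult Y γ ≠ 0 :=
  ⟨fun h => ⟨h.1, h.2.2.1, h.2.2.2⟩,
    fun h => ⟨h.1, subset_stableSet hX hY h.1 h.2.1 h.2.2, h.2.1, h.2.2⟩⟩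

end WeightedComplex

/-! ### Existence of a generator modulo a hyperplane lattice -/

section LatticeNormal

variable {n : ℕ}

/-- The lattice of a rational subspace is generated by the lattice of a rational hyperplane and one
more vector. -/
theorem exists_latPts_sup {T E : Submodule ℝ (Fin n → ℝ)} (hT : IsRatSub T) (hTE : T ≤ E)
    (hd : Module.finrank ℝ E = Module.finrank ℝ T + 1) :
    ∃ v : Fin n → ℤ, latPts T ⊔ AddSubgroup.zmultiples v = latPts E := by
  obtain ⟨A, hA⟩ := hT
  obtain ⟨a, haA, x, hxE, hax⟩ : ∃ a ∈ A, ∃ x ∈ E, intDual a x ≠ 0 := by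
    by_contra! h
    have : E ≤ T := fun x hx => (hA x).2 fun a ha => h a ha x hx
    have := Submodule.finrank_mono this
    omega
  have hker : ∀ z ∈ E, intDual a z = 0 → z ∈ T := by
    have h1 : T ≤ E ⊓ LinearMap.ker (intDual a) := le_inf hTE fun z hz => (hA z).1 hz a haA
    have h2 : E ⊓ LinearMap.ker (intDual a) < E :=
      lt_of_le_of_ne inf_le_left fun h => hax (h.ge hxE).2
    have h3 := Submodule.finrank_lt_finrank_of_lt h2
    have h4 := Submodule.eq_of_le_of_finrank_le h1 (by omega)
    exact fun z hz h0 => h4.ge ⟨hz, h0⟩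
  obtain ⟨l, hl⟩ := exists_intDual_incl a
  -- On `E` the functional `a` has kernel `T`, so `latPts E` modulo `latPts T` embeds in `ℤ` and is
  -- cyclic; `v` lifts a generator of the image.
  obtain ⟨g, hg⟩ := Int.subgroup_cyclic ((latPts E).map l)
  obtain ⟨v, hvE, hv⟩ : g ∈ (latPts E).map l := by
    rw [hg]
    exact AddSubgroup.subset_closure rfl
  refine ⟨v, le_antisymm (sup_le (fun x hx => hTE hx) ?_) fun x hx => ?_⟩
  · rwa [AddSubgroup.zmultiples_le]
  · have h1 : l x ∈ (latPts E).map l := ⟨x, hx, rfl⟩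
    rw [hg, AddSubgroup.mem_closure_singleton] at h1
    obtain ⟨k, hk⟩ := h1
    refine AddSubgroup.mem_sup.2 ⟨x - k • v, ?_, k • v,
      AddSubgroup.mem_zmultiples_iff.2 ⟨k, rfl⟩, sub_add_cancel _ _⟩
    refine hker _ (sub_mem hx (zsmul_mem hvE k)) ?_
    rw [hl, map_sub, map_zsmul, hv, hk, sub_self, Int.cast_zero]

end LatticeNormal

/-! ### Balancing, and the support for non-negative multiplicities -/

namespace WeightedComplex

variable {n p q : ℕ} {X Y : WeightedComplex n}

/-- A generator modulo the lattice of `τ` is determined only up to sign. Some tangent direction of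
`σ` lies outside the span of `τ`, and the sign of its coefficient selects the generator that points
into `σ`. -/
theorem exists_isLatticeNormal {σ τ : Set (Fin n → ℝ)} (hσ : IsRationalPolyhedron σ)
    (hτ : IsRationalPolyhedron τ) (hne : τ.Nonempty) (hs : τ ⊆ σ) (hd : dim σ = dim τ + 1) :
    ∃ v, IsLatticeNormal σ τ v := by
  have hp := hσ.isPoly
  have hE := hσ.isRatSub_vectorSpan (hne.mono hs)
  obtain ⟨w, hw⟩ := exists_inRel hτ.isPoly.convex hne
  have hTlin : vectorSpan ℝ τ ≤ lin w σ := by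
    rw [← hτ.isPoly.lin_eq_vectorSpan_of_inRel hw]
    exact lin_mono hs
  obtain ⟨v, hv⟩ := exists_latPts_sup (hτ.isRatSub_vectorSpan hne) (vectorSpan_mono ℝ hs) hd
  obtain ⟨z, hz, hzT⟩ : ∃ z ∈ tcone w σ, z ∉ vectorSpan ℝ τ := by
    by_contra! h
    have h1 : vectorSpan ℝ σ ≤ vectorSpan ℝ τ := by
      rw [← hp.span_tcone (hs hw.1), Submodule.span_le]
      exact h
    have := Submodule.finrank_mono h1
    unfold dim at hd
    omega
  obtain ⟨t, ht, s, hs', hts⟩ := Submodule.mem_sup.1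
    (span_le_of_latPts_sup hE hv (hp.tcone_subset_vectorSpan hz))
  obtain ⟨c, rfl⟩ := Submodule.mem_span_singleton.1 hs'
  have hc0 : c ≠ 0 := by
    rintro rfl
    rw [zero_smul, add_zero] at hts
    exact hzT (hts ▸ ht)
  have hcv : c • incl n v ∈ tcone w σ := by
    have := hp.sub_mem_tcone_of_lin (hs hw.1) hz (hTlin ht)
    rwa [← hts, add_sub_cancel_left] at this
  have hcv' := (hp.isPolyCone_tcone (hs hw.1)).smul_mem hcv (inv_nonneg.2 (abs_nonneg c))
  rw [smul_smul] at hcv'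
  rcases hc0.lt_or_gt with hc | hc
  · refine ⟨-v, ?_, ?_⟩
    · rw [hp.linkAlong_eq hτ.isPoly.convex hs hw, map_neg]
      rwa [abs_of_neg hc, ← neg_inv, neg_mul, inv_mul_cancel₀ hc0, neg_one_smul] at hcv'
    · rw [AddSubgroup.zmultiples_neg]
      exact hv
  · refine ⟨v, ?_, hv⟩
    rw [hp.linkAlong_eq hτ.isPoly.convex hs hw]
    rwa [abs_of_pos hc, inv_mul_cancel₀ hc0, one_smul] at hcv'

/-- The tangent cone along a ridge is a half-space bounded by the span of the ridge. -/
theorem IsLatticeNormal.add_smul_mem_tcone_iff {σ τ : Set (Fin n → ℝ)} {v : Fin n → ℤ}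
    (h : IsLatticeNormal σ τ v) (hσ : IsPoly σ) (hτ : IsFace σ τ) {w : Fin n → ℝ} (hw : InRel w τ)
    (hv : incl n v ∉ vectorSpan ℝ τ) {t : Fin n → ℝ} (ht : t ∈ vectorSpan ℝ τ) (c : ℝ) :
    t + c • incl n v ∈ tcone w σ ↔ 0 ≤ c := by
  have hwσ := hτ.subset hw.1
  have hlin : vectorSpan ℝ τ = lin w σ := by
    rw [hτ.eq_minFace hσ.convex hw, hσ.vectorSpan_minFace hwσ]
  have hcone := hσ.isPolyCone_tcone hwσ
  have hvl := h.1
  rw [hσ.linkAlong_eq (hτ.convex hσ.convex) hτ.subset hw] at hvl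
  rw [hlin] at ht hv
  constructor
  · intro hz
    by_contra hc
    rw [not_le] at hc
    have h1 : c • incl n v ∈ tcone w σ := by
      have := hσ.sub_mem_tcone_of_lin hwσ hz ht
      rwa [add_sub_cancel_left] at this
    have h2 := hcone.smul_mem h1 (inv_nonneg.2 (neg_nonneg.2 hc.le))
    rw [smul_smul, ← neg_inv, neg_mul, inv_mul_cancel₀ hc.ne, neg_one_smul] at h2
    exact hv ((hσ.mem_lin hwσ).2 ⟨hvl, h2⟩)
  · intro hc
    rw [add_comm]
    exact hσ.add_mem_tcone_of_lin hwσ (hcone.smul_mem hvl hc) ht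

theorem latPts_inf_ker {τ σ : Set (Fin n → ℝ)} {v : Fin n → ℤ} (h : IsLatticeNormal σ τ v)
    {l : (Fin n → ℤ) →+ ℤ} (hl : ∀ x ∈ latticeOf τ, l x = 0) (hv : l v ≠ 0) {x : Fin n → ℤ}
    (hx : x ∈ latticeOf σ) (hlx : l x = 0) : x ∈ latticeOf τ := by
  rw [← h.2] at hx
  obtain ⟨a, ha, b, hb, rfl⟩ := AddSubgroup.mem_sup.1 hx
  obtain ⟨c, rfl⟩ := AddSubgroup.mem_zmultiples_iff.1 hb
  rw [map_add, hl a ha, map_zsmul, zero_add, smul_eq_mul, mul_eq_zero, or_iff_left hv] at hlx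
  rwa [hlx, zero_smul, add_zero]

/-- The index of the image of `N_σ` under `(l, M)`, where `l` vanishes on the lattice of a ridge. -/
theorem IsLatticeNormal.index_map_prod {Λ : Type*} [AddCommGroup Λ] {σ τ : Set (Fin n → ℝ)}
    {v : Fin n → ℤ} (h : IsLatticeNormal σ τ v) {l : (Fin n → ℤ) →+ ℤ}
    (hl : ∀ x ∈ latticeOf τ, l x = 0) (M : (Fin n → ℤ) →+ Λ) :
    ((latticeOf σ).map (l.prod M)).index = (l v).natAbs * ((latticeOf τ).map M).index := by
  have h1 : ((latticeOf σ).map (l.prod M)).map (AddMonoidHom.fst ℤ Λ) =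
      AddSubgroup.zmultiples (l v) := by
    rw [AddSubgroup.map_map, AddMonoidHom.fst_comp_prod, ← h.2, AddSubgroup.map_sup,
      AddMonoidHom.map_zmultiples, sup_eq_right]
    rintro _ ⟨x, hx, rfl⟩
    rw [hl x hx]
    exact zero_mem _
  rw [index_eq_map_fst_mul, h1, Int.index_zmultiples]
  by_cases hv : l v = 0
  · simp [hv]
  congr 2
  ext y
  constructor
  · rintro ⟨x, hx, hxy⟩
    obtain ⟨h2, h3⟩ := Prod.mk.inj hxy
    exact ⟨x, latPts_inf_ker h hl hv hx h2, h3⟩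
  · rintro ⟨x, hx, rfl⟩
    refine ⟨x, ?_, Prod.ext (hl x hx) rfl⟩
    rw [← h.2]
    exact AddSubgroup.mem_sup_left hx

/-- A ray in the direction of `(u, u')` is hit by the tangent cone along a ridge exactly if `u` has
the sign of the functional on the lattice normal. -/
theorem IsLatticeNormal.mem_image_tcone_iff {W : Type*} [AddCommGroup W] [Module ℝ W]
    {σ τ : Set (Fin n → ℝ)} {v : Fin n → ℤ} (h : IsLatticeNormal σ τ v)
    (hσ : IsRationalPolyhedron σ) (hτ : IsFace σ τ) {w : Fin n → ℝ} (hw : InRel w τ)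
    {l : Module.Dual ℝ (Fin n → ℝ)} (hl : ∀ x ∈ vectorSpan ℝ τ, l x = 0) (hv : l (incl n v) ≠ 0)
    {Mr : (Fin n → ℝ) →ₗ[ℝ] W} (hM : (vectorSpan ℝ τ).map Mr = ⊤) (u : ℝ × W) :
    u ∈ l.prod Mr '' tcone w σ ↔ 0 ≤ l (incl n v) * u.1 := by
  have hp := hσ.isPoly
  have hvT : incl n v ∉ vectorSpan ℝ τ := fun h => hv (hl _ h)
  have hE := hσ.isRatSub_vectorSpan (hτ.1.mono hτ.subset)
  constructor
  · rintro ⟨z, hz, rfl⟩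
    obtain ⟨t, ht, s, hs, rfl⟩ := Submodule.mem_sup.1
      (span_le_of_latPts_sup hE h.2 (hp.tcone_subset_vectorSpan hz))
    obtain ⟨c, rfl⟩ := Submodule.mem_span_singleton.1 hs
    rw [h.add_smul_mem_tcone_iff hp hτ hw hvT ht] at hz
    change 0 ≤ l (incl n v) * l (t + c • incl n v)
    rw [map_add, map_smul, hl t ht, zero_add, smul_eq_mul, mul_left_comm]
    exact mul_nonneg hz (mul_self_nonneg _)
  · intro hu
    obtain ⟨t, ht, htM⟩ : u.2 - (u.1 / l (incl n v)) • Mr (incl n v) ∈ (vectorSpan ℝ τ).map Mr :=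
      hM ▸ Submodule.mem_top
    refine ⟨t + (u.1 / l (incl n v)) • incl n v,
      (h.add_smul_mem_tcone_iff hp hτ hw hvT ht _).2 ?_, ?_⟩
    · rw [div_nonneg_iff, ← mul_nonneg_iff, mul_comm]
      exact hu
    · refine Prod.ext ?_ ?_
      · simp [hl t ht, hv]
      · simp [htM]

/-- Balancing asks for membership in a rational span; for a rational vector, membership in the real
subspace suffices, by clearing denominators. -/
theorem mem_span_rat_of_mem {T : Submodule ℝ (Fin n → ℝ)} (q : Fin n → ℚ)
    (h : (fun i => (q i : ℝ)) ∈ T) :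
    (fun i => (q i : ℝ)) ∈ Submodule.span ℚ (incl n '' (latPts T : Set (Fin n → ℤ))) := by
  obtain ⟨D, z, hD, hz⟩ := exists_smul_eq_incl q
  have hz' : incl n z = (D : ℝ) • fun i => (q i : ℝ) := by
    ext i
    have := congrArg (fun t : ℚ => (t : ℝ)) (hz i)
    simpa using this
  have h1 : (fun i => (q i : ℝ)) = (D : ℚ)⁻¹ • incl n z := by
    rw [hz', ← Rat.cast_smul_eq_qsmul ℝ, smul_smul]
    simp [hD]
  rw [h1]
  refine Submodule.smul_mem _ _ (Submodule.subset_span ⟨z, ?_, rfl⟩)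
  rw [SetLike.mem_coe, mem_latPts, hz']
  exact T.smul_mem _ h

theorem mem_commonCells_of_isFace (hX : X.IsPolyhedralComplex) (hY : Y.IsPolyhedralComplex)
    {γ δ : Set (Fin n → ℝ)} (hγ : γ ∈ X.commonCells Y) (h : IsFace γ δ) :
    δ ∈ X.commonCells Y := by
  have hc := (isRational_of_mem_commonCells hX hY hγ).isPoly.convex
  obtain ⟨w, hw⟩ := exists_inRel (h.convex hc) h.1
  have hwγ := h.subset hw.1
  have hδ := h.eq_minFace hc hw
  obtain ⟨-, σ, hσ, τ, hτ, rfl⟩ := hγ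
  refine ⟨h.1, minFace w σ, hX.face_mem σ hσ _ ((hX.isPoly hσ).isFace_minFace hwγ.1),
    minFace w τ, hY.face_mem τ hτ _ ((hY.isPoly hτ).isFace_minFace hwγ.2), ?_⟩
  rw [hδ, minFace_inter]

theorem stableIntersection_isPolyhedralComplex (hX : X.IsPolyhedralComplex)
    (hY : Y.IsPolyhedralComplex) : (X.stableIntersection Y p q).IsPolyhedralComplex := by
  have hcell : ∀ δ ∈ (X.stableIntersection Y p q).cells, δ ∈ X.commonCells Y := by
    rintro δ ⟨γ, hγ, h⟩
    exact mem_commonCells_of_isFace hX hY hγ.1 h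
  refine ⟨(finite_commonCells hX hY).subset hcell, fun δ h => (hcell δ h).1,
    fun δ h => isRational_of_mem_commonCells hX hY (hcell δ h), ?_, fun δ h δ' h' hne =>
      ⟨isFace_inter_of_mem_commonCells hX hY (hcell δ h) (hcell δ' h') hne, ?_⟩⟩
  · rintro δ ⟨γ, hγ, h⟩ ε hε
    exact ⟨γ, hγ, h.trans (isRational_of_mem_commonCells hX hY hγ.1).isPoly hε⟩
  · rw [Set.inter_comm] at hne ⊢
    exact isFace_inter_of_mem_commonCells hX hY (hcell δ' h') (hcell δ h) hne

theorem isFacet_stableIntersection_iff (hX : X.IsPolyhedralComplex) (hY : Y.IsPolyhedralComplex)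
    {γ : Set (Fin n → ℝ)} :
    (X.stableIntersection Y p q).IsFacet γ ↔ IsStableFacet X Y p q γ := by
  have hself : ∀ γ, IsStableFacet X Y p q γ → γ ∈ (X.stableIntersection Y p q).cells :=
    fun γ h => ⟨γ, h, isFace_self h.1.1⟩
  constructor
  · intro h
    obtain ⟨γ', hγ', hf⟩ := h.1
    rwa [h.eq_of_subset (hself γ' hγ') hf.subset]
  · refine fun h => ⟨hself γ h, ?_⟩
    rintro δ ⟨γ', hγ', hf⟩ hs
    rw [eq_of_subset_of_dim_eq hX hY h.1 hγ'.1 (hs.trans hf.subset)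
      (by have := h.2.2.1; have := hγ'.2.2.1; omega)]
    exact hf.subset

/-- Every integral functional that vanishes on a cell of codimension `p + q + 1` vanishes on the
weighted sum of the lattice normals. -/
theorem sum_stableMult_mul_eq_zero (hX : X.IsTropicalCycle p) (hY : Y.IsTropicalCycle q)
    {τ : Set (Fin n → ℝ)} (hτ : τ ∈ X.commonCells Y) (hd : dim τ + 1 + (p + q) = n)
    {w : Fin n → ℝ} (hw : InRel w τ) {v : Set (Fin n → ℝ) → Fin n → ℤ}
    (hv : ∀ γ ∈ commonCellsAt hX.isPolyhedralComplex hY.isPolyhedralComplex (p + q) w,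
      IsLatticeNormal γ τ (v γ)) {a : Fin n → ℤ} (ha : ∀ x ∈ vectorSpan ℝ τ, intDual a x = 0) :
    (∑ γ ∈ commonCellsAt hX.isPolyhedralComplex hY.isPolyhedralComplex (p + q) w,
      (X.stableMult Y γ : ℝ) * intDual a (incl n (v γ))) = 0 := by
  classical
  have hXc := hX.isPolyhedralComplex
  have hYc := hY.isPolyhedralComplex
  obtain ⟨l, hl⟩ := exists_intDual_incl a
  obtain ⟨M, Mr, hM, htop⟩ := exists_integral_iso (vectorSpan ℝ τ) (d := dim τ) rfl
  have hMM : ∀ x, (intDual a).prod Mr (incl n x) =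
      ((Int.castAddHom ℝ).prodMap (incl (dim τ))) (l.prod M x) := fun x => by
    simp [hl, hM]
  obtain ⟨m, -, hm⟩ := exists_generic_sum_stableMult (isLat_int.prod (isLat_incl (dim τ))) hMM hX hY
    (by rw [Module.finrank_prod, Module.finrank_fin_fun, Module.finrank_self]; omega) w
  have hfst : (LinearMap.fst ℝ ℝ (Fin (dim τ) → ℝ)) ≠ 0 := fun h => by
    have := LinearMap.congr_fun h (1, 0)
    simp at this
  -- If `a` is non-zero on the lattice normal of `γ`, the tangent cone of `γ` is mapped onto a
  -- half-space of the target bounded by the vanishing of the first coordinate. Hence `u` and `-u`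
  -- lie on opposite sides, and equality of the two sums is a linear relation between the signed
  -- values.
  obtain ⟨u, hu, hu', hu0⟩ := (hm.and ((generic_neg hm).and (generic_ne hfst))).exists
  rw [LinearMap.fst_apply] at hu0
  have hrat := isRational_of_mem_commonCells hXc hYc hτ
  have hc : ((latticeOf τ).map M).index ≠ 0 := by
    rw [latticeOf_eq, (isLat_incl _).index_ne_zero_iff, span_image_map hM,
      (hrat.isRatSub_vectorSpan hτ.1).span_latPts, htop]
  have hlτ : ∀ x ∈ latticeOf τ, l x = 0 := fun x hx => by
    have := ha _ hx
    rw [hl] at this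
    exact_mod_cast this
  have hsum := sub_eq_zero.2 (hu.trans hu'.symm)
  rw [← Finset.sum_sub_distrib] at hsum
  have hterm : ∀ γ ∈ commonCellsAt hXc hYc (p + q) w,
      ((if u ∈ (intDual a).prod Mr '' tcone w γ then
        (((latticeOf γ).map (l.prod M)).index : ℝ) * (X.stableMult Y γ : ℝ) else 0) -
      if -u ∈ (intDual a).prod Mr '' tcone w γ then
        (((latticeOf γ).map (l.prod M)).index : ℝ) * (X.stableMult Y γ : ℝ) else 0) =
      ((X.stableMult Y γ : ℝ) * intDual a (incl n (v γ))) *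
        (((latticeOf τ).map M).index * SignType.sign u.1) := by
    intro γ hγ
    obtain ⟨h1, h2, h3⟩ := mem_commonCellsAt.1 hγ
    have hs := subset_of_mem_commonCells hXc hYc hτ h1 hw h2
    have hf := isFace_inter_of_mem_commonCells hXc hYc h1 hτ ⟨w, h2, hw.1⟩
    rw [Set.inter_eq_right.2 hs] at hf
    have hγr := isRational_of_mem_commonCells hXc hYc h1
    rw [sub_ite_eq_mul_sign (m := (X.stableMult Y γ : ℝ) * ((latticeOf τ).map M).index)
      (r := intDual a (incl n (v γ))) (l := u.1) ?_
      (fun h => (hv γ hγ).mem_image_tcone_iff hγr hf hw ha h htop u)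
      (fun h => (hv γ hγ).mem_image_tcone_iff hγr hf hw ha h htop (-u))]
    · ring
    · rw [(hv γ hγ).index_map_prod hlτ, hl]
      push_cast
      rw [Nat.cast_natAbs, Int.cast_abs]
      ring
  rw [Finset.sum_congr rfl hterm, ← Finset.sum_mul, mul_eq_zero] at hsum
  refine hsum.resolve_right (mul_ne_zero (Nat.cast_ne_zero.2 hc) ?_)
  rcases hu0.lt_or_gt with h | h <;> simp [h]

/-- The span of a ridge is cut out by integral functionals, and each of them kills the weighted sum
of lattice normals. The sum is a rational vector, so it lies in the rational span as well. -/
theorem stableIntersection_isBalanced (hX : X.IsTropicalCycle p) (hY : Y.IsTropicalCycle q) :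
    (X.stableIntersection Y p q).IsBalanced (p + q) := by
  classical
  have hXc := hX.isPolyhedralComplex
  have hYc := hY.isPolyhedralComplex
  rintro τ ⟨γ₀, hγ₀, hf₀⟩ hd
  have hτ := mem_commonCells_of_isFace hXc hYc hγ₀.1 hf₀
  have hrat := isRational_of_mem_commonCells hXc hYc hτ
  obtain ⟨w, hw⟩ := exists_inRel hrat.isPoly.convex hτ.1
  have hex : ∀ γ, ∃ v, γ ∈ commonCellsAt hXc hYc (p + q) w → IsLatticeNormal γ τ v := fun γ => by
    by_cases hγ : γ ∈ commonCellsAt hXc hYc (p + q) w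
    · obtain ⟨h1, h2, h3⟩ := mem_commonCellsAt.1 hγ
      obtain ⟨v, hv⟩ := exists_isLatticeNormal (isRational_of_mem_commonCells hXc hYc h1) hrat hτ.1
        (subset_of_mem_commonCells hXc hYc hτ h1 hw h2) (by omega)
      exact ⟨v, fun _ => hv⟩
    · exact ⟨0, fun h => absurd h hγ⟩
  choose v hv using hex
  have hmem : ∀ σ, ((X.stableIntersection Y p q).IsFacet σ ∧ τ ⊆ σ) ↔
      σ ∈ (commonCellsAt hXc hYc (p + q) w).filter fun γ => X.stableMult Y γ ≠ 0 := fun σ => by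
    rw [isFacet_stableIntersection_iff hXc hYc, isStableFacet_iff hX hY, Finset.mem_filter,
      mem_commonCellsAt]
    constructor
    · rintro ⟨⟨h1, h2, h3⟩, h4⟩
      exact ⟨⟨h1, h4 hw.1, h2⟩, h3⟩
    · rintro ⟨⟨h1, h4, h2⟩, h3⟩
      exact ⟨⟨h1, h2, h3⟩, subset_of_mem_commonCells hXc hYc hτ h1 hw h4⟩
  refine ⟨v, fun σ hσ hs => hv σ (Finset.mem_filter.1 ((hmem σ).1 ⟨hσ, hs⟩)).1, ?_⟩
  have hsum : (∑ᶠ (σ : Set (Fin n → ℝ)) (_ : (X.stableIntersection Y p q).IsFacet σ ∧ τ ⊆ σ),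
      (X.stableIntersection Y p q).mult σ • incl n (v σ)) =
      ∑ γ ∈ commonCellsAt hXc hYc (p + q) w, X.stableMult Y γ • incl n (v γ) := by
    simp only [hmem]
    -- Cells of multiplicity zero are not facets of the stable intersection, but they add nothing to
    -- the sum.
    rw [← Finset.sum_filter_of_ne (p := fun γ => X.stableMult Y γ ≠ 0)
      fun γ _ h h0 => h (by rw [h0, zero_smul])]
    exact finsum_mem_coe_finset _ _
  have hq : (∑ γ ∈ commonCellsAt hXc hYc (p + q) w, X.stableMult Y γ • incl n (v γ)) =
      fun i => ((∑ γ ∈ commonCellsAt hXc hYc (p + q) w, X.stableMult Y γ * v γ i : ℚ) : ℝ) := by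
    ext i
    rw [Finset.sum_apply, Rat.cast_sum]
    refine Finset.sum_congr rfl fun γ _ => ?_
    rw [Pi.smul_apply, incl_apply, Rat.smul_def]
    push_cast
    rfl
  rw [hsum, hq]
  refine mem_span_rat_of_mem _ ?_
  rw [← hq]
  obtain ⟨A, hA⟩ := hrat.isRatSub_vectorSpan hτ.1
  rw [hA]
  intro a ha
  rw [← sum_stableMult_mul_eq_zero hX hY hτ hd hw hv fun x hx => (hA x).1 hx a ha, map_sum]
  refine Finset.sum_congr rfl fun γ _ => ?_
  rw [← Rat.cast_smul_eq_qsmul ℝ, map_smul, smul_eq_mul]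

theorem stableIntersection_isTropicalCycle (hX : X.IsTropicalCycle p) (hY : Y.IsTropicalCycle q) :
    (X.stableIntersection Y p q).IsTropicalCycle (p + q) where
  isPolyhedralComplex :=
    stableIntersection_isPolyhedralComplex hX.isPolyhedralComplex hY.isPolyhedralComplex
  pure _ h := ((isFacet_stableIntersection_iff hX.isPolyhedralComplex
    hY.isPolyhedralComplex).1 h).2.2.1
  balanced := stableIntersection_isBalanced hX hY

/-- At a point of the stable set some pair of facets is transverse. -/
theorem exists_transverse_of_mem_stableSet (hX : X.IsPolyhedralComplex)
    (hY : Y.IsPolyhedralComplex) {w : Fin n → ℝ} (hw : w ∈ X.stableSet Y) :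
    ∃ σ₁ σ₂, X.IsFacet σ₁ ∧ Y.IsFacet σ₂ ∧ w ∈ σ₁ ∧ w ∈ σ₂ ∧ X.mult σ₁ ≠ 0 ∧ Y.mult σ₂ ≠ 0 ∧
      vectorSpan ℝ σ₁ ⊔ vectorSpan ℝ σ₂ = ⊤ := by
  -- The differences of non-transverse pairs lie in finitely many proper subspaces, which a generic
  -- `v` avoids.
  have hev : ∀ᶠ v in generic (Fin n → ℝ), ∀ P ∈ hX.facetsAt w ×ˢ hY.facetsAt w,
      vectorSpan ℝ P.1 ⊔ vectorSpan ℝ P.2 ≠ ⊤ → v ∉ vectorSpan ℝ P.1 ⊔ vectorSpan ℝ P.2 := by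
    refine (Finset.eventually_all _).2 fun P _ => ?_
    by_cases h : vectorSpan ℝ P.1 ⊔ vectorSpan ℝ P.2 = ⊤
    · exact Eventually.of_forall fun v h' => absurd h h'
    · exact (generic_notMem h).mono fun v hv _ => hv
  obtain ⟨v, hv⟩ := hev.exists
  obtain ⟨σ₁, σ₂, h1, h2, h3, h4, h5, h6, a, ha, b, hb, rfl⟩ := (mem_stableSet_iff hX hY).1 hw v
  refine ⟨σ₁, σ₂, h1, h2, h3, h4, h5, h6, ?_⟩
  by_contra h
  refine hv (σ₁, σ₂) ?_ h ?_
  · simp only [Finset.mem_product, IsPolyhedralComplex.mem_facetsAt]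
    exact ⟨⟨h1, h3⟩, h2, h4⟩
  · exact sub_mem (Submodule.mem_sup_left ((hX.isPoly h1.1).tcone_subset_vectorSpan ha))
      (Submodule.mem_sup_right ((hY.isPoly h2.1).tcone_subset_vectorSpan hb))

/-- The image of a product of cones under a linear map that is surjective on the product of their
spans contains a point with all generic directions pointing into the image. -/
theorem exists_eventually_mem_image {W : Type*} [AddCommGroup W] [Module ℝ W]
    {σ₁ σ₂ : Set (Fin n → ℝ)} (hp₁ : IsPoly σ₁) (hp₂ : IsPoly σ₂) {w : Fin n → ℝ} (hw₁ : w ∈ σ₁)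
    (hw₂ : w ∈ σ₂) {L : (Fin n → ℝ) × (Fin n → ℝ) →ₗ[ℝ] W}
    (hL : ((vectorSpan ℝ σ₁).prod (vectorSpan ℝ σ₂)).map L = ⊤) :
    ∃ c : W, ∀ z, ∀ᶠ e : ℝ in 𝓝[>] 0, c + e • z ∈ L '' (tcone w σ₁ ×ˢ tcone w σ₂) := by
  have hc₁ := hp₁.isPolyCone_tcone hw₁
  have hc₂ := hp₂.isPolyCone_tcone hw₂
  obtain ⟨y₁, hy₁⟩ := exists_inRel hc₁.isPoly.convex ⟨0, hc₁.zero_mem⟩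
  obtain ⟨y₂, hy₂⟩ := exists_inRel hc₂.isPoly.convex ⟨0, hc₂.zero_mem⟩
  refine ⟨L (y₁, y₂), fun z => ?_⟩
  obtain ⟨⟨z₁, z₂⟩, ⟨hz₁, hz₂⟩, rfl⟩ : z ∈ ((vectorSpan ℝ σ₁).prod (vectorSpan ℝ σ₂)).map L :=
    hL ▸ Submodule.mem_top
  have h1 : z₁ ∈ tcone y₁ (tcone w σ₁) := by
    rw [hc₁.isPoly.tcone_of_inRel hy₁, vectorSpan_tcone hp₁ hw₁]
    exact hz₁
  have h2 : z₂ ∈ tcone y₂ (tcone w σ₂) := by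
    rw [hc₂.isPoly.tcone_of_inRel hy₂, vectorSpan_tcone hp₂ hw₂]
    exact hz₂
  filter_upwards [mem_tcone.1 h1, mem_tcone.1 h2] with e h3 h4
  exact ⟨(y₁ + e • z₁, y₂ + e • z₂), ⟨h3, h4⟩, by rw [← map_smul, ← map_add]; rfl⟩

/-- With non-negative multiplicities nothing cancels in the degree, and a transverse pair of facets
makes it positive. Since the same number is a weighted sum of multiplicities of cells through `w`,
one of these is non-zero. -/
theorem exists_stableMult_ne_zero (hX : X.IsTropicalCycle p) (hY : Y.IsTropicalCycle q)
    (hX0 : ∀ σ, X.IsFacet σ → 0 ≤ X.mult σ) (hY0 : ∀ σ, Y.IsFacet σ → 0 ≤ Y.mult σ)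
    {w : Fin n → ℝ} (hw : w ∈ X.stableSet Y) :
    ∃ γ, γ ∈ X.commonCells Y ∧ w ∈ γ ∧ dim γ + (p + q) = n ∧ X.stableMult Y γ ≠ 0 := by
  classical
  have hXc := hX.isPolyhedralComplex
  have hYc := hY.isPolyhedralComplex
  obtain ⟨σ₁, σ₂, h1, h2, hw₁, hw₂, hm₁, hm₂, htop⟩ :=
    exists_transverse_of_mem_stableSet hXc hYc hw
  obtain ⟨d, hd⟩ : ∃ d, d + (p + q) = n := by
    have h3 := Submodule.finrank_sup_add_finrank_inf_eq (vectorSpan ℝ σ₁) (vectorSpan ℝ σ₂)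
    rw [htop, finrank_top, Module.finrank_fin_fun] at h3
    have h4 := hX.pure σ₁ h1
    have h5 := hY.pure σ₂ h2
    unfold dim at h4 h5
    exact ⟨n - (p + q), by omega⟩
  obtain ⟨M, Mr, hM, hMtop⟩ := exists_integral_iso _
    (finrank_inf_of_sup_eq_top hX.pure hY.pure hd h1 h2 htop)
  obtain ⟨m, hm, hm'⟩ := exists_generic_sum_stableMult (isLat_incl d) hM hX hY
    (by rw [Module.finrank_fin_fun]; exact hd) w
  have hE₁ := hXc.isRatSub h1.1
  have hE₂ := hYc.isRatSub h2.1
  have hidx : (((latticeOf σ₁).prod (latticeOf σ₂)).map (subProd M)).index ≠ 0 := by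
    rw [index_map_subProd]
    refine mul_ne_zero (index_sup_ne_zero hE₁ hE₂ htop) ?_
    rw [latticeOf_eq, latticeOf_eq, ← latPts_inf, (isLat_incl d).index_ne_zero_iff,
      span_image_map hM, (hE₁.inf hE₂).span_latPts, hMtop]
  have hL := (index_map_prod_ne_zero_iff ((isLat_incl n).prod (isLat_incl d)) (subProdₗ_incl hM)
    hE₁ hE₂).1 hidx
  obtain ⟨c, hc⟩ := exists_eventually_mem_image (hXc.isPoly h1.1) (hYc.isPoly h2.1) hw₁ hw₂ hL
  -- For small `e` the point `c + e • z` is generic for the degree and also lies in the image of the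
  -- transverse pair.
  obtain ⟨z, hz⟩ := (generic_line c hm).exists
  obtain ⟨e, hze, hce⟩ := (hz.and (hc z)).exists
  have hmpos : 0 < m := by
    rw [← hze]
    refine Finset.sum_pos' (fun P hP => ?_) ⟨(σ₁, σ₂), ?_, ?_⟩
    · simp only [Finset.mem_product, IsPolyhedralComplex.mem_facetsAt] at hP
      have h3 : (0 : ℝ) ≤ X.mult P.1 := Rat.cast_nonneg.2 (hX0 _ hP.1.1)
      have h4 : (0 : ℝ) ≤ Y.mult P.2 := Rat.cast_nonneg.2 (hY0 _ hP.2.1)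
      split_ifs <;> positivity
    · simp only [Finset.mem_product, IsPolyhedralComplex.mem_facetsAt]
      exact ⟨⟨h1, hw₁⟩, h2, hw₂⟩
    · rw [if_pos hce]
      have h3 : (0 : ℝ) < X.mult σ₁ := Rat.cast_pos.2 ((hX0 _ h1).lt_of_ne' hm₁)
      have h4 : (0 : ℝ) < Y.mult σ₂ := Rat.cast_pos.2 ((hY0 _ h2).lt_of_ne' hm₂)
      have h5 : (0 : ℝ) < (((latticeOf σ₁).prod (latticeOf σ₂)).map (subProd M)).index :=
        Nat.cast_pos.2 hidx.bot_lt
      positivity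
  obtain ⟨u, hu⟩ := hm'.exists
  obtain ⟨γ, hγ, hγ'⟩ := Finset.exists_ne_zero_of_sum_ne_zero (hu.trans_ne hmpos.ne')
  rw [ite_ne_right_iff] at hγ'
  obtain ⟨h3, h4, h5⟩ := mem_commonCellsAt.1 hγ
  exact ⟨γ, h3, h4, h5, fun h => hγ'.2 (by rw [h, Rat.cast_zero, mul_zero])⟩

theorem supp_stableIntersection_eq (hX : X.IsTropicalCycle p) (hY : Y.IsTropicalCycle q)
    (hX0 : ∀ σ, X.IsFacet σ → 0 ≤ X.mult σ) (hY0 : ∀ σ, Y.IsFacet σ → 0 ≤ Y.mult σ) :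
    (X.stableIntersection Y p q).supp = X.stableSet Y := by
  have hf := fun γ => isFacet_stableIntersection_iff (p := p) (q := q) hX.isPolyhedralComplex
    hY.isPolyhedralComplex (γ := γ)
  ext w
  constructor
  · rintro ⟨γ, hγ, -, hw⟩
    exact ((hf γ).1 hγ).2.1 hw
  · intro hw
    obtain ⟨γ, h1, h2, h3, h4⟩ := exists_stableMult_ne_zero hX hY hX0 hY0 hw
    exact ⟨γ, (hf γ).2 ((isStableFacet_iff hX hY).2 ⟨h1, h3, h4⟩), h4, h2⟩

end WeightedComplex

end Trop

theorem mainTheorem1 (n p q : ℕ) (X Y : Trop.WeightedComplex n)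
    (hX : X.IsTropicalCycle p) (hY : Y.IsTropicalCycle q) :
    -- the multiplicities of the cells of codimension `p + q` are well defined
    (∀ γ ∈ X.commonCells Y, Trop.dim γ + (p + q) = n →
      Trop.IsGenericValue ((X.link γ).sumMult (Y.link γ).reflect) (X.stableMult Y γ)) ∧
    -- `X · Y` is a tropical cycle of codimension `p + q`
    (X.stableIntersection Y p q).IsTropicalCycle (p + q) ∧
    -- integral multiplicities give integral multiplicities
    ((∀ σ, X.IsFacet σ → ∃ k : ℤ, X.mult σ = k) → (∀ σ, Y.IsFacet σ → ∃ k : ℤ, Y.mult σ = k) →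
      ∀ γ, (X.stableIntersection Y p q).IsFacet γ →
        ∃ k : ℤ, (X.stableIntersection Y p q).mult γ = k) ∧
    -- for non-negative multiplicities the support of `X · Y` is the whole stable set,
    -- which is therefore pure of codimension `p + q`
    ((∀ σ, X.IsFacet σ → 0 ≤ X.mult σ) → (∀ σ, Y.IsFacet σ → 0 ≤ Y.mult σ) →
      (X.stableIntersection Y p q).supp = X.stableSet Y) := by
  refine ⟨fun γ hγ hd => Trop.isGenericValue_of_eventually
    (Trop.WeightedComplex.eventually_sumMult_eq hX hY hγ hd),
    Trop.WeightedComplex.stableIntersection_isTropicalCycle hX hY, fun hXi hYi γ hγ => ?_,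
    Trop.WeightedComplex.supp_stableIntersection_eq hX hY⟩
  have h := (Trop.WeightedComplex.isFacet_stableIntersection_iff hX.isPolyhedralComplex
    hY.isPolyhedralComplex).1 hγ
  exact Trop.WeightedComplex.exists_int_stableMult hX hY hXi hYi h.1 h.2.2.1
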